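/- **Setting.** Let $\Lambda=\begin{bmatrix}0&1\\ \zeta&0\end{bmatrix}$, $H_n=\mathrm{diag}(\zeta^n,-\zeta^n)$, and let $t=(t_1,t_2,\dots)$, $\bar t=(\bar t_1,\bar t_2,\dots)$ be complex times, almost all zero. For a formal series $A=\sum_i A_i\Lambda^i$ with diagonal $2\times2$ coefficients put $A_{\ge0}=\sum_{i\ge0}A_i\Lambda^i$, $A_{<0}=\sum_{i<0}A_i\Lambda^i$. The unknowns are functions of $(t,\bar t)$ of the form $$g_{<0}=I+W_1\Lambda^{-1}+W_2\Lambda^{-2}+\cdots,\quad g_0=\mathrm{diag}(e^{\phi},e^{-\phi}),\quad g_{>0}=I+\bar W_1\Lambda+\bar W_2\Lambda^2+\cdots,$$ with $W_i,\bar W_i$ diagonal, $\det g_{<0}=\det g_{>0}=1$, $W_1=\mathrm{diag}(q,r)$, $\bar W_1=\mathrm{diag}(\bar q,\bar r)$; put $g_{\ge0}=g_0g_{>0}$. The Sato–Wilson equations of the modified Pohlmeyer–Lund–Regge hierarchy are, for $n\ge1$, $$\partial_{t_n}g_{<0}=-(g_{<0}H_ng_{<0}^{-1})_{<0}\,g_{<0},\qquad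 \partial_{t_n}g_{\ge0}=(g_{<0}H_ng_{<0}^{-1})_{\ge0}\,g_{\ge0},$$ $$\partial_{\bar t_n}g_{<0}=(g_{\ge0}H_{-n}g_{\ge0}^{-1})_{<0}\,g_{<0},\qquad \partial_{\bar t_n}g_{\ge0}=-(g_{\ge0}H_{-n}g_{\ge0}^{-1})_{\ge0}\,g_{\ge0}.$$ **Transformations.** Let $S_0=\begin{bmatrix}0&\zeta^{-1}\\-\zeta&0\end{bmatrix}$, $S_1=\begin{bmatrix}0&-1\\1&0\end{bmatrix}$, $P=\begin{bmatrix}0&\zeta^{-1/2}\\-\zeta^{1/2}&0\end{bmatrix}$ and $$G_0^L=\begin{bmatrix}-1/q&0\\ \zeta&-q\end{bmatrix},\ G_1^L=\begin{bmatrix}-r&1\\0&-1/r\end{bmatrix},\ \bar G_0^L=\begin{bmatrix}1&0\\-\zeta e^{2\phi}/q&1\end{bmatrix},\ \bar G_1^L=\begin{bmatrix}1&-1/(re^{2\phi})\\0&1\end{bmatrix},$$ $$G_0^R=\begin{bmatrix}1&-\zeta^{-1}e^{2\phi}/\bar r\\0&1\end{bmatrix},\ G_1^R=\begin{bmatrix}1&0\\-1/(\bar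 qe^{2\phi})&1\end{bmatrix},\ \bar G_0^R=\begin{bmatrix}\bar r&-\zeta^{-1}\\0&1/\bar r\end{bmatrix},\ \bar G_1^R=\begin{bmatrix}1/\bar q&0\\-1&\bar q\end{bmatrix}.$$ The six basic transformations are as follows. * $\sigma$ replaces $(W_i,\bar W_i,\phi)$ at $(t,\bar t)$ by $(\bar W_i,W_i,-\phi)$ at $(\bar t,t)$. * $s_i^L$ ($i=0,1$) replaces $(g_{<0},g_0,g_{>0})$ at $(t,\bar t)$ by $(G_i^Lg_{<0}S_i,\;G_i^Lg_0(\bar G_i^L)^{-1},\;\bar G_i^Lg_{>0})$ at $(-t,\bar t)$; it is defined where $q\ne0$ ($i=0$), resp. $r\neq0$ ($i=1$). * $s_i^R$ ($i=0,1$) replaces it by $(G_i^Rg_{<0},\;G_i^Rg_0(\bar G_i^R)^{-1},\;\bar G_i^Rg_{>0}S_i)$ at $(t,-\bar t)$; it is defined where $\bar r\ne0$ ($i=0$), resp. $\bar q\neq0$ ($i=1$). * $\pi$ replaces it by $(P^{-1}g_{<0}P,\;P^{-1}g_0P,\;P^{-1}g_{>0}P)$ at $(-t,-\bar t)$. **Theorem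 1.** 1. Each of the six transformations, where it is defined, yields again a triple of the above form, which again lies in the domain of definition of that transformation, and it maps solutions of the Sato–Wilson equations to solutions. The same holds for the system of equations with $n$ restricted to any given set of indices. 2. Wherever the compositions are defined, on $q,r,\bar q,\bar r$ (indeed on $g_{<0}$ and $g_{>0}$) one has, for $i=0,1$, $$\sigma^2=(s_i^L)^2=(s_i^R)^2=\pi^2=\mathrm{Id},\quad \pi s_0^L=s_1^L\pi,\quad \pi s_0^R=s_1^R\pi,\quad \sigma s_0^L=s_1^R\sigma,\quad \sigma s_1^L=s_0^R\sigma,$$ and on $e^{\phi}$ (hence on $g_0$) one has $$\sigma^2=\pi^2=\mathrm{Id},\quad (s_i^L)^2=(s_i^R)^2=-\mathrm{Id},\quad (s_i^L)^4=(s_i^R)^4=\mathrm{Id},$$ $$\pi s_0^L=-s_1^L\pi,\quad \pi s_0^R=-s_1^R\pi,\quad \sigma s_0^L=-s_1^R\sigma,\quad \sigma s_1^L=-s_0^R\sigma.$$ 3. The groups $\widetilde W_L=\langle s_0^L,s_1^L,\pi\rangle$ and $\widetilde W_R=\langle s_0^R,s_1^R,\pi\rangle$ generated by these transformations on the variables $q,r,\bar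 q,\bar r$ of solutions are extended affine Weyl groups of type $A_1^{(1)}$. More precisely, a word in $s_0,s_1,\pi$ acts as the identity on $q,r,\bar q,\bar r$ of every local solution of the hierarchy, wherever it is defined, if and only if it represents the identity in $\widetilde W=W(A_1^{(1)})\rtimes\mathrm{Aut}(\text{Dynkin diagram})$; and the group of words modulo those acting as the identity is isomorphic to $\widetilde W$, where $s_0,s_1,\pi$ correspond to the simple reflections and the diagram automorphism exchanging them. -/

import Mathlib

open Filter Topology

noncomputable section

namespace MPLR

/-! ### Formal loop-algebra elements

A `2 × 2` matrix `A = ∑ Aₘ Λ^m` (`Aₘ` diagonal, `Λ = !![0, 1; ζ, 0]`) whose powers of `Λ` are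
bounded above is a matrix over `ℂ((ζ⁻¹))`, one whose powers are bounded below is a matrix over
`ℂ((ζ))`.  Both fields are the field of Laurent series in one variable `X`: we have `X = ζ⁻¹` in the
first case (expansion at `ζ = ∞`) and `X = ζ` in the second one (expansion at `ζ = 0`). -/

/-- Formal Laurent series, in `X = ζ⁻¹` or in `X = ζ`. -/
abbrev Ser : Type := LaurentSeries ℂ

/-- `2 × 2` matrices of formal Laurent series. -/
abbrev Mat : Type := Matrix (Fin 2) (Fin 2) Ser

/-- The loop parameter `ζ` as an element of `ℂ((ζ⁻¹))`. -/
def zetaInf : Ser := HahnSeries.single (-1 : ℤ) (1 : ℂ)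

/-- The loop parameter `ζ` as an element of `ℂ((ζ))`. -/
def zetaZero : Ser := HahnSeries.single (1 : ℤ) (1 : ℂ)

/-- Constants as Laurent series. -/
def cst (a : ℂ) : Ser := HahnSeries.C a

/-- The `Λ`-degree of the matrix unit `E_{ij} ζ^k`.
Indeed `Λ^(2k) = ζ^k I` and `Λ^(2k+1) = ζ^k E₀₁ + ζ^(k+1) E₁₀`. -/
def lamDeg (i j : Fin 2) (k : ℤ) : ℤ := 2 * k + (j : ℤ) - (i : ℤ)

/-- For `A` over `ℂ((ζ⁻¹))`, the part `A_{≥0}` of nonnegative powers of `Λ`.  Its entries are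
polynomials in `ζ`, here evaluated at `z`, so that `z = zetaInf` and `z = zetaZero` give
`A_{≥0}` as a matrix over `ℂ((ζ⁻¹))` and over `ℂ((ζ))`. -/
def lamNonneg (A : Mat) (z : Ser) : Mat := Matrix.of fun i j =>
  ∑ k ∈ (Finset.Icc 0 (-(A i j).order)).filter (fun k => 0 ≤ lamDeg i j k),
    cst ((A i j).coeff (-k)) * z ^ k

/-- For `A` over `ℂ((ζ))`, the part `A_{<0}` of negative powers of `Λ`.  Its entries are
polynomials in `ζ⁻¹`, here evaluated at `ζ = z`. -/
def lamNeg (A : Mat) (z : Ser) : Mat := Matrix.of fun i j =>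
  ∑ k ∈ (Finset.Icc (A i j).order 0).filter (fun k => lamDeg i j k < 0),
    cst ((A i j).coeff k) * z ^ k

/-- The element `H_n = diag(ζ^n, -ζ^n)` of the homogeneous Heisenberg subalgebra. -/
def Hmat (z : Ser) (n : ℤ) : Mat := !![z ^ n, 0; 0, -z ^ n]

/-! ### The dependent variables -/

/-- The value of the triple `(g_{<0}, g_0, g_{>0})` at one point: `neg` is a matrix over
`ℂ((ζ⁻¹))`, `zero` and `pos` are matrices over `ℂ((ζ))`. -/
@[ext]
structure Triple where
  /-- The factor `g_{<0}`. -/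
  neg : Mat
  /-- The factor `g_0`. -/
  zero : Mat
  /-- The factor `g_{>0}`. -/
  pos : Mat

namespace Triple

/-- `q`, the first diagonal entry of `W_1`: coefficient of `ζ⁻¹ E₀₁` in `g_{<0}`. -/
def q (m : Triple) : ℂ := (m.neg 0 1).coeff 1

/-- `r`, the second diagonal entry of `W_1`: coefficient of `E₁₀` in `g_{<0}`. -/
def r (m : Triple) : ℂ := (m.neg 1 0).coeff 0

/-- `q̄`, the first diagonal entry of `W̄_1`: coefficient of `E₀₁` in `g_{>0}`. -/
def qb (m : Triple) : ℂ := (m.pos 0 1).coeff 0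

/-- `r̄`, the second diagonal entry of `W̄_1`: coefficient of `ζ E₁₀` in `g_{>0}`. -/
def rb (m : Triple) : ℂ := (m.pos 1 0).coeff 1

/-- `e^φ`, where `g_0 = diag(e^φ, e^{-φ})`. -/
def ephi (m : Triple) : ℂ := (m.zero 0 0).coeff 0

/-- The factor `g_{≥0} = g_0 g_{>0}`. -/
def nonneg (m : Triple) : Mat := m.zero * m.pos

/-- The normal form of a Gauss decomposition: `g_{<0} = I + W_1 Λ⁻¹ + W_2 Λ⁻² + ⋯`,
`g_0 = exp Φ` with `Φ = diag(φ, -φ)`, `g_{>0} = I + W̄_1 Λ + W̄_2 Λ² + ⋯`, all of determinant one. -/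
def Normal (m : Triple) : Prop :=
  (∀ i j k, 0 ≤ lamDeg i j k →
      (m.neg i j).coeff (-k) = if i = j ∧ k = 0 then 1 else 0) ∧
  m.neg.det = 1 ∧
  (∃ φ : ℂ, m.zero = !![cst (Complex.exp φ), 0; 0, cst (Complex.exp (-φ))]) ∧
  (∀ i j k, lamDeg i j k ≤ 0 →
      (m.pos i j).coeff k = if i = j ∧ k = 0 then 1 else 0) ∧
  m.pos.det = 1

end Triple

/-! ### Sato–Wilson equations -/

/-- The times `(t, t̄)`, `t = (t_1, t_2, …)`, `t̄ = (t̄_1, t̄_2, …)`, almost all of them zero. -/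
abbrev Times : Type := (ℕ+ →₀ ℂ) × (ℕ+ →₀ ℂ)

/-- The point `p` with `s` added to the time `t_n`. -/
def shiftT (n : ℕ+) (p : Times) (s : ℂ) : Times := (p.1 + Finsupp.single n s, p.2)

/-- The point `p` with `s` added to the time `t̄_n`. -/
def shiftTbar (n : ℕ+) (p : Times) (s : ℂ) : Times := (p.1, p.2 + Finsupp.single n s)

/-- At `p`, the derivative of `F` along the line `s ↦ line p s` exists coefficientwise and
equals `D`. -/
def HasPartial (line : Times → ℂ → Times) (F : Times → Mat) (p : Times) (D : Mat) : Prop :=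
  ∀ i j k, HasDerivAt (fun s : ℂ => (F (line p s) i j).coeff k) ((D i j).coeff k) 0

/-- The four Sato–Wilson equations with index `n`, at the point `p`. -/
def SatoWilsonAt (n : ℕ+) (x : Times → Triple) (p : Times) : Prop :=
  let gneg := (x p).neg
  let gnn := (x p).nonneg
  let A : Mat := gneg * Hmat zetaInf (n : ℤ) * gneg⁻¹
  let C : Mat := gnn * Hmat zetaZero (-(n : ℤ)) * gnn⁻¹
  HasPartial (shiftT n) (fun p' => (x p').neg) p (-(A - lamNonneg A zetaInf) * gneg) ∧
  HasPartial (shiftT n) (fun p' => (x p').nonneg) p (lamNonneg A zetaZero * gnn) ∧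
  HasPartial (shiftTbar n) (fun p' => (x p').neg) p (lamNeg C zetaInf * gneg) ∧
  HasPartial (shiftTbar n) (fun p' => (x p').nonneg) p (-(C - lamNeg C zetaZero) * gnn)

/-- `U` is open along each coordinate line of a time `t_n` or `t̄_n` with `n ∈ N`.  Every set that is
open in a usual sense has this property. -/
def CoordOpen (N : Set ℕ+) (U : Set Times) : Prop :=
  ∀ p ∈ U, ∀ n ∈ N, (∀ᶠ s in 𝓝 (0 : ℂ), shiftT n p s ∈ U) ∧
    (∀ᶠ s in 𝓝 (0 : ℂ), shiftTbar n p s ∈ U)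

/-- On `U`, `x = (g_{<0}, g_0, g_{>0})` satisfies the Sato–Wilson equations with indices `n ∈ N`.
`N = Set.univ` is the whole hierarchy, `N = {1}` the equations in `t_1, t̄_1` alone. -/
def SolutionOn (N : Set ℕ+) (U : Set Times) (x : Times → Triple) : Prop :=
  CoordOpen N U ∧ ∀ p ∈ U, (x p).Normal ∧ ∀ n ∈ N, SatoWilsonAt n x p

/-! ### The six basic transformations -/

/-- The matrices `S_0`, `S_1`. -/
def S (z : Ser) : Fin 2 → Mat
  | 0 => !![0, z⁻¹; -z, 0]
  | 1 => !![0, -1; 1, 0]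

/-- The matrices `G_0^L`, `G_1^L`. -/
def gaugeL (z : Ser) (m : Triple) : Fin 2 → Mat
  | 0 => !![cst (-1 / m.q), 0; z, cst (-m.q)]
  | 1 => !![cst (-m.r), 1; 0, cst (-1 / m.r)]

/-- The matrices `Ḡ_0^L`, `Ḡ_1^L`. -/
def gaugeBarL (z : Ser) (m : Triple) : Fin 2 → Mat
  | 0 => !![1, 0; -z * cst (m.ephi ^ 2 / m.q), 1]
  | 1 => !![1, cst (-1 / (m.r * m.ephi ^ 2)); 0, 1]

/-- The matrices `G_0^R`, `G_1^R`. -/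
def gaugeR (z : Ser) (m : Triple) : Fin 2 → Mat
  | 0 => !![1, -z⁻¹ * cst (m.ephi ^ 2 / m.rb); 0, 1]
  | 1 => !![1, 0; cst (-1 / (m.qb * m.ephi ^ 2)), 1]

/-- The matrices `Ḡ_0^R`, `Ḡ_1^R`. -/
def gaugeBarR (z : Ser) (m : Triple) : Fin 2 → Mat
  | 0 => !![cst m.rb, -z⁻¹; 0, cst (1 / m.rb)]
  | 1 => !![cst (1 / m.qb), 0; -1, cst m.qb]

/-- The map `∑ Aₘ Λ^m ↦ ∑ Aₘ Λ^(-m)` between matrices over `ℂ((ζ⁻¹))` and over `ℂ((ζ))`; `z` is the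
parameter `ζ` of the target.  On entries,
`!![a(ζ), b(ζ); c(ζ), d(ζ)] ↦ !![a(ζ⁻¹), ζ⁻¹ b(ζ⁻¹); ζ c(ζ⁻¹), d(ζ⁻¹)]`. -/
def flip (z : Ser) (A : Mat) : Mat := !![A 0 0, z⁻¹ * A 0 1; z * A 1 0, A 1 1]

/-- Conjugation `A ↦ P⁻¹ A P` by `P = !![0, ζ^(-1/2); -ζ^(1/2), 0]`.  The matrix
`ζ^(-1/2) P = !![0, ζ⁻¹; -1, 0]` gives the same conjugation and has no half-integer powers. -/
def conjP (z : Ser) (A : Mat) : Mat := (!![0, z⁻¹; -1, 0] : Mat)⁻¹ * A * !![0, z⁻¹; -1, 0]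

/-- Names of the six basic transformations `σ`, `s_i^L`, `s_i^R`, `π`. -/
inductive Gen where
  | sigma : Gen
  | sL (i : Fin 2) : Gen
  | sR (i : Fin 2) : Gen
  | pi : Gen

/-- The change of the times that goes with a basic transformation. -/
def timeMap : Gen → Times → Times
  | .sigma, p => (p.2, p.1)
  | .sL _, p => (-p.1, p.2)
  | .sR _, p => (p.1, -p.2)
  | .pi, p => (-p.1, -p.2)

/-- The action of a basic transformation on the values of `(g_{<0}, g_0, g_{>0})`. -/
def act : Gen → Triple → Triple
  | .sigma, m => ⟨flip zetaInf m.pos, m.zero⁻¹, flip zetaZero m.neg⟩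
  | .sL i, m => ⟨gaugeL zetaInf m i * m.neg * S zetaInf i,
      gaugeL zetaZero m i * m.zero * (gaugeBarL zetaZero m i)⁻¹, gaugeBarL zetaZero m i * m.pos⟩
  | .sR i, m => ⟨gaugeR zetaInf m i * m.neg,
      gaugeR zetaZero m i * m.zero * (gaugeBarR zetaZero m i)⁻¹,
      gaugeBarR zetaZero m i * m.pos * S zetaZero i⟩
  | .pi, m => ⟨conjP zetaInf m.neg, conjP zetaZero m.zero, conjP zetaZero m.pos⟩

/-- The denominator of a basic transformation does not vanish. -/
def Regular : Gen → Triple → Prop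
  | .sigma, _ => True
  | .sL 0, m => m.q ≠ 0
  | .sL 1, m => m.r ≠ 0
  | .sR 0, m => m.rb ≠ 0
  | .sR 1, m => m.qb ≠ 0
  | .pi, _ => True

/-- A basic transformation acting on `(g_{<0}, g_0, g_{>0})` as functions of the times. -/
def apply (g : Gen) (x : Times → Triple) : Times → Triple := fun p => act g (x (timeMap g p))

/-- The points where `apply g x` is defined, for `x` defined on `U`. -/
def domain (g : Gen) (U : Set Times) (x : Times → Triple) : Set Times :=
  {p | timeMap g p ∈ U ∧ Regular g (x (timeMap g p))}

/-! ### Compositions -/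

/-- The composition `g₁ g₂ ⋯ g_k` for a list `[g₁, …, g_k]`. -/
def applyWord : List Gen → (Times → Triple) → Times → Triple
  | [], x => x
  | g :: w, x => apply g (applyWord w x)

/-- The value at `p` of the composition is defined: no denominator vanishes on the way. -/
def DefinedAt : List Gen → (Times → Triple) → Times → Prop
  | [], x, p => (x p).Normal
  | g :: w, x, p => DefinedAt w x (timeMap g p) ∧ Regular g (applyWord w x (timeMap g p))

/-- `m` and `m'` have the same `g_{<0}` and `g_{>0}` (in particular the same `q, r, q̄, r̄`), and
the values of `g_0 = diag(e^φ, e^{-φ})` differ by the factor `ε`. -/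
def EqUpTo (ε : ℤ) (m m' : Triple) : Prop :=
  m.neg = m'.neg ∧ m.pos = m'.pos ∧ m.zero = ε • m'.zero

/-- The relation `w = w'` on `q, r, q̄, r̄`, and `w = ε w'` on `e^φ`, at each point where `w` is
defined. -/
def Rel (w w' : List Gen) (ε : ℤ) : Prop :=
  ∀ (x : Times → Triple) (p : Times), DefinedAt w x p →
    DefinedAt w' x p ∧ EqUpTo ε (applyWord w x p) (applyWord w' x p)

/-- `m` and `m'` have the same `q, r, q̄, r̄`. -/
def SameVars (m m' : Triple) : Prop := m.q = m'.q ∧ m.r = m'.r ∧ m.qb = m'.qb ∧ m.rb = m'.rb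

/-! ### The groups generated by the left, resp. right, transformations and `π` -/

/-- Generators `s_0, s_1, π`. -/
inductive ExtGen where
  | s (i : Fin 2) : ExtGen
  | pi : ExtGen

/-- The left transformations `s_0^L, s_1^L, π`. -/
def leftGen : ExtGen → Gen
  | .s i => .sL i
  | .pi => .pi

/-- The right transformations `s_0^R, s_1^R, π`. -/
def rightGen : ExtGen → Gen
  | .s i => .sR i
  | .pi => .pi

/-- A word in the generators acts as the identity on the variables `q, r, q̄, r̄` of all solutions
of the hierarchy, wherever it is defined. -/
def ActsTrivially (γ : ExtGen → Gen) (l : List ExtGen) : Prop :=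
  ∀ (U : Set Times) (x : Times → Triple), SolutionOn Set.univ U x → ∀ p ∈ U,
    DefinedAt (l.map γ) x p → SameVars (applyWord (l.map γ) x p) (x p)

/-- The words, as elements of the free group, that act as the identity on `q, r, q̄, r̄`. -/
def trivialWords (γ : ExtGen → Gen) : Set (FreeGroup ExtGen) :=
  {w | ∃ l : List ExtGen, w = (l.map FreeGroup.of).prod ∧ ActsTrivially γ l}

/-- The group generated by the three transformations `γ (s 0)`, `γ (s 1)`, `γ π`, acting on the
variables `q, r, q̄, r̄`: words modulo those that act as the identity. -/
abbrev TransformationGroup (γ : ExtGen → Gen) : Type := PresentedGroup (trivialWords γ)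

/-- The Coxeter matrix of type `A_1^{(1)}`: `m(0,1) = ∞`, which is encoded by `0`. -/
def affineA1 : CoxeterMatrix (Fin 2) where
  M := Matrix.of fun i j => if i = j then 1 else 0
  isSymm := by decide
  diagonal := by decide
  off_diagonal := by
    intro i j h
    simp [h]

/-- The affine Weyl group `W(A_1^{(1)})`. -/
abbrev AffineWeyl : Type := affineA1.Group

theorem affineA1_liftable (e : Equiv.Perm (Fin 2)) :
    affineA1.IsLiftable (fun i => affineA1.simple (e i)) := by
  intro i j
  by_cases h : i = j
  · subst h
    have h1 := affineA1.toCoxeterSystem.simple_mul_simple_self (e i)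
    rw [CoxeterMatrix.toCoxeterSystem_simple] at h1
    simp [h1]
  · have h0 : affineA1 i j = 0 := by
      change (if i = j then 1 else 0) = 0
      simp [h]
    simp [h0]

/-- The endomorphism of `W(A_1^{(1)})` with `s_i ↦ s_{e(i)}`. -/
def diagramHom (e : Equiv.Perm (Fin 2)) : AffineWeyl →* AffineWeyl :=
  affineA1.toCoxeterSystem.lift ⟨fun i => affineA1.simple (e i), affineA1_liftable e⟩

theorem diagramHom_simple (e : Equiv.Perm (Fin 2)) (i : Fin 2) :
    diagramHom e (affineA1.simple i) = affineA1.simple (e i) := by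
  have h := affineA1.toCoxeterSystem.lift_apply_simple (affineA1_liftable e) i
  rwa [CoxeterMatrix.toCoxeterSystem_simple] at h

theorem diagramHom_comp (e f : Equiv.Perm (Fin 2)) :
    (diagramHom e).comp (diagramHom f) = diagramHom (e * f) := by
  apply affineA1.toCoxeterSystem.ext_simple
  intro i
  simp [CoxeterMatrix.toCoxeterSystem_simple, diagramHom_simple]

theorem diagramHom_one : diagramHom 1 = MonoidHom.id AffineWeyl := by
  apply affineA1.toCoxeterSystem.ext_simple
  intro i
  simp [CoxeterMatrix.toCoxeterSystem_simple, diagramHom_simple]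

/-- The action of the automorphisms of the Dynkin diagram (all permutations of its two nodes) on
`W(A_1^{(1)})`. -/
def diagramAut : Equiv.Perm (Fin 2) →* MulAut AffineWeyl where
  toFun e := MonoidHom.toMulEquiv (diagramHom e) (diagramHom e⁻¹)
    (by rw [diagramHom_comp, inv_mul_cancel, diagramHom_one])
    (by rw [diagramHom_comp, mul_inv_cancel, diagramHom_one])
  map_one' := by
    ext w
    simp [diagramHom_one]
  map_mul' e f := by
    ext w
    simp [← diagramHom_comp]

/-- The extended affine Weyl group of type `A_1^{(1)}`: the semidirect product of the affine Weyl
group and the group (of order two) of automorphisms of its Dynkin diagram. -/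
abbrev ExtAffineWeyl : Type := AffineWeyl ⋊[diagramAut] Equiv.Perm (Fin 2)

/-- The generators of the extended affine Weyl group: the simple reflections `s_0`, `s_1` and the
diagram automorphism `π`, which exchanges the two nodes. -/
def weylGen : ExtGen → ExtAffineWeyl
  | .s i => SemidirectProduct.inl (affineA1.simple i)
  | .pi => SemidirectProduct.inr (Equiv.swap 0 1)

end MPLR

end

noncomputable section

namespace MPLR

/-! ### Coefficients of Laurent series -/

/-! Up to the sign of g_0, three of the transformations generate the others: s_1^L = -π s_0^L π and
s_i^R = -σ s_{1-i}^L σ (`act_sL_one_eq`, `act_sR_eq`). The sign is harmless, because the gauge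
matrices see e^φ only through its square and the equations are linear in g_{≥0}. Matrix computations
give these formulas and the properties of σ, π and s_0^L; the rest follows by conjugation.

Solutions go to solutions for the following reason. A t_n-flow or t̄_n-flow at a point amounts to
one Laurent polynomial matrix B, expanded at ζ = ∞ to act on g_{<0} and at ζ = 0 to act on g_{≥0},
and pinned down by degree conditions in Λ (`satoWilsonAt_iff`). Replacing g by Gg replaces B by
G'G⁻¹ + GBG⁻¹, so only the degree conditions must be checked. At most a few leading coefficients
violate them, and these cancel because of the evolution equation of q (for s_0^L, `isNegInf_gauge`)
or of φ (for σ, `isNegInf_flip`). The reversal of times comes from S_0 and P anticommuting with H_n.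

For the group statement, every element of the extended affine Weyl group is uniquely e w_n, with e a
diagram automorphism and w_n an alternating word, n an integer. The relations reduce every word of
transformations to such a normal form without shrinking its domain, so words trivial in the group
act trivially (`IsExtTriple.reduces_wordState`).

Conversely, solutions are needed on which different normal forms of bounded length act differently.
If F = ∑ F_k ζ^k solves ∂F/∂t_n = 2ζ^n F and ∂F/∂t̄_n = 2ζ^{-n} F, splitting F into its negative and
nonnegative powers gives an upper triangular solution (`LinearSolution.solutionOn`). Take F to be a
superposition of exponentials, so that at the origin the negative part is the moment series of the
uniform measure on -2, …, -(M+1). Applying s_0^L and s_1^L alternately then produces Padé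
approximants: entries of g_{<0} are built from monic orthogonal polynomials, and at the successive
steps q = -⟨A, A⟩ and r = ⟨Q, XQ⟩ are negative (`EvenStage.exists_q_neg`, `OddStage.exists_r_neg`).
Hence no denominator vanishes for 2M steps, and each step strictly increases q̄ + r̄, so the values
are distinct. A bound on q̄ and r̄ separates them from their images under π (`isChain_chain`).
Started in the middle of such a chain, a word moves along it exactly as it moves the index n, so a
word acting trivially has n = 0 and e = 1 (`wordState_eq_of_actsTrivially`). The right-hand case is
the image of the left-hand one under σ. -/

theorem zetaInf_eq_inv : zetaInf = zetaZero⁻¹ := by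
  simp [zetaInf, zetaZero, HahnSeries.inv_single]

theorem zetaZero_ne_zero : zetaZero ≠ 0 := by simp [zetaZero]

theorem zetaInf_ne_zero : zetaInf ≠ 0 := by simp [zetaInf]

theorem zetaZero_zpow (n : ℤ) : zetaZero ^ n = HahnSeries.single n (1 : ℂ) := by
  rw [zetaZero, RatFunc.single_zpow n]

theorem zetaInf_zpow (n : ℤ) : zetaInf ^ n = HahnSeries.single (-n) (1 : ℂ) := by
  rw [zetaInf_eq_inv, inv_zpow', zetaZero_zpow]

@[simp] theorem cst_one : cst 1 = 1 := map_one HahnSeries.C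
theorem cst_mul (a b : ℂ) : cst (a * b) = cst a * cst b := map_mul HahnSeries.C a b
theorem cst_neg (a : ℂ) : cst (-a) = -cst a := map_neg HahnSeries.C a
theorem cst_div (a b : ℂ) : cst (a / b) = cst a / cst b := map_div₀ HahnSeries.C a b
theorem cst_inv (a : ℂ) : cst a⁻¹ = (cst a)⁻¹ := map_inv₀ HahnSeries.C a
theorem cst_pow (a : ℂ) (n : ℕ) : cst (a ^ n) = cst a ^ n := map_pow HahnSeries.C a n

theorem cst_ne_zero {a : ℂ} (h : a ≠ 0) : cst a ≠ 0 :=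
  (map_ne_zero_iff (HahnSeries.C : ℂ →+* Ser) HahnSeries.C_injective).2 h

@[simp] theorem coeff_cst_mul (a : ℂ) (f : Ser) (k : ℤ) : (cst a * f).coeff k = a * f.coeff k := by
  simp [cst, HahnSeries.C_apply]

@[simp] theorem coeff_zetaZero_mul (f : Ser) (k : ℤ) :
    (zetaZero * f).coeff k = f.coeff (k - 1) := by
  simp [zetaZero, HahnSeries.coeff_single_mul]

@[simp] theorem coeff_zetaInf_mul (f : Ser) (k : ℤ) : (zetaInf * f).coeff k = f.coeff (k + 1) := by
  simp [zetaInf, HahnSeries.coeff_single_mul]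

theorem coeff_cst (a : ℂ) (k : ℤ) : (cst a).coeff k = if k = 0 then a else 0 := by
  simp [cst, HahnSeries.C_apply, HahnSeries.coeff_single]

/-! ### Explicit form of the transformations -/

namespace Triple

/-- The triple with `g_0` replaced by `-g_0`. -/
def negZero (m : Triple) : Triple := ⟨m.neg, -m.zero, m.pos⟩

theorem negZero_negZero (m : Triple) : m.negZero.negZero = m := by simp [negZero]

theorem Normal.exists_zero {m : Triple} (h : m.Normal) :
    m.ephi ≠ 0 ∧ m.zero = !![cst m.ephi, 0; 0, cst (1 / m.ephi)] := by
  obtain ⟨φ, hφ⟩ := h.2.2.1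
  have : m.ephi = Complex.exp φ := by simp [ephi, hφ, coeff_cst]
  rw [this]
  refine ⟨Complex.exp_ne_zero φ, ?_⟩
  rw [hφ, Complex.exp_neg, one_div]

theorem normal_of_zero {m : Triple}
    (h1 : ∀ i j k, 0 ≤ lamDeg i j k → (m.neg i j).coeff (-k) = if i = j ∧ k = 0 then 1 else 0)
    (h2 : m.neg.det = 1) {e : ℂ} (he : e ≠ 0) (h3 : m.zero = !![cst e, 0; 0, cst (1 / e)])
    (h4 : ∀ i j k, lamDeg i j k ≤ 0 → (m.pos i j).coeff k = if i = j ∧ k = 0 then 1 else 0)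
    (h5 : m.pos.det = 1) : m.Normal :=
  ⟨h1, h2, ⟨Complex.log e, by rw [h3, Complex.exp_neg, Complex.exp_log he, one_div]⟩, h4, h5⟩

theorem Normal.negZero {m : Triple} (h : m.Normal) : m.negZero.Normal := by
  obtain ⟨he, hz⟩ := h.exists_zero
  refine normal_of_zero h.1 h.2.1 (neg_ne_zero.2 he) ?_ h.2.2.2.1 h.2.2.2.2
  simp [Triple.negZero, hz, cst_neg, div_neg]

end Triple

theorem eqUpTo_one {m m' : Triple} : EqUpTo 1 m m' ↔ m = m' := by
  simp [EqUpTo, Triple.ext_iff]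
  tauto

theorem eqUpTo_neg_one {m m' : Triple} : EqUpTo (-1) m m' ↔ m = m'.negZero := by
  simp [EqUpTo, Triple.ext_iff, Triple.negZero]
  tauto

theorem ephi_negZero (m : Triple) : m.negZero.ephi = -m.ephi := by
  simp [Triple.ephi, Triple.negZero]

theorem mat_ext {A B : Mat} (h00 : A 0 0 = B 0 0) (h01 : A 0 1 = B 0 1) (h10 : A 1 0 = B 1 0)
    (h11 : A 1 1 = B 1 1) : A = B := by
  ext1 i j
  fin_cases i <;> fin_cases j <;> assumption

theorem mat_neg_mul (A B : Mat) : -A * B = -(A * B) := neg_mul A B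

theorem mat_mul_neg (A B : Mat) : A * -B = -(A * B) := mul_neg A B

theorem inv_neg_mat (A : Mat) : (-A)⁻¹ = -A⁻¹ := by
  have h : Matrix.adjugate (-A) = -Matrix.adjugate A := by
    rw [Matrix.adjugate_fin_two, Matrix.adjugate_fin_two]
    simp
  rw [Matrix.inv_def, Matrix.inv_def, Matrix.det_neg, h, Fintype.card_fin,
    show ((-1 : Ser) ^ 2) = 1 by ring, one_mul]
  ext1 i j
  simp only [Matrix.smul_apply, Matrix.neg_apply, smul_eq_mul]
  ring

theorem regular_negZero (g : Gen) (m : Triple) : Regular g m.negZero ↔ Regular g m := by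
  cases g with
  | sL i => fin_cases i <;> exact Iff.rfl
  | sR i => fin_cases i <;> exact Iff.rfl
  | _ => exact Iff.rfl

/-- The gauge matrices depend on e^φ only through its square, so a sign of g_0 passes through
unchanged. All later conjugation arguments up to sign rest on this. -/
theorem act_negZero (g : Gen) (m : Triple) : act g m.negZero = (act g m).negZero := by
  have he := ephi_negZero m
  cases g with
  | sigma => simp [act, Triple.negZero, inv_neg_mat]
  | sL i =>
    have he' : m.negZero.ephi ^ 2 = m.ephi ^ 2 := by rw [he, neg_sq]
    have h1 : ∀ z, gaugeL z m.negZero i = gaugeL z m i := by intro z; fin_cases i <;> rfl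
    have h2 : ∀ z, gaugeBarL z m.negZero i = gaugeBarL z m i := by
      intro z; fin_cases i <;> simp only [gaugeBarL, he'] <;> rfl
    simp only [act, h1, h2]
    simp [Triple.negZero]
  | sR i =>
    have he' : m.negZero.ephi ^ 2 = m.ephi ^ 2 := by rw [he, neg_sq]
    have h1 : ∀ z, gaugeR z m.negZero i = gaugeR z m i := by
      intro z; fin_cases i <;> simp only [gaugeR, he'] <;> rfl
    have h2 : ∀ z, gaugeBarR z m.negZero i = gaugeBarR z m i := by intro z; fin_cases i <;> rfl
    simp only [act, h1, h2]
    simp [Triple.negZero]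
  | pi => simp [act, Triple.negZero, conjP]

theorem inv_diag {a b : Ser} (ha : a ≠ 0) (hb : b ≠ 0) :
    (!![a, 0; 0, b] : Mat)⁻¹ = !![a⁻¹, 0; 0, b⁻¹] := by
  apply Matrix.inv_eq_left_inv
  refine mat_ext ?_ ?_ ?_ ?_ <;> simp [ha, hb]

theorem act_sigma {m : Triple} (h : m.Normal) : act .sigma m =
    ⟨!![m.pos 0 0, zetaZero * m.pos 0 1; zetaInf * m.pos 1 0, m.pos 1 1],
      !![cst (1 / m.ephi), 0; 0, cst m.ephi],
      !![m.neg 0 0, zetaInf * m.neg 0 1; zetaZero * m.neg 1 0, m.neg 1 1]⟩ := by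
  obtain ⟨he, hz⟩ := h.exists_zero
  have := cst_ne_zero he
  simp only [act, flip, hz]
  rw [inv_diag this (by simpa [cst_inv] using this)]
  simp [zetaInf_eq_inv, cst_inv]

theorem conjP_eq {z : Ser} (hz : z ≠ 0) (A : Mat) :
    conjP z A = !![A 1 1, -(z⁻¹ * A 1 0); -(z * A 0 1), A 0 0] := by
  have h : (!![0, z⁻¹; -1, 0] : Mat)⁻¹ = !![0, -1; z, 0] := by
    apply Matrix.inv_eq_left_inv
    refine mat_ext ?_ ?_ ?_ ?_ <;> simp [hz]
    ring
  rw [conjP, h]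
  refine mat_ext ?_ ?_ ?_ ?_ <;>
    simp [-Matrix.cons_mul, Matrix.mul_apply, Fin.sum_univ_two] <;> field_simp

theorem act_pi {m : Triple} (h : m.Normal) : act .pi m =
    ⟨!![m.neg 1 1, -(zetaZero * m.neg 1 0); -(zetaInf * m.neg 0 1), m.neg 0 0],
      !![cst (1 / m.ephi), 0; 0, cst m.ephi],
      !![m.pos 1 1, -(zetaInf * m.pos 1 0); -(zetaZero * m.pos 0 1), m.pos 0 0]⟩ := by
  obtain ⟨he, hz⟩ := h.exists_zero
  simp only [act, conjP_eq zetaZero_ne_zero, conjP_eq zetaInf_ne_zero, hz]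
  simp only [zetaInf_eq_inv, inv_inv]
  refine Triple.ext (mat_ext ?_ ?_ ?_ ?_) (mat_ext ?_ ?_ ?_ ?_) (mat_ext ?_ ?_ ?_ ?_) <;>
    simp

theorem inv_lower (a : Ser) : (!![1, 0; a, 1] : Mat)⁻¹ = !![1, 0; -a, 1] := by
  apply Matrix.inv_eq_left_inv
  refine mat_ext ?_ ?_ ?_ ?_ <;> simp

theorem inv_upper (a : Ser) : (!![1, a; 0, 1] : Mat)⁻¹ = !![1, -a; 0, 1] := by
  apply Matrix.inv_eq_left_inv
  refine mat_ext ?_ ?_ ?_ ?_ <;> simp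

theorem inv_upper_diag {a b : Ser} (c : Ser) (ha : a ≠ 0) (hb : b ≠ 0) :
    (!![a, c; 0, b] : Mat)⁻¹ = !![a⁻¹, -(a⁻¹ * c * b⁻¹); 0, b⁻¹] := by
  apply Matrix.inv_eq_left_inv
  refine mat_ext ?_ ?_ ?_ ?_ <;> simp [ha, hb]; field_simp; ring

theorem inv_lower_diag {a b : Ser} (c : Ser) (ha : a ≠ 0) (hb : b ≠ 0) :
    (!![a, 0; c, b] : Mat)⁻¹ = !![a⁻¹, 0; -(b⁻¹ * c * a⁻¹), b⁻¹] := by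
  apply Matrix.inv_eq_left_inv
  refine mat_ext ?_ ?_ ?_ ?_ <;> simp [ha, hb]; field_simp; ring

/-- Ḡ_0^L is chosen so that the lower left entry of G_0^L g_0 (Ḡ_0^L)⁻¹ cancels and the new g_0 is
again diagonal. -/
theorem act_sL_zero {m : Triple} (h : m.Normal) (hq : m.q ≠ 0) : act (.sL 0) m =
    ⟨!![cst (1 / m.q) * (zetaInf * m.neg 0 1), -(cst (1 / m.q) * (zetaZero * m.neg 0 0));
        cst m.q * (zetaInf * m.neg 1 1) - zetaInf * (zetaInf * m.neg 0 1),
        m.neg 0 0 - cst m.q * (zetaZero * m.neg 1 0)],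
      !![cst (-m.ephi / m.q), 0; 0, cst (-m.q / m.ephi)],
      !![m.pos 0 0, m.pos 0 1;
        m.pos 1 0 - cst (m.ephi ^ 2 / m.q) * (zetaZero * m.pos 0 0),
        m.pos 1 1 - cst (m.ephi ^ 2 / m.q) * (zetaZero * m.pos 0 1)]⟩ := by
  obtain ⟨he, hz⟩ := h.exists_zero
  have h1 := cst_ne_zero he
  have h2 := cst_ne_zero hq
  have h3 := zetaZero_ne_zero
  simp only [act, gaugeL, gaugeBarL, S, hz, inv_lower, zetaInf_eq_inv, inv_inv]
  refine Triple.ext (mat_ext ?_ ?_ ?_ ?_) (mat_ext ?_ ?_ ?_ ?_) (mat_ext ?_ ?_ ?_ ?_) <;>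
    simp [-Matrix.cons_mul, Matrix.mul_apply, Fin.sum_univ_two, cst_inv,
      cst_div, cst_neg, cst_pow] <;>
    field_simp <;> ring

theorem act_sL_one {m : Triple} (h : m.Normal) (hr : m.r ≠ 0) : act (.sL 1) m =
    ⟨!![m.neg 1 1 - cst m.r * m.neg 0 1, cst m.r * m.neg 0 0 - m.neg 1 0;
        -(cst (1 / m.r) * m.neg 1 1), cst (1 / m.r) * m.neg 1 0],
      !![cst (-m.r * m.ephi), 0; 0, cst (-1 / (m.r * m.ephi))],
      !![m.pos 0 0 - cst (1 / (m.r * m.ephi ^ 2)) * m.pos 1 0,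
        m.pos 0 1 - cst (1 / (m.r * m.ephi ^ 2)) * m.pos 1 1; m.pos 1 0, m.pos 1 1]⟩ := by
  obtain ⟨he, hz⟩ := h.exists_zero
  have h1 := cst_ne_zero he
  have h2 := cst_ne_zero hr
  have h3 := zetaZero_ne_zero
  simp only [act, gaugeL, gaugeBarL, S, hz, inv_upper]
  refine Triple.ext (mat_ext ?_ ?_ ?_ ?_) (mat_ext ?_ ?_ ?_ ?_) (mat_ext ?_ ?_ ?_ ?_) <;>
    simp [-Matrix.cons_mul, Matrix.mul_apply, Fin.sum_univ_two, cst_inv,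
      cst_div, cst_neg, cst_pow, cst_mul] <;>
    field_simp <;> ring

theorem act_sR_zero {m : Triple} (h : m.Normal) (hr : m.rb ≠ 0) : act (.sR 0) m =
    ⟨!![m.neg 0 0 - cst (m.ephi ^ 2 / m.rb) * (zetaZero * m.neg 1 0),
        m.neg 0 1 - cst (m.ephi ^ 2 / m.rb) * (zetaZero * m.neg 1 1); m.neg 1 0, m.neg 1 1],
      !![cst (m.ephi / m.rb), 0; 0, cst (m.rb / m.ephi)],
      !![m.pos 1 1 - cst m.rb * (zetaZero * m.pos 0 1),
        cst m.rb * (zetaInf * m.pos 0 0) - zetaInf * (zetaInf * m.pos 1 0);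
        -(cst (1 / m.rb) * (zetaZero * m.pos 1 1)), cst (1 / m.rb) * (zetaInf * m.pos 1 0)]⟩ := by
  obtain ⟨he, hz⟩ := h.exists_zero
  have h1 := cst_ne_zero he
  have h2 := cst_ne_zero hr
  have h3 := zetaZero_ne_zero
  simp only [act, gaugeR, gaugeBarR, S, hz, zetaInf_eq_inv, inv_inv]
  rw [inv_upper_diag _ h2 (by simpa [cst_inv] using h2)]
  refine Triple.ext (mat_ext ?_ ?_ ?_ ?_) (mat_ext ?_ ?_ ?_ ?_) (mat_ext ?_ ?_ ?_ ?_) <;>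
    simp [-Matrix.cons_mul, Matrix.mul_apply, Fin.sum_univ_two, cst_inv, cst_div, cst_pow] <;>
    field_simp <;> ring

theorem act_sR_one {m : Triple} (h : m.Normal) (hq : m.qb ≠ 0) : act (.sR 1) m =
    ⟨!![m.neg 0 0, m.neg 0 1; m.neg 1 0 - cst (1 / (m.qb * m.ephi ^ 2)) * m.neg 0 0,
        m.neg 1 1 - cst (1 / (m.qb * m.ephi ^ 2)) * m.neg 0 1],
      !![cst (m.qb * m.ephi), 0; 0, cst (1 / (m.qb * m.ephi))],
      !![cst (1 / m.qb) * m.pos 0 1, -(cst (1 / m.qb) * m.pos 0 0);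
        cst m.qb * m.pos 1 1 - m.pos 0 1, m.pos 0 0 - cst m.qb * m.pos 1 0]⟩ := by
  obtain ⟨he, hz⟩ := h.exists_zero
  have h1 := cst_ne_zero he
  have h2 := cst_ne_zero hq
  have h3 := zetaZero_ne_zero
  simp only [act, gaugeR, gaugeBarR, S, hz]
  rw [inv_lower_diag _ (by simpa [cst_inv] using h2) h2]
  refine Triple.ext (mat_ext ?_ ?_ ?_ ?_) (mat_ext ?_ ?_ ?_ ?_) (mat_ext ?_ ?_ ?_ ?_) <;>
    simp [-Matrix.cons_mul, Matrix.mul_apply, Fin.sum_univ_two, cst_inv,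
      cst_div, cst_neg, cst_pow, cst_mul] <;>
    field_simp <;> ring

/-! ### Normal forms are preserved, and relations between the transformations -/

namespace Triple

theorem Normal.neg_coeff {m : Triple} (h : m.Normal) :
    (∀ k, k ≤ 0 → (m.neg 0 0).coeff k = if k = 0 then 1 else 0) ∧
    (∀ k, k ≤ 0 → (m.neg 0 1).coeff k = 0) ∧ (∀ k, k < 0 → (m.neg 1 0).coeff k = 0) ∧
    (∀ k, k ≤ 0 → (m.neg 1 1).coeff k = if k = 0 then 1 else 0) := by
  refine ⟨fun k hk => ?_, fun k hk => ?_, fun k hk => ?_, fun k hk => ?_⟩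
  · simpa using h.1 0 0 (-k) (by simp [lamDeg]; omega)
  · simpa using h.1 0 1 (-k) (by simp [lamDeg]; omega)
  · simpa using h.1 1 0 (-k) (by simp [lamDeg]; omega)
  · simpa using h.1 1 1 (-k) (by simp [lamDeg]; omega)

theorem Normal.pos_coeff {m : Triple} (h : m.Normal) :
    (∀ k, k ≤ 0 → (m.pos 0 0).coeff k = if k = 0 then 1 else 0) ∧
    (∀ k, k < 0 → (m.pos 0 1).coeff k = 0) ∧ (∀ k, k ≤ 0 → (m.pos 1 0).coeff k = 0) ∧
    (∀ k, k ≤ 0 → (m.pos 1 1).coeff k = if k = 0 then 1 else 0) := by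
  refine ⟨fun k hk => ?_, fun k hk => ?_, fun k hk => ?_, fun k hk => ?_⟩
  · simpa using h.2.2.2.1 0 0 k (by simp [lamDeg]; omega)
  · simpa using h.2.2.2.1 0 1 k (by simp [lamDeg]; omega)
  · simpa using h.2.2.2.1 1 0 k (by simp [lamDeg]; omega)
  · simpa using h.2.2.2.1 1 1 k (by simp [lamDeg]; omega)

theorem normal_of_coeff {m : Triple} {e : ℂ} (he : e ≠ 0)
    (h3 : m.zero = !![cst e, 0; 0, cst (1 / e)])
    (n00 : ∀ k, k ≤ 0 → (m.neg 0 0).coeff k = if k = 0 then 1 else 0)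
    (n01 : ∀ k, k ≤ 0 → (m.neg 0 1).coeff k = 0) (n10 : ∀ k, k < 0 → (m.neg 1 0).coeff k = 0)
    (n11 : ∀ k, k ≤ 0 → (m.neg 1 1).coeff k = if k = 0 then 1 else 0)
    (p00 : ∀ k, k ≤ 0 → (m.pos 0 0).coeff k = if k = 0 then 1 else 0)
    (p01 : ∀ k, k < 0 → (m.pos 0 1).coeff k = 0) (p10 : ∀ k, k ≤ 0 → (m.pos 1 0).coeff k = 0)
    (p11 : ∀ k, k ≤ 0 → (m.pos 1 1).coeff k = if k = 0 then 1 else 0)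
    (hn : m.neg 0 0 * m.neg 1 1 - m.neg 0 1 * m.neg 1 0 = 1)
    (hp : m.pos 0 0 * m.pos 1 1 - m.pos 0 1 * m.pos 1 0 = 1) : m.Normal := by
  refine normal_of_zero ?_ (by rw [Matrix.det_fin_two, hn]) he h3 ?_
    (by rw [Matrix.det_fin_two, hp])
  · intro i j k hk
    fin_cases i <;> fin_cases j <;> simp [lamDeg] at hk ⊢
    · simpa using n00 (-k) (by omega)
    · exact n01 (-k) (by omega)
    · exact n10 (-k) (by omega)
    · simpa using n11 (-k) (by omega)
  · intro i j k hk
    fin_cases i <;> fin_cases j <;> simp [lamDeg] at hk ⊢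
    · simpa using p00 k (by omega)
    · exact p01 k (by omega)
    · exact p10 k (by omega)
    · simpa using p11 k (by omega)

theorem Normal.det_neg {m : Triple} (h : m.Normal) :
    m.neg 0 0 * m.neg 1 1 - m.neg 0 1 * m.neg 1 0 = 1 := by
  rw [← Matrix.det_fin_two, h.2.1]

theorem Normal.det_pos {m : Triple} (h : m.Normal) :
    m.pos 0 0 * m.pos 1 1 - m.pos 0 1 * m.pos 1 0 = 1 := by
  rw [← Matrix.det_fin_two, h.2.2.2.2]

end Triple

theorem normal_act_sigma {m : Triple} (h : m.Normal) : (act .sigma m).Normal := by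
  obtain ⟨he, -⟩ := h.exists_zero
  obtain ⟨n00, n01, n10, n11⟩ := h.neg_coeff
  obtain ⟨p00, p01, p10, p11⟩ := h.pos_coeff
  have hz := zetaZero_ne_zero
  rw [act_sigma h]
  refine Triple.normal_of_coeff (e := 1 / m.ephi) (by simpa using he) (by simp) p00 ?_ ?_ p11
    n00 ?_ ?_ n11 ?_ ?_
  · intro k hk; simpa using p01 _ (by omega)
  · intro k hk; simpa using p10 _ (by omega)
  · intro k hk; simpa using n01 _ (by omega)
  · intro k hk; simpa using n10 _ (by omega)
  · rw [← h.det_pos]; simp [zetaInf_eq_inv]; field_simp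
  · rw [← h.det_neg]; simp [zetaInf_eq_inv]; field_simp

theorem normal_act_pi {m : Triple} (h : m.Normal) : (act .pi m).Normal := by
  obtain ⟨he, -⟩ := h.exists_zero
  obtain ⟨n00, n01, n10, n11⟩ := h.neg_coeff
  obtain ⟨p00, p01, p10, p11⟩ := h.pos_coeff
  have hz := zetaZero_ne_zero
  rw [act_pi h]
  refine Triple.normal_of_coeff (e := 1 / m.ephi) (by simpa using he) (by simp) n11 ?_ ?_ n00
    p11 ?_ ?_ p00 ?_ ?_
  · intro k hk; simpa using n10 _ (by omega)
  · intro k hk; simpa using n01 _ (by omega)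
  · intro k hk; simpa using p10 _ (by omega)
  · intro k hk; simpa using p01 _ (by omega)
  · rw [← h.det_neg]; simp [zetaInf_eq_inv]; field_simp
  · rw [← h.det_pos]; simp [zetaInf_eq_inv]; field_simp

theorem normal_act_sL_zero {m : Triple} (h : m.Normal) (hq : m.q ≠ 0) :
    (act (.sL 0) m).Normal := by
  obtain ⟨he, -⟩ := h.exists_zero
  obtain ⟨n00, n01, n10, n11⟩ := h.neg_coeff
  obtain ⟨p00, p01, p10, p11⟩ := h.pos_coeff
  have hz := zetaZero_ne_zero
  have hq' := cst_ne_zero hq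
  rw [act_sL_zero h hq]
  refine Triple.normal_of_coeff (e := -m.ephi / m.q) (by simp [he, hq])
    (by simp [neg_div]) ?_ ?_ ?_ ?_ p00 p01 ?_ ?_ ?_ ?_
  · intro k hk
    rcases hk.lt_or_eq with hk | rfl
    · simp [hk.ne, n01 (k + 1) (by omega)]
    · simpa [Triple.q] using inv_mul_cancel₀ hq
  · intro k hk
    simp [n00 (k - 1) (by omega), show k - 1 ≠ 0 by omega]
  · intro k hk
    -- At k = -1, that is at ζE₁₀ = the Λ¹ part, the two terms contribute q - q = 0; this is what
    -- fixes the entry -q of G_0^L.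
    rcases (show k < -1 ∨ k = -1 by omega) with hk | rfl
    · simp [n11 (k + 1) (by omega), n01 (k + 1 + 1) (by omega), show k + 1 ≠ 0 by omega]
    · simp [n11 0 le_rfl, Triple.q]
  · intro k hk
    simp [n00 k hk, n10 (k - 1) (by omega)]
  · intro k hk
    simp [p10 k hk, p00 (k - 1) (by omega), show k - 1 ≠ 0 by omega]
  · intro k hk
    simp [p11 k hk, p01 (k - 1) (by omega)]
  · rw [← h.det_neg]
    simp [zetaInf_eq_inv, cst_inv]
    field_simp
    ring
  · rw [← h.det_pos]
    simp
    ring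

/-! ### Action on q, r, q̄, r̄, e^φ, and the relations. -/

theorem q_act_sL_zero {m : Triple} (h : m.Normal) (hq : m.q ≠ 0) :
    (act (.sL 0) m).q = -1 / m.q := by
  rw [act_sL_zero h hq]
  simp [Triple.q, h.neg_coeff.1 0 le_rfl, neg_div]

theorem q_act_pi {m : Triple} (h : m.Normal) : (act .pi m).q = -m.r := by
  rw [act_pi h]; simp [Triple.q, Triple.r]

theorem r_act_pi {m : Triple} (h : m.Normal) : (act .pi m).r = -m.q := by
  rw [act_pi h]; simp [Triple.q, Triple.r]

theorem qb_act_pi {m : Triple} (h : m.Normal) : (act .pi m).qb = -m.rb := by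
  rw [act_pi h]; simp [Triple.qb, Triple.rb]

theorem rb_act_pi {m : Triple} (h : m.Normal) : (act .pi m).rb = -m.qb := by
  rw [act_pi h]; simp [Triple.qb, Triple.rb]

theorem ephi_act_pi {m : Triple} (h : m.Normal) : (act .pi m).ephi = 1 / m.ephi := by
  rw [act_pi h]; simp [Triple.ephi, coeff_cst]

theorem q_act_sigma {m : Triple} (h : m.Normal) : (act .sigma m).q = m.qb := by
  rw [act_sigma h]; simp [Triple.q, Triple.qb]

theorem r_act_sigma {m : Triple} (h : m.Normal) : (act .sigma m).r = m.rb := by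
  rw [act_sigma h]; simp [Triple.r, Triple.rb]

theorem qb_act_sigma {m : Triple} (h : m.Normal) : (act .sigma m).qb = m.q := by
  rw [act_sigma h]; simp [Triple.q, Triple.qb]

theorem rb_act_sigma {m : Triple} (h : m.Normal) : (act .sigma m).rb = m.r := by
  rw [act_sigma h]; simp [Triple.r, Triple.rb]

theorem ephi_act_sigma {m : Triple} (h : m.Normal) : (act .sigma m).ephi = 1 / m.ephi := by
  rw [act_sigma h]; simp [Triple.ephi, coeff_cst]

theorem act_sigma_sigma {m : Triple} (h : m.Normal) : act .sigma (act .sigma m) = m := by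
  have hz := zetaZero_ne_zero
  obtain ⟨he, hz0⟩ := h.exists_zero
  rw [act_sigma (normal_act_sigma h), ephi_act_sigma h, act_sigma h]
  refine Triple.ext (mat_ext ?_ ?_ ?_ ?_) (mat_ext ?_ ?_ ?_ ?_) (mat_ext ?_ ?_ ?_ ?_) <;>
    simp [zetaInf_eq_inv, hz, hz0]

theorem act_pi_pi {m : Triple} (h : m.Normal) : act .pi (act .pi m) = m := by
  have hz := zetaZero_ne_zero
  obtain ⟨he, hz0⟩ := h.exists_zero
  rw [act_pi (normal_act_pi h), ephi_act_pi h, act_pi h]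
  refine Triple.ext (mat_ext ?_ ?_ ?_ ?_) (mat_ext ?_ ?_ ?_ ?_) (mat_ext ?_ ?_ ?_ ?_) <;>
    simp [zetaInf_eq_inv, hz0] <;> field_simp

theorem act_pi_sigma {m : Triple} (h : m.Normal) :
    act .pi (act .sigma m) = act .sigma (act .pi m) := by
  have hz := zetaZero_ne_zero
  rw [act_pi (normal_act_sigma h), ephi_act_sigma h, act_sigma (normal_act_pi h), ephi_act_pi h,
    act_pi h, act_sigma h]
  refine Triple.ext (mat_ext ?_ ?_ ?_ ?_) (mat_ext ?_ ?_ ?_ ?_) (mat_ext ?_ ?_ ?_ ?_) <;>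
    simp [zetaInf_eq_inv] <;> field_simp

theorem ephi_act_sL_zero {m : Triple} (h : m.Normal) (hq : m.q ≠ 0) :
    (act (.sL 0) m).ephi = -m.ephi / m.q := by
  rw [act_sL_zero h hq]
  simp [Triple.ephi, coeff_cst]

theorem act_sL_zero_sq {m : Triple} (h : m.Normal) (hq : m.q ≠ 0) :
    act (.sL 0) (act (.sL 0) m) = m.negZero := by
  have hz := zetaZero_ne_zero
  obtain ⟨he, hz0⟩ := h.exists_zero
  have he' := cst_ne_zero he
  have hq' := cst_ne_zero hq
  rw [act_sL_zero (normal_act_sL_zero h hq) (by rw [q_act_sL_zero h hq]; simp [hq]),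
    q_act_sL_zero h hq, ephi_act_sL_zero h hq, act_sL_zero h hq]
  refine Triple.ext (mat_ext ?_ ?_ ?_ ?_) (mat_ext ?_ ?_ ?_ ?_) (mat_ext ?_ ?_ ?_ ?_) <;>
    simp [zetaInf_eq_inv, Triple.negZero, hz0, cst_div, cst_neg, cst_pow, cst_inv] <;>
    field_simp <;> ring

theorem act_pi_sL_zero {m : Triple} (h : m.Normal) (hq : m.q ≠ 0) :
    act .pi (act (.sL 0) m) = (act (.sL 1) (act .pi m)).negZero := by
  have hz := zetaZero_ne_zero
  obtain ⟨he, hz0⟩ := h.exists_zero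
  have he' := cst_ne_zero he
  have hq' := cst_ne_zero hq
  rw [act_pi (normal_act_sL_zero h hq), ephi_act_sL_zero h hq, act_sL_zero h hq,
    act_sL_one (normal_act_pi h) (by rw [r_act_pi h]; simp [hq]), r_act_pi h, ephi_act_pi h,
    act_pi h]
  refine Triple.ext (mat_ext ?_ ?_ ?_ ?_) (mat_ext ?_ ?_ ?_ ?_) (mat_ext ?_ ?_ ?_ ?_) <;>
    simp [zetaInf_eq_inv, Triple.negZero, cst_div, cst_neg, cst_pow, cst_inv, cst_mul] <;>
    field_simp <;> ring

theorem act_sigma_sL_zero {m : Triple} (h : m.Normal) (hq : m.q ≠ 0) :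
    act .sigma (act (.sL 0) m) = (act (.sR 1) (act .sigma m)).negZero := by
  have hz := zetaZero_ne_zero
  obtain ⟨he, hz0⟩ := h.exists_zero
  have he' := cst_ne_zero he
  have hq' := cst_ne_zero hq
  rw [act_sigma (normal_act_sL_zero h hq), ephi_act_sL_zero h hq, act_sL_zero h hq,
    act_sR_one (normal_act_sigma h) (by rw [qb_act_sigma h]; simp [hq]), qb_act_sigma h,
    ephi_act_sigma h, act_sigma h]
  refine Triple.ext (mat_ext ?_ ?_ ?_ ?_) (mat_ext ?_ ?_ ?_ ?_) (mat_ext ?_ ?_ ?_ ?_) <;>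
    simp [-mul_eq_mul_left_iff, -mul_eq_mul_right_iff, zetaInf_eq_inv, Triple.negZero, cst_div,
      cst_neg, cst_pow, cst_inv, cst_mul] <;>
    field_simp

/-- Obtained from the commutation of π with s_0^L, evaluated at the π-image. It transfers normality,
the square relation and the solution property from s_0^L to s_1^L. -/
theorem act_sL_one_eq {m : Triple} (h : m.Normal) (hr : m.r ≠ 0) :
    act (.sL 1) m = (act .pi (act (.sL 0) (act .pi m))).negZero := by
  rw [act_pi_sL_zero (normal_act_pi h) (by rw [q_act_pi h]; simp [hr]), act_pi_pi h,
    Triple.negZero_negZero]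

theorem normal_act_sL_one {m : Triple} (h : m.Normal) (hr : m.r ≠ 0) :
    (act (.sL 1) m).Normal := by
  rw [act_sL_one_eq h hr]
  exact (normal_act_pi (normal_act_sL_zero (normal_act_pi h)
    (by rw [q_act_pi h]; simp [hr]))).negZero

theorem act_sigma_sL_one {m : Triple} (h : m.Normal) (hr : m.r ≠ 0) :
    act .sigma (act (.sL 1) m) = (act (.sR 0) (act .sigma m)).negZero := by
  have hz := zetaZero_ne_zero
  obtain ⟨he, hz0⟩ := h.exists_zero
  have he' := cst_ne_zero he
  have hr' := cst_ne_zero hr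
  have hee : (act (.sL 1) m).ephi = -m.r * m.ephi := by
    rw [act_sL_one h hr]
    simp [Triple.ephi, coeff_cst]
  rw [act_sigma (normal_act_sL_one h hr), hee, act_sL_one h hr,
    act_sR_zero (normal_act_sigma h) (by rw [rb_act_sigma h]; simp [hr]), rb_act_sigma h,
    ephi_act_sigma h, act_sigma h]
  refine Triple.ext (mat_ext ?_ ?_ ?_ ?_) (mat_ext ?_ ?_ ?_ ?_) (mat_ext ?_ ?_ ?_ ?_) <;>
    simp [-mul_eq_mul_left_iff, -mul_eq_mul_right_iff, zetaInf_eq_inv, Triple.negZero, cst_div,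
      cst_neg, cst_pow, cst_inv, cst_mul] <;>
    field_simp

theorem act_sR_one_eq {m : Triple} (h : m.Normal) (hq : m.qb ≠ 0) :
    act (.sR 1) m = (act .sigma (act (.sL 0) (act .sigma m))).negZero := by
  rw [act_sigma_sL_zero (normal_act_sigma h) (by rwa [q_act_sigma h]), act_sigma_sigma h,
    Triple.negZero_negZero]

theorem act_sR_zero_eq {m : Triple} (h : m.Normal) (hr : m.rb ≠ 0) :
    act (.sR 0) m = (act .sigma (act (.sL 1) (act .sigma m))).negZero := by
  rw [act_sigma_sL_one (normal_act_sigma h) (by rwa [r_act_sigma h]), act_sigma_sigma h,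
    Triple.negZero_negZero]

theorem normal_act {g : Gen} {m : Triple} (h : m.Normal) (hg : Regular g m) :
    (act g m).Normal := by
  match g with
  | .sigma => exact normal_act_sigma h
  | .pi => exact normal_act_pi h
  | .sL 0 => exact normal_act_sL_zero h hg
  | .sL 1 => exact normal_act_sL_one h hg
  | .sR 0 =>
    rw [act_sR_zero_eq h hg]
    exact (normal_act_sigma (normal_act_sL_one (normal_act_sigma h)
      (by rw [r_act_sigma h]; exact hg))).negZero
  | .sR 1 =>
    rw [act_sR_one_eq h hg]
    exact (normal_act_sigma (normal_act_sL_zero (normal_act_sigma h)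
      (by rw [q_act_sigma h]; exact hg))).negZero

theorem act_sL_one_sq {m : Triple} (h : m.Normal) (hr : m.r ≠ 0) :
    act (.sL 1) (act (.sL 1) m) = m.negZero := by
  have h1 := normal_act_pi h
  have hq : (act .pi m).q ≠ 0 := by rw [q_act_pi h]; simpa
  have h2 := normal_act_sL_zero h1 hq
  rw [act_sL_one_eq h hr, act_negZero, act_sL_one_eq (normal_act_pi h2), act_pi_pi h2,
    act_sL_zero_sq h1 hq, act_negZero, act_pi_pi h, Triple.negZero_negZero]
  rw [r_act_pi h2, q_act_sL_zero h1 hq]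
  simpa using hq

theorem act_sL_sq {m : Triple} (h : m.Normal) {i : Fin 2} (hi : Regular (.sL i) m) :
    act (.sL i) (act (.sL i) m) = m.negZero := by
  match i with
  | 0 => exact act_sL_zero_sq h hi
  | 1 => exact act_sL_one_sq h hi

theorem r_act_sL_one {m : Triple} (h : m.Normal) (hr : m.r ≠ 0) :
    (act (.sL 1) m).r = -1 / m.r := by
  rw [act_sL_one h hr]
  simp [Triple.r, h.neg_coeff.2.2.2 0 le_rfl, neg_div]

theorem regular_sL_act_sL {m : Triple} (h : m.Normal) {i : Fin 2} (hi : Regular (.sL i) m) :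
    Regular (.sL i) (act (.sL i) m) := by
  match i with
  | 0 =>
    change (act (.sL 0) m).q ≠ 0
    rw [q_act_sL_zero h hi]
    simpa using show m.q ≠ 0 from hi
  | 1 =>
    change (act (.sL 1) m).r ≠ 0
    rw [r_act_sL_one h hi]
    simpa using show m.r ≠ 0 from hi

theorem regular_sL_act_sigma {m : Triple} (h : m.Normal) (i : Fin 2) :
    Regular (.sL i) (act .sigma m) ↔ Regular (.sR (1 - i)) m := by
  match i with
  | 0 =>
    change (act .sigma m).q ≠ 0 ↔ m.qb ≠ 0
    rw [q_act_sigma h]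
  | 1 =>
    change (act .sigma m).r ≠ 0 ↔ m.rb ≠ 0
    rw [r_act_sigma h]

theorem regular_sR_act_sigma {m : Triple} (h : m.Normal) (i : Fin 2) :
    Regular (.sR i) (act .sigma m) ↔ Regular (.sL (1 - i)) m := by
  have := regular_sL_act_sigma (normal_act_sigma h) (1 - i)
  rw [act_sigma_sigma h, sub_sub_cancel] at this
  exact this.symm

theorem regular_sL_act_pi {m : Triple} (h : m.Normal) (i : Fin 2) :
    Regular (.sL i) (act .pi m) ↔ Regular (.sL (1 - i)) m := by
  match i with
  | 0 =>
    change (act .pi m).q ≠ 0 ↔ m.r ≠ 0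
    rw [q_act_pi h, neg_ne_zero]
  | 1 =>
    change (act .pi m).r ≠ 0 ↔ m.q ≠ 0
    rw [r_act_pi h, neg_ne_zero]

theorem regular_sR_act_pi {m : Triple} (h : m.Normal) (i : Fin 2) :
    Regular (.sR i) (act .pi m) ↔ Regular (.sR (1 - i)) m := by
  match i with
  | 0 =>
    change (act .pi m).rb ≠ 0 ↔ m.qb ≠ 0
    rw [rb_act_pi h, neg_ne_zero]
  | 1 =>
    change (act .pi m).qb ≠ 0 ↔ m.rb ≠ 0
    rw [qb_act_pi h, neg_ne_zero]

theorem act_sR_eq {m : Triple} (h : m.Normal) {i : Fin 2} (hi : Regular (.sR i) m) :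
    act (.sR i) m = (act .sigma (act (.sL (1 - i)) (act .sigma m))).negZero := by
  match i with
  | 0 => exact act_sR_zero_eq h hi
  | 1 => exact act_sR_one_eq h hi

theorem act_sigma_sL {m : Triple} (h : m.Normal) {i : Fin 2} (hi : Regular (.sL i) m) :
    act .sigma (act (.sL i) m) = (act (.sR (1 - i)) (act .sigma m)).negZero := by
  match i with
  | 0 => exact act_sigma_sL_zero h hi
  | 1 => exact act_sigma_sL_one h hi

theorem act_pi_sL {m : Triple} (h : m.Normal) {i : Fin 2} (hi : Regular (.sL i) m) :
    act .pi (act (.sL i) m) = (act (.sL (1 - i)) (act .pi m)).negZero := by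
  match i with
  | 0 => exact act_pi_sL_zero h hi
  | 1 =>
    have hq : (act .pi m).q ≠ 0 := by rw [q_act_pi h]; exact neg_ne_zero.2 hi
    rw [act_sL_one_eq h hi, act_negZero,
      act_pi_pi (normal_act_sL_zero (normal_act_pi h) hq)]
    rfl

theorem regular_act_sigma_of_sR {m : Triple} (h : m.Normal) {i : Fin 2} (hi : Regular (.sR i) m) :
    Regular (.sL (1 - i)) (act .sigma m) := by
  rwa [regular_sL_act_sigma h, sub_sub_cancel]

theorem regular_sR_act_sR {m : Triple} (h : m.Normal) {i : Fin 2} (hi : Regular (.sR i) m) :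
    Regular (.sR i) (act (.sR i) m) := by
  have h1 := normal_act_sigma h
  have h2 := regular_act_sigma_of_sR h hi
  rw [act_sR_eq h hi, regular_negZero, regular_sR_act_sigma (normal_act h1 h2)]
  exact regular_sL_act_sL h1 h2

theorem act_sR_sq {m : Triple} (h : m.Normal) {i : Fin 2} (hi : Regular (.sR i) m) :
    act (.sR i) (act (.sR i) m) = m.negZero := by
  have h1 := normal_act_sigma h
  have h2 := regular_act_sigma_of_sR h hi
  have h3 := normal_act h1 h2
  have h4 := regular_sL_act_sL h1 h2
  rw [act_sR_eq h hi, act_negZero, act_sR_eq (normal_act_sigma h3), act_sigma_sigma h3,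
    act_sL_sq h1 h2, act_negZero, act_sigma_sigma h, Triple.negZero_negZero]
  rwa [regular_sR_act_sigma h3]

theorem act_pi_sR {m : Triple} (h : m.Normal) {i : Fin 2} (hi : Regular (.sR i) m) :
    act .pi (act (.sR i) m) = (act (.sR (1 - i)) (act .pi m)).negZero := by
  have h1 := normal_act_sigma h
  have h2 := regular_act_sigma_of_sR h hi
  have h3 := normal_act h1 h2
  have h5 : Regular (.sR (1 - i)) (act .pi m) := by rwa [regular_sR_act_pi h, sub_sub_cancel]
  rw [act_sR_eq h hi, act_sR_eq (normal_act_pi h) h5, act_negZero, act_pi_sigma h3,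
    act_pi_sL h1 h2, act_negZero, act_pi_sigma h]

theorem regular_act {g : Gen} {m : Triple} (h : m.Normal) (hg : Regular g m) :
    Regular g (act g m) := by
  cases g with
  | sigma => trivial
  | pi => trivial
  | sL i => exact regular_sL_act_sL h hg
  | sR i => exact regular_sR_act_sR h hg

/-! ### Relations between words of transformations. -/

theorem applyWord_cons (g : Gen) (w : List Gen) (x : Times → Triple) (p : Times) :
    applyWord (g :: w) x p = act g (applyWord w x (timeMap g p)) := rfl

theorem normal_applyWord {w : List Gen} {x : Times → Triple} {p : Times} (h : DefinedAt w x p) :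
    (applyWord w x p).Normal := by
  induction w generalizing p with
  | nil => exact h
  | cons g w ih => exact normal_act (ih h.1) h.2

theorem timeMap_timeMap (g : Gen) (p : Times) : timeMap g (timeMap g p) = p := by
  cases g <;> simp [timeMap]

theorem rel_of_sq {g : Gen} {ε : ℤ}
    (hg : ∀ m : Triple, m.Normal → Regular g m → EqUpTo ε (act g (act g m)) m) :
    Rel [g, g] [] ε := by
  rintro x p ⟨⟨h1, h2⟩, -⟩
  simp only [applyWord, apply, DefinedAt, timeMap_timeMap] at *
  exact ⟨h1, hg _ h1 h2⟩

theorem rel_of_comm {g a b : Gen} (htime : ∀ p, timeMap a (timeMap g p) = timeMap g (timeMap b p))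
    (hg : ∀ m : Triple, m.Normal → Regular g m)
    (hreg : ∀ m : Triple, m.Normal → Regular a m → Regular b (act g m))
    (hact : ∀ m : Triple, m.Normal → Regular a m → act g (act a m) = (act b (act g m)).negZero) :
    Rel [g, a] [b, g] (-1) := by
  rintro x p ⟨⟨h1, h2⟩, -⟩
  simp only [applyWord, apply, DefinedAt, htime, eqUpTo_neg_one] at *
  exact ⟨⟨⟨h1, hg _ h1⟩, hreg _ h1 h2⟩, hact _ h1 h2⟩

theorem rel_of_pow_four {g : Gen}
    (hg : ∀ m : Triple, m.Normal → Regular g m → act g (act g m) = m.negZero) :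
    Rel [g, g, g, g] [] 1 := by
  rintro x p ⟨⟨⟨⟨h1, h2⟩, -⟩, -⟩, -⟩
  simp only [applyWord, apply, DefinedAt, timeMap_timeMap, eqUpTo_one] at *
  refine ⟨h1, ?_⟩
  rw [hg _ (normal_act (normal_act h1 h2) (regular_act h1 h2)), hg _ h1 h2,
    Triple.negZero_negZero]
  rw [hg _ h1 h2, regular_negZero]
  exact h2

theorem rel_all : Rel [.sigma, .sigma] [] 1 ∧ Rel [.pi, .pi] [] 1 ∧
    (∀ i, Rel [.sL i, .sL i] [] (-1)) ∧ (∀ i, Rel [.sR i, .sR i] [] (-1)) ∧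
    (∀ i, Rel [.sL i, .sL i, .sL i, .sL i] [] 1) ∧
    (∀ i, Rel [.sR i, .sR i, .sR i, .sR i] [] 1) ∧
    (∀ i, Rel [.pi, .sL i] [.sL (1 - i), .pi] (-1)) ∧
    (∀ i, Rel [.pi, .sR i] [.sR (1 - i), .pi] (-1)) ∧
    (∀ i, Rel [.sigma, .sL i] [.sR (1 - i), .sigma] (-1)) := by
  refine ⟨rel_of_sq fun m h _ => ?_, rel_of_sq fun m h _ => ?_, fun i => rel_of_sq fun m h hi => ?_,
    fun i => rel_of_sq fun m h hi => ?_, fun i => rel_of_pow_four fun m h hi => act_sL_sq h hi,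
    fun i => rel_of_pow_four fun m h hi => act_sR_sq h hi,
    fun i => rel_of_comm (fun p => rfl) (fun _ _ => trivial) (fun m h hi => ?_)
      fun m h hi => act_pi_sL h hi,
    fun i => rel_of_comm (fun p => rfl) (fun _ _ => trivial) (fun m h hi => ?_)
      fun m h hi => act_pi_sR h hi,
    fun i => rel_of_comm (fun p => rfl) (fun _ _ => trivial) (fun m h hi => ?_)
      fun m h hi => act_sigma_sL h hi⟩
  · rw [act_sigma_sigma h, eqUpTo_one]
  · rw [act_pi_pi h, eqUpTo_one]
  · rw [act_sL_sq h hi, eqUpTo_neg_one]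
  · rw [act_sR_sq h hi, eqUpTo_neg_one]
  · rwa [regular_sL_act_pi h, sub_sub_cancel]
  · rwa [regular_sR_act_pi h, sub_sub_cancel]
  · rwa [regular_sR_act_sigma h, sub_sub_cancel]

/-! ### Laurent polynomials and their two expansions -/

/-- Matrices of Laurent polynomials in `ζ`. -/
abbrev LMat : Type := Matrix (Fin 2) (Fin 2) (LaurentPolynomial ℂ)

/-- The expansion of a Laurent polynomial at `ζ = ∞`. -/
def lpInf : LaurentPolynomial ℂ →+* Ser :=
  LaurentPolynomial.eval₂ HahnSeries.C (Units.mk0 zetaInf zetaInf_ne_zero)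

/-- The expansion of a Laurent polynomial at `ζ = 0`. -/
def lpZero : LaurentPolynomial ℂ →+* Ser :=
  LaurentPolynomial.eval₂ HahnSeries.C (Units.mk0 zetaZero zetaZero_ne_zero)

@[simp] theorem lpInf_C (a : ℂ) : lpInf (LaurentPolynomial.C a) = cst a := by
  simp [lpInf, cst]

@[simp] theorem lpZero_C (a : ℂ) : lpZero (LaurentPolynomial.C a) = cst a := by
  simp [lpZero, cst]

theorem lpInf_T (n : ℤ) : lpInf (LaurentPolynomial.T n) = zetaInf ^ n := by
  simp [lpInf]

theorem lpZero_T (n : ℤ) : lpZero (LaurentPolynomial.T n) = zetaZero ^ n := by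
  simp [lpZero]

theorem lpInf_invert (p : LaurentPolynomial ℂ) :
    lpInf (LaurentPolynomial.invert p) = lpZero p := by
  induction p using LaurentPolynomial.induction_on' with
  | add p q hp hq => simp [hp, hq]
  | C_mul_T n a => simp [lpInf_T, lpZero_T, zetaInf_eq_inv]

theorem lpZero_invert (p : LaurentPolynomial ℂ) :
    lpZero (LaurentPolynomial.invert p) = lpInf p := by
  rw [← lpInf_invert, LaurentPolynomial.involutive_invert]

theorem coeff_cst_mul_zetaZero_zpow (a : ℂ) (n k : ℤ) :
    (cst a * zetaZero ^ n).coeff k = if k = n then a else 0 := by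
  rw [zetaZero_zpow, coeff_cst_mul, HahnSeries.coeff_single]
  split_ifs <;> simp

theorem coeff_cst_mul_zetaInf_zpow (a : ℂ) (n k : ℤ) :
    (cst a * zetaInf ^ n).coeff k = if k = -n then a else 0 := by
  rw [zetaInf_zpow, coeff_cst_mul, HahnSeries.coeff_single]
  split_ifs <;> simp

/-- The two expansions of a Laurent polynomial carry the same coefficients with opposite indexing.
Degree conditions stated at one of the points 0, ∞ can therefore be read at the other. -/
theorem coeff_lpZero (p : LaurentPolynomial ℂ) (k : ℤ) :
    (lpZero p).coeff k = (lpInf p).coeff (-k) := by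
  induction p using LaurentPolynomial.induction_on' with
  | add p q hp hq => simp [hp, hq]
  | C_mul_T n a =>
    rw [map_mul, map_mul, lpZero_C, lpInf_C, lpZero_T, lpInf_T, coeff_cst_mul_zetaZero_zpow,
      coeff_cst_mul_zetaInf_zpow]
    simp

/-! ### Splitting by powers of Λ. -/

/-- A matrix over `ℂ((ζ⁻¹))` has only negative powers of `Λ`. -/
def IsNegInf (A : Mat) : Prop := ∀ i j k, 0 ≤ lamDeg i j k → (A i j).coeff (-k) = 0

/-- A matrix over `ℂ((ζ))` has only nonnegative powers of `Λ`. -/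
def IsNonnegZero (A : Mat) : Prop := ∀ i j k, lamDeg i j k < 0 → (A i j).coeff k = 0

/-- The expansion at `ζ = ∞` of a matrix of Laurent polynomials. -/
abbrev mInf (B : LMat) : Mat := lpInf.mapMatrix B

/-- The expansion at `ζ = 0` of a matrix of Laurent polynomials. -/
abbrev mZero (B : LMat) : Mat := lpZero.mapMatrix B

theorem mInf_neg (B : LMat) : mInf (-B) = -mInf B := map_neg _ B

theorem mZero_neg (B : LMat) : mZero (-B) = -mZero B := map_neg _ B

theorem mInf_add (B B' : LMat) : mInf (B + B') = mInf B + mInf B' := map_add _ B B'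

theorem mZero_add (B B' : LMat) : mZero (B + B') = mZero B + mZero B' := map_add _ B B'

theorem mInf_mul (B B' : LMat) : mInf (B * B') = mInf B * mInf B' := map_mul _ B B'

theorem mZero_mul (B B' : LMat) : mZero (B * B') = mZero B * mZero B' := map_mul _ B B'

theorem exists_lamNonneg (A : Mat) : ∃ B : LMat, mInf B = lamNonneg A zetaInf ∧
    mZero B = lamNonneg A zetaZero ∧ IsNonnegZero (mZero B) ∧ IsNegInf (A - mInf B) := by
  let B : LMat := Matrix.of fun i j =>
    ∑ k ∈ (Finset.Icc 0 (-(A i j).order)).filter (fun k => 0 ≤ lamDeg i j k),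
      LaurentPolynomial.C ((A i j).coeff (-k)) * LaurentPolynomial.T k
  have h1 : mInf B = lamNonneg A zetaInf := by
    ext1 i j
    simp [B, lamNonneg, lpInf_T]
  have h2 : mZero B = lamNonneg A zetaZero := by
    ext1 i j
    simp [B, lamNonneg, lpZero_T]
  refine ⟨B, h1, h2, ?_, ?_⟩
  · intro i j k hk
    rw [h2, lamNonneg, Matrix.of_apply, HahnSeries.coeff_sum]
    refine Finset.sum_eq_zero fun l hl => ?_
    rw [coeff_cst_mul_zetaZero_zpow, if_neg]
    rintro rfl
    rw [Finset.mem_filter] at hl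
    omega
  · intro i j k hk
    rw [h1, Matrix.sub_apply, lamNonneg, Matrix.of_apply, HahnSeries.coeff_sub,
      HahnSeries.coeff_sum]
    simp only [coeff_cst_mul_zetaInf_zpow, neg_inj]
    rw [Finset.sum_ite_eq, sub_eq_zero]
    split_ifs with h
    · rfl
    · apply HahnSeries.coeff_eq_zero_of_lt_order
      rw [Finset.mem_filter, Finset.mem_Icc] at h
      -- The summation range may start at 0: since |j - i| ≤ 1, nonnegative Λ-degree 2k + j - i
      -- forces k ≥ 0.
      have : 0 ≤ k := by
        have hi := i.isLt
        have hj := j.isLt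
        simp only [lamDeg] at hk
        omega
      omega

theorem exists_lamNeg (A : Mat) : ∃ B : LMat, mInf B = lamNeg A zetaInf ∧
    mZero B = lamNeg A zetaZero ∧ IsNegInf (mInf B) ∧ IsNonnegZero (A - mZero B) := by
  let B : LMat := Matrix.of fun i j =>
    ∑ k ∈ (Finset.Icc (A i j).order 0).filter (fun k => lamDeg i j k < 0),
      LaurentPolynomial.C ((A i j).coeff k) * LaurentPolynomial.T k
  have h1 : mInf B = lamNeg A zetaInf := by
    ext1 i j
    simp [B, lamNeg, lpInf_T]
  have h2 : mZero B = lamNeg A zetaZero := by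
    ext1 i j
    simp [B, lamNeg, lpZero_T]
  refine ⟨B, h1, h2, ?_, ?_⟩
  · intro i j k hk
    rw [h1, lamNeg, Matrix.of_apply, HahnSeries.coeff_sum]
    refine Finset.sum_eq_zero fun l hl => ?_
    rw [coeff_cst_mul_zetaInf_zpow, if_neg]
    intro h
    rw [neg_inj] at h
    subst h
    rw [Finset.mem_filter] at hl
    omega
  · intro i j k hk
    rw [h2, Matrix.sub_apply, lamNeg, Matrix.of_apply, HahnSeries.coeff_sub,
      HahnSeries.coeff_sum]
    simp only [coeff_cst_mul_zetaZero_zpow]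
    rw [Finset.sum_ite_eq, sub_eq_zero]
    split_ifs with h
    · rfl
    · apply HahnSeries.coeff_eq_zero_of_lt_order
      rw [Finset.mem_filter, Finset.mem_Icc] at h
      have : k ≤ 0 := by
        have hi := i.isLt
        have hj := j.isLt
        simp only [lamDeg] at hk
        omega
      omega

theorem mZero_eq_of_mInf_eq {B B' : LMat} (h : mInf B = mInf B') : mZero B = mZero B' := by
  ext i j k
  have := congrArg (fun M : Mat => (M i j).coeff (-k)) h
  simpa [coeff_lpZero] using this

/-- The two conditions concern complementary Λ-degrees: one prescribes the coefficients of degree ≥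
0, the other kills those of degree < 0. -/
theorem mInf_eq_of_parts {A : Mat} {B B' : LMat} (h1 : IsNonnegZero (mZero B))
    (h2 : IsNegInf (A - mInf B)) (h1' : IsNonnegZero (mZero B')) (h2' : IsNegInf (A - mInf B')) :
    mInf B = mInf B' := by
  ext i j k
  by_cases hk : 0 ≤ lamDeg i j (-k)
  · have e1 := h2 i j (-k) hk
    have e2 := h2' i j (-k) hk
    simp only [Matrix.sub_apply, HahnSeries.coeff_sub, neg_neg] at e1 e2
    exact (sub_eq_zero.1 e1).symm.trans (sub_eq_zero.1 e2)
  · have e1 := h1 i j (-k) (by omega)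
    have e2 := h1' i j (-k) (by omega)
    simp only [RingHom.mapMatrix_apply, Matrix.map_apply, coeff_lpZero, neg_neg] at e1 e2 ⊢
    rw [e1, e2]

theorem mInf_eq_of_parts' {C : Mat} {B B' : LMat} (h1 : IsNegInf (mInf B))
    (h2 : IsNonnegZero (C - mZero B)) (h1' : IsNegInf (mInf B'))
    (h2' : IsNonnegZero (C - mZero B')) : mInf B = mInf B' := by
  ext i j k
  by_cases hk : 0 ≤ lamDeg i j (-k)
  · have e1 := h1 i j (-k) hk
    have e2 := h1' i j (-k) hk
    rw [neg_neg] at e1 e2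
    rw [e1, e2]
  · have e1 := h2 i j (-k) (by omega)
    have e2 := h2' i j (-k) (by omega)
    simp only [Matrix.sub_apply, HahnSeries.coeff_sub, RingHom.mapMatrix_apply, Matrix.map_apply,
      coeff_lpZero, neg_neg] at e1 e2 ⊢
    exact (sub_eq_zero.1 e1).symm.trans (sub_eq_zero.1 e2)

/-! ### Flows along curves -/

/-- Coefficientwise derivative at `0` of a curve of series. -/
def HasSerDeriv (f : ℂ → Ser) (f' : Ser) : Prop :=
  ∀ k, HasDerivAt (fun s => (f s).coeff k) (f'.coeff k) 0

/-- Coefficientwise derivative at `0` of a curve of matrices. -/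
def HasMatDeriv (F : ℂ → Mat) (D : Mat) : Prop := ∀ i j, HasSerDeriv (fun s => F s i j) (D i j)

/-- The curve `m` satisfies at `0` the equations in `t_n`. -/
def FlowT (n : ℕ+) (m : ℂ → Triple) : Prop :=
  ∃ B : LMat, IsNonnegZero (mZero B) ∧
    IsNegInf ((m 0).neg * Hmat zetaInf (n : ℤ) * (m 0).neg⁻¹ - mInf B) ∧
    HasMatDeriv (fun s => (m s).neg)
      (-((m 0).neg * Hmat zetaInf (n : ℤ) * (m 0).neg⁻¹ - mInf B) * (m 0).neg) ∧
    HasMatDeriv (fun s => (m s).nonneg) (mZero B * (m 0).nonneg)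

/-- The curve `m` satisfies at `0` the equations in `t̄_n`. -/
def FlowTbar (n : ℕ+) (m : ℂ → Triple) : Prop :=
  ∃ B : LMat, IsNegInf (mInf B) ∧
    IsNonnegZero ((m 0).nonneg * Hmat zetaZero (-(n : ℤ)) * (m 0).nonneg⁻¹ - mZero B) ∧
    HasMatDeriv (fun s => (m s).neg) (mInf B * (m 0).neg) ∧
    HasMatDeriv (fun s => (m s).nonneg)
      (-((m 0).nonneg * Hmat zetaZero (-(n : ℤ)) * (m 0).nonneg⁻¹ - mZero B) * (m 0).nonneg)

theorem shiftT_zero (n : ℕ+) (p : Times) : shiftT n p 0 = p := by simp [shiftT]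

theorem shiftTbar_zero (n : ℕ+) (p : Times) : shiftTbar n p 0 = p := by simp [shiftTbar]

/-- Existence and uniqueness of the polynomial part replace the explicit truncations by "some B with
the right degrees". To verify a transformed flow it then suffices to exhibit B, with no need to
compute a truncation. -/
theorem satoWilsonAt_iff {n : ℕ+} {x : Times → Triple} {p : Times} : SatoWilsonAt n x p ↔
    FlowT n (fun s => x (shiftT n p s)) ∧ FlowTbar n (fun s => x (shiftTbar n p s)) := by
  simp only [SatoWilsonAt, FlowT, FlowTbar, shiftT_zero, shiftTbar_zero]
  obtain ⟨B, hB1, hB2, hB3, hB4⟩ :=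
    exists_lamNonneg ((x p).neg * Hmat zetaInf (n : ℤ) * (x p).neg⁻¹)
  obtain ⟨B', hB1', hB2', hB3', hB4'⟩ :=
    exists_lamNeg ((x p).nonneg * Hmat zetaZero (-(n : ℤ)) * (x p).nonneg⁻¹)
  rw [← hB1, ← hB2, ← hB1', ← hB2']
  constructor
  · rintro ⟨h1, h2, h3, h4⟩
    exact ⟨⟨B, hB3, hB4, h1, h2⟩, ⟨B', hB3', hB4', h3, h4⟩⟩
  · rintro ⟨⟨E, hE3, hE4, h1, h2⟩, ⟨E', hE3', hE4', h3, h4⟩⟩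
    have e := mInf_eq_of_parts hE3 hE4 hB3 hB4
    have e' := mInf_eq_of_parts' hE3' hE4' hB3' hB4'
    rw [e] at h1
    rw [mZero_eq_of_mInf_eq e] at h2
    rw [e'] at h3
    rw [mZero_eq_of_mInf_eq e'] at h4
    exact ⟨h1, h2, h3, h4⟩

theorem HasSerDeriv.congr {f g : ℂ → Ser} {f' : Ser} (hf : HasSerDeriv f f')
    (h : g =ᶠ[𝓝 0] f) : HasSerDeriv g f' := fun k =>
  (hf k).congr_of_eventuallyEq (h.mono fun s hs => by simp only [hs])

theorem HasMatDeriv.congr {F G : ℂ → Mat} {D : Mat} (hF : HasMatDeriv F D)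
    (h : G =ᶠ[𝓝 0] F) : HasMatDeriv G D := fun i j =>
  (hF i j).congr (h.mono fun s hs => by simp only [hs])

theorem FlowT.congr {n : ℕ+} {m m' : ℂ → Triple} (h : FlowT n m) (e : m' =ᶠ[𝓝 0] m) :
    FlowT n m' := by
  obtain ⟨B, h1, h2, h3, h4⟩ := h
  rw [← e.self_of_nhds] at h2 h3 h4
  exact ⟨B, h1, h2, h3.congr (e.mono fun s hs => by simp only [hs]),
    h4.congr (e.mono fun s hs => by simp only [hs])⟩

theorem FlowTbar.congr {n : ℕ+} {m m' : ℂ → Triple} (h : FlowTbar n m) (e : m' =ᶠ[𝓝 0] m) :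
    FlowTbar n m' := by
  obtain ⟨B, h1, h2, h3, h4⟩ := h
  rw [← e.self_of_nhds] at h2 h3 h4
  exact ⟨B, h1, h2, h3.congr (e.mono fun s hs => by simp only [hs]),
    h4.congr (e.mono fun s hs => by simp only [hs])⟩

namespace HasSerDeriv

variable {f g : ℂ → Ser} {f' g' : Ser}

theorem neg (hf : HasSerDeriv f f') : HasSerDeriv (fun s => -f s) (-f') := fun k => by
  simpa using (hf k).fun_neg

theorem add (hf : HasSerDeriv f f') (hg : HasSerDeriv g g') :
    HasSerDeriv (fun s => f s + g s) (f' + g') := fun k => by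
  simpa using (hf k).fun_add (hg k)

theorem zetaZero_mul (hf : HasSerDeriv f f') :
    HasSerDeriv (fun s => zetaZero * f s) (zetaZero * f') := fun k => by
  simpa using hf (k - 1)

theorem zetaInf_mul (hf : HasSerDeriv f f') :
    HasSerDeriv (fun s => zetaInf * f s) (zetaInf * f') := fun k => by
  simpa using hf (k + 1)

theorem cst_mul (hf : HasSerDeriv f f') {a : ℂ → ℂ} {a' : ℂ} (ha : HasDerivAt a a' 0) :
    HasSerDeriv (fun s => cst (a s) * f s) (cst a' * f 0 + cst (a 0) * f') := fun k => by
  simpa using ha.fun_mul (hf k)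

theorem comp_neg (hf : HasSerDeriv f f') : HasSerDeriv (fun s => f (-s)) (-f') := fun k => by
  have h := hf k
  rw [← neg_zero] at h
  simpa [Function.comp_def] using h.scomp (0 : ℂ) (hasDerivAt_neg (0 : ℂ))

end HasSerDeriv

namespace HasMatDeriv

variable {F : ℂ → Mat} {D : Mat}

theorem neg (hF : HasMatDeriv F D) : HasMatDeriv (fun s => -F s) (-D) :=
  fun i j => (hF i j).neg

theorem comp_neg (hF : HasMatDeriv F D) : HasMatDeriv (fun s => F (-s)) (-D) :=
  fun i j => (hF i j).comp_neg

end HasMatDeriv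

theorem hasMatDeriv_of {F : ℂ → Mat} {D : Mat} (h00 : HasSerDeriv (fun s => F s 0 0) (D 0 0))
    (h01 : HasSerDeriv (fun s => F s 0 1) (D 0 1)) (h10 : HasSerDeriv (fun s => F s 1 0) (D 1 0))
    (h11 : HasSerDeriv (fun s => F s 1 1) (D 1 1)) : HasMatDeriv F D := by
  intro i j
  fin_cases i <;> fin_cases j <;> assumption

/-! ### Leading coefficients of products -/

theorem coeff_mul_of_lt {f g : Ser} {a b k : ℤ} (hf : ∀ i < a, f.coeff i = 0)
    (hg : ∀ i < b, g.coeff i = 0) (hk : k < a + b) : (f * g).coeff k = 0 := by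
  rw [HahnSeries.coeff_mul]
  refine Finset.sum_eq_zero fun ij hij => ?_
  rw [Finset.mem_antidiagonal] at hij
  by_cases h : ij.1 < a
  · rw [hf _ h, zero_mul]
  · rw [hg _ (by omega), mul_zero]

theorem coeff_mul_of_eq {f g : Ser} {a b k : ℤ} (hf : ∀ i < a, f.coeff i = 0)
    (hg : ∀ i < b, g.coeff i = 0) (hk : k = a + b) :
    (f * g).coeff k = f.coeff a * g.coeff b := by
  rw [HahnSeries.coeff_mul]
  rw [Finset.sum_eq_single (a, b)]
  · intro ij hij hne
    rw [Finset.mem_antidiagonal] at hij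
    by_cases h1 : ij.1 < a
    · rw [hf _ h1, zero_mul]
    · rw [hg _ _, mul_zero]
      by_contra h2
      exact hne (Prod.ext (by simp; omega) (by simp; omega))
  · intro h
    rw [Finset.mem_antidiagonal] at h
    simp only [HahnSeries.mem_support] at h
    by_contra h3
    exact h ⟨fun h4 => h3 (by simp [h4]), fun h4 => h3 (by simp [h4]), hk.symm⟩

/-! ### Conjugation by `P` -/

theorem conjP_mul {z : Ser} (hz : z ≠ 0) (A B : Mat) :
    conjP z (A * B) = conjP z A * conjP z B := by
  simp only [conjP_eq hz]
  refine mat_ext ?_ ?_ ?_ ?_ <;>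
    simp [-Matrix.cons_mul, Matrix.mul_apply, Fin.sum_univ_two] <;> field_simp <;> ring

theorem conjP_inv {z : Ser} (hz : z ≠ 0) (A : Mat) : conjP z A⁻¹ = (conjP z A)⁻¹ := by
  have hP : IsUnit (!![0, z⁻¹; -1, 0] : Mat).det := by simp [Matrix.det_fin_two, hz]
  simp only [conjP, Matrix.mul_inv_rev, Matrix.nonsing_inv_nonsing_inv _ hP, Matrix.mul_assoc]

theorem conjP_Hmat {z : Ser} (hz : z ≠ 0) (w : Ser) (n : ℤ) :
    conjP z (Hmat w n) = -Hmat w n := by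
  rw [conjP_eq hz]
  refine mat_ext ?_ ?_ ?_ ?_ <;> simp [Hmat]

theorem conjP_sub {z : Ser} (hz : z ≠ 0) (A B : Mat) :
    conjP z (A - B) = conjP z A - conjP z B := by
  simp only [conjP_eq hz]
  refine mat_ext ?_ ?_ ?_ ?_ <;> simp <;> ring

theorem conjP_neg (z : Ser) (A : Mat) : conjP z (-A) = -conjP z A := by
  simp [conjP]

/-- Conjugation by `P` of matrices of Laurent polynomials. -/
def conjPL (B : LMat) : LMat :=
  !![B 1 1, -(LaurentPolynomial.T (-1) * B 1 0); -(LaurentPolynomial.T 1 * B 0 1), B 0 0]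

theorem mInf_conjPL (B : LMat) : mInf (conjPL B) = conjP zetaInf (mInf B) := by
  rw [conjP_eq zetaInf_ne_zero]
  refine mat_ext ?_ ?_ ?_ ?_ <;> simp [conjPL, lpInf_T] <;> ring

theorem mZero_conjPL (B : LMat) : mZero (conjPL B) = conjP zetaZero (mZero B) := by
  rw [conjP_eq zetaZero_ne_zero]
  refine mat_ext ?_ ?_ ?_ ?_ <;> simp [conjPL, lpZero_T] <;> ring

theorem IsNegInf.entries {A : Mat} (h : IsNegInf A) :
    (∀ k ≤ 0, (A 0 0).coeff k = 0) ∧ (∀ k ≤ 0, (A 0 1).coeff k = 0) ∧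
    (∀ k < 0, (A 1 0).coeff k = 0) ∧ (∀ k ≤ 0, (A 1 1).coeff k = 0) := by
  refine ⟨fun k hk => ?_, fun k hk => ?_, fun k hk => ?_, fun k hk => ?_⟩
  · simpa using h 0 0 (-k) (by simp [lamDeg]; omega)
  · simpa using h 0 1 (-k) (by simp [lamDeg]; omega)
  · simpa using h 1 0 (-k) (by simp [lamDeg]; omega)
  · simpa using h 1 1 (-k) (by simp [lamDeg]; omega)

theorem isNegInf_of {A : Mat} (h00 : ∀ k ≤ 0, (A 0 0).coeff k = 0)
    (h01 : ∀ k ≤ 0, (A 0 1).coeff k = 0) (h10 : ∀ k < 0, (A 1 0).coeff k = 0)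
    (h11 : ∀ k ≤ 0, (A 1 1).coeff k = 0) : IsNegInf A := by
  intro i j k hk
  fin_cases i <;> fin_cases j <;> simp [lamDeg] at hk ⊢
  · exact h00 (-k) (by omega)
  · exact h01 (-k) (by omega)
  · exact h10 (-k) (by omega)
  · exact h11 (-k) (by omega)

theorem IsNonnegZero.entries {A : Mat} (h : IsNonnegZero A) :
    (∀ k < 0, (A 0 0).coeff k = 0) ∧ (∀ k < 0, (A 0 1).coeff k = 0) ∧
    (∀ k ≤ 0, (A 1 0).coeff k = 0) ∧ (∀ k < 0, (A 1 1).coeff k = 0) := by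
  refine ⟨fun k hk => ?_, fun k hk => ?_, fun k hk => ?_, fun k hk => ?_⟩
  · simpa using h 0 0 k (by simp [lamDeg]; omega)
  · simpa using h 0 1 k (by simp [lamDeg]; omega)
  · simpa using h 1 0 k (by simp [lamDeg]; omega)
  · simpa using h 1 1 k (by simp [lamDeg]; omega)

theorem isNonnegZero_of {A : Mat} (h00 : ∀ k < 0, (A 0 0).coeff k = 0)
    (h01 : ∀ k < 0, (A 0 1).coeff k = 0) (h10 : ∀ k ≤ 0, (A 1 0).coeff k = 0)
    (h11 : ∀ k < 0, (A 1 1).coeff k = 0) : IsNonnegZero A := by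
  intro i j k hk
  fin_cases i <;> fin_cases j <;> simp [lamDeg] at hk ⊢
  · exact h00 k (by omega)
  · exact h01 k (by omega)
  · exact h10 k (by omega)
  · exact h11 k (by omega)

theorem IsNegInf.neg {A : Mat} (h : IsNegInf A) : IsNegInf (-A) := by
  intro i j k hk
  simp [h i j k hk]

theorem IsNonnegZero.neg {A : Mat} (h : IsNonnegZero A) : IsNonnegZero (-A) := by
  intro i j k hk
  simp [h i j k hk]

theorem IsNonnegZero.add {A B : Mat} (h : IsNonnegZero A) (h' : IsNonnegZero B) :
    IsNonnegZero (A + B) := by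
  intro i j k hk
  simp [h i j k hk, h' i j k hk]

theorem IsNegInf.conjP {A : Mat} (h : IsNegInf A) : IsNegInf (conjP zetaInf A) := by
  obtain ⟨h00, h01, h10, h11⟩ := h.entries
  rw [conjP_eq zetaInf_ne_zero, zetaInf_eq_inv, inv_inv, ← zetaInf_eq_inv]
  refine isNegInf_of (by simpa using h11) ?_ ?_ (by simpa using h00)
  · intro k hk
    have := h10 (k - 1) (by omega)
    simpa using this
  · intro k hk
    have := h01 (k + 1) (by omega)
    simpa using this

theorem IsNonnegZero.conjP {A : Mat} (h : IsNonnegZero A) : IsNonnegZero (conjP zetaZero A) := by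
  obtain ⟨h00, h01, h10, h11⟩ := h.entries
  rw [conjP_eq zetaZero_ne_zero, ← zetaInf_eq_inv]
  refine isNonnegZero_of (by simpa using h11) ?_ ?_ (by simpa using h00)
  · intro k hk
    have := h10 (k + 1) (by omega)
    simpa using this
  · intro k hk
    have := h01 (k - 1) (by omega)
    simpa using this

theorem HasMatDeriv.conjP_inf {F : ℂ → Mat} {D : Mat} (h : HasMatDeriv F D) :
    HasMatDeriv (fun s => conjP zetaInf (F s)) (conjP zetaInf D) := by
  simp only [conjP_eq zetaInf_ne_zero]
  refine hasMatDeriv_of (h 1 1) ?_ ?_ (h 0 0)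
  · have := (h 1 0).zetaZero_mul.neg
    simpa [zetaInf_eq_inv] using this
  · have := (h 0 1).zetaInf_mul.neg
    simpa using this

theorem HasMatDeriv.conjP_zero {F : ℂ → Mat} {D : Mat} (h : HasMatDeriv F D) :
    HasMatDeriv (fun s => conjP zetaZero (F s)) (conjP zetaZero D) := by
  simp only [conjP_eq zetaZero_ne_zero]
  refine hasMatDeriv_of (h 1 1) ?_ ?_ (h 0 0)
  · have := (h 1 0).zetaInf_mul.neg
    simpa [zetaInf_eq_inv] using this
  · have := (h 0 1).zetaZero_mul.neg
    simpa using this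

theorem nonneg_act_pi (m : Triple) : (act .pi m).nonneg = conjP zetaZero m.nonneg := by
  rw [Triple.nonneg, Triple.nonneg, conjP_mul zetaZero_ne_zero]
  rfl

/-- Conjugation by P preserves Λ-degrees and sends H_n to -H_n; the sign is absorbed by reversing
the time. -/
theorem FlowT.act_pi {n : ℕ+} {m : ℂ → Triple} (h : FlowT n m) :
    FlowT n (fun s => act .pi (m (-s))) := by
  obtain ⟨B, h1, h2, h3, h4⟩ := h
  have hA : conjP zetaInf (m 0).neg * Hmat zetaInf n * (conjP zetaInf (m 0).neg)⁻¹ =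
      -conjP zetaInf ((m 0).neg * Hmat zetaInf n * (m 0).neg⁻¹) := by
    simp [conjP_mul zetaInf_ne_zero, conjP_inv zetaInf_ne_zero, conjP_Hmat zetaInf_ne_zero]
  have hN : conjP zetaInf (m 0).neg * Hmat zetaInf n * (conjP zetaInf (m 0).neg)⁻¹ -
      mInf (-conjPL B) = -conjP zetaInf ((m 0).neg * Hmat zetaInf n * (m 0).neg⁻¹ - mInf B) := by
    rw [hA, mInf_neg, mInf_conjPL, conjP_sub zetaInf_ne_zero]
    abel
  have hP : mZero (-conjPL B) = -conjP zetaZero (mZero B) := by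
    rw [mZero_neg, mZero_conjPL]
  refine ⟨-conjPL B, ?_, ?_, ?_, ?_⟩
  · rw [hP]
    exact h1.conjP.neg
  · simp only [neg_zero]
    rw [show (act .pi (m 0)).neg = conjP zetaInf (m 0).neg from rfl, hN]
    exact h2.conjP.neg
  · simp only [neg_zero]
    rw [show (act .pi (m 0)).neg = conjP zetaInf (m 0).neg from rfl, hN]
    have := h3.conjP_inf.comp_neg
    rw [mat_neg_mul, conjP_neg, conjP_mul zetaInf_ne_zero] at this
    change HasMatDeriv (fun s => conjP zetaInf (m (-s)).neg) _
    simpa using this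
  · simp only [neg_zero, nonneg_act_pi, hP]
    have := h4.conjP_zero.comp_neg
    rwa [conjP_mul zetaZero_ne_zero, ← mat_neg_mul] at this

theorem FlowTbar.act_pi {n : ℕ+} {m : ℂ → Triple} (h : FlowTbar n m) :
    FlowTbar n (fun s => act .pi (m (-s))) := by
  obtain ⟨B, h1, h2, h3, h4⟩ := h
  have hA : conjP zetaZero (m 0).nonneg * Hmat zetaZero (-n) * (conjP zetaZero (m 0).nonneg)⁻¹ =
      -conjP zetaZero ((m 0).nonneg * Hmat zetaZero (-n) * (m 0).nonneg⁻¹) := by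
    simp [conjP_mul zetaZero_ne_zero, conjP_inv zetaZero_ne_zero, conjP_Hmat zetaZero_ne_zero]
  have hN : conjP zetaZero (m 0).nonneg * Hmat zetaZero (-n) *
      (conjP zetaZero (m 0).nonneg)⁻¹ - mZero (-conjPL B) =
      -conjP zetaZero ((m 0).nonneg * Hmat zetaZero (-n) * (m 0).nonneg⁻¹ - mZero B) := by
    rw [hA, mZero_neg, mZero_conjPL, conjP_sub zetaZero_ne_zero]
    abel
  have hP : mInf (-conjPL B) = -conjP zetaInf (mInf B) := by
    rw [mInf_neg, mInf_conjPL]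
  refine ⟨-conjPL B, ?_, ?_, ?_, ?_⟩
  · rw [hP]
    exact h1.conjP.neg
  · simp only [neg_zero, nonneg_act_pi]
    rw [hN]
    exact h2.conjP.neg
  · simp only [neg_zero, hP]
    have := h3.conjP_inf.comp_neg
    rwa [conjP_mul zetaInf_ne_zero, ← mat_neg_mul] at this
  · simp only [neg_zero, nonneg_act_pi]
    rw [hN]
    have := h4.conjP_zero.comp_neg
    rw [mat_neg_mul, conjP_neg, conjP_mul zetaZero_ne_zero] at this
    simpa using this

theorem FlowT.negZero {n : ℕ+} {m : ℂ → Triple} (h : FlowT n m) :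
    FlowT n (fun s => (m s).negZero) := by
  obtain ⟨B, h1, h2, h3, h4⟩ := h
  refine ⟨B, h1, h2, h3, ?_⟩
  simpa [Triple.nonneg, Triple.negZero] using h4.neg

theorem FlowTbar.negZero {n : ℕ+} {m : ℂ → Triple} (h : FlowTbar n m) :
    FlowTbar n (fun s => (m s).negZero) := by
  obtain ⟨B, h1, h2, h3, h4⟩ := h
  have e : ∀ s, (m s).negZero.nonneg = -(m s).nonneg := fun s => by
    simp [Triple.nonneg, Triple.negZero]
  refine ⟨B, h1, ?_, h3, ?_⟩
  · simpa [e, inv_neg_mat] using h2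
  · simpa [e, inv_neg_mat] using h4.neg

/-! ### The transformation `s_0^L` of flows -/

/-- The matrix `G_0^L` over Laurent polynomials. -/
def gaugeLP (q : ℂ) : LMat :=
  !![LaurentPolynomial.C (-1 / q), 0; LaurentPolynomial.T 1, LaurentPolynomial.C (-q)]

/-- The inverse of `G_0^L` over Laurent polynomials. -/
def gaugeLPInv (q : ℂ) : LMat :=
  !![LaurentPolynomial.C (-q), 0; -LaurentPolynomial.T 1, LaurentPolynomial.C (-1 / q)]

/-- The derivative of `G_0^L` when the derivative of `q` is `q'`. -/
def gaugeLPDeriv (q q' : ℂ) : LMat :=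
  !![LaurentPolynomial.C (q' / q ^ 2), 0; 0, LaurentPolynomial.C (-q')]

theorem mInf_gaugeLP (q : ℂ) : mInf (gaugeLP q) = !![cst (-1 / q), 0; zetaInf, cst (-q)] := by
  refine mat_ext ?_ ?_ ?_ ?_ <;> simp [gaugeLP, cst_neg, lpInf_T]

theorem mZero_gaugeLP (q : ℂ) : mZero (gaugeLP q) = !![cst (-1 / q), 0; zetaZero, cst (-q)] := by
  refine mat_ext ?_ ?_ ?_ ?_ <;> simp [gaugeLP, cst_neg, lpZero_T]

theorem mInf_gaugeLPInv (q : ℂ) :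
    mInf (gaugeLPInv q) = !![cst (-q), 0; -zetaInf, cst (-1 / q)] := by
  refine mat_ext ?_ ?_ ?_ ?_ <;> simp [gaugeLPInv, cst_neg, lpInf_T]

theorem mZero_gaugeLPInv (q : ℂ) :
    mZero (gaugeLPInv q) = !![cst (-q), 0; -zetaZero, cst (-1 / q)] := by
  refine mat_ext ?_ ?_ ?_ ?_ <;> simp [gaugeLPInv, cst_neg, lpZero_T]

theorem mInf_gaugeLPDeriv (q q' : ℂ) :
    mInf (gaugeLPDeriv q q') = !![cst (q' / q ^ 2), 0; 0, cst (-q')] := by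
  refine mat_ext ?_ ?_ ?_ ?_ <;> simp [gaugeLPDeriv, cst_neg]

theorem mZero_gaugeLPDeriv (q q' : ℂ) :
    mZero (gaugeLPDeriv q q') = !![cst (q' / q ^ 2), 0; 0, cst (-q')] := by
  refine mat_ext ?_ ?_ ?_ ?_ <;> simp [gaugeLPDeriv, cst_neg]

theorem mInf_gaugeLPInv_mul {q : ℂ} (hq : q ≠ 0) : mInf (gaugeLPInv q) * mInf (gaugeLP q) = 1 := by
  have := cst_ne_zero hq
  rw [mInf_gaugeLPInv, mInf_gaugeLP]
  refine mat_ext ?_ ?_ ?_ ?_ <;>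
    simp [-Matrix.cons_mul, Matrix.mul_apply, Fin.sum_univ_two, cst_div, cst_neg] <;>
    field_simp <;> ring

theorem mZero_gaugeLPInv_mul {q : ℂ} (hq : q ≠ 0) :
    mZero (gaugeLPInv q) * mZero (gaugeLP q) = 1 := by
  have := cst_ne_zero hq
  rw [mZero_gaugeLPInv, mZero_gaugeLP]
  refine mat_ext ?_ ?_ ?_ ?_ <;>
    simp [-Matrix.cons_mul, Matrix.mul_apply, Fin.sum_univ_two, cst_div, cst_neg] <;>
    field_simp <;> ring

/-- Conjugation by G_0^L raises the degree of the Λ⁻¹ term of N and creates unwanted coefficients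
±N_{-1}/q at Λ⁰ and -N_{-1} at ζE₁₀, where N_{-1} is the coefficient of ζ⁻¹E₀₁. The derivative term
of the gauge cancels exactly these when q' = -N_{-1}. -/
theorem isNegInf_gauge {N : Mat} (hN : IsNegInf N) {q q' : ℂ} (hq : q ≠ 0)
    (h : q' = -(N 0 1).coeff 1) :
    IsNegInf (mInf (gaugeLP q) * N * mInf (gaugeLPInv q) -
      mInf (gaugeLPDeriv q q') * mInf (gaugeLPInv q)) := by
  obtain ⟨h00, h01, h10, h11⟩ := hN.entries
  have hq' := cst_ne_zero hq
  have e : mInf (gaugeLP q) * N * mInf (gaugeLPInv q) -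
      mInf (gaugeLPDeriv q q') * mInf (gaugeLPInv q) =
      !![N 0 0 + cst (1 / q) * (zetaInf * N 0 1) + cst (q' / q), cst (1 / q ^ 2) * N 0 1;
        cst q * (zetaInf * N 1 1) - cst q * (zetaInf * N 0 0) + cst (q ^ 2) * N 1 0 -
          zetaInf * (zetaInf * N 0 1) - zetaInf * cst q',
        N 1 1 - cst (1 / q) * (zetaInf * N 0 1) - cst (q' / q)] := by
    rw [mInf_gaugeLP, mInf_gaugeLPInv, mInf_gaugeLPDeriv]
    refine mat_ext ?_ ?_ ?_ ?_ <;>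
      simp [-Matrix.cons_mul, Matrix.mul_apply, Fin.sum_univ_two, cst_div, cst_neg, cst_pow,
        cst_inv] <;>
      field_simp <;> ring
  rw [e]
  refine isNegInf_of ?_ ?_ ?_ ?_
  · intro k hk
    rcases hk.lt_or_eq with hk | rfl
    · simp [h00 k hk.le, h01 (k + 1) (by omega), coeff_cst, hk.ne]
    · simp [h00 0 le_rfl, coeff_cst, h]
      ring
  · intro k hk
    simp [h01 k hk]
  · intro k hk
    rcases (show k < -1 ∨ k = -1 by omega) with hk | rfl
    · simp [h11 (k + 1) (by omega), h00 (k + 1) (by omega), h10 k (by omega),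
        h01 (k + 1 + 1) (by omega), coeff_cst, show k + 1 ≠ 0 by omega]
    · simp [h11 0 le_rfl, h00 0 le_rfl, h10 (-1) (by omega), coeff_cst, h]
  · intro k hk
    rcases hk.lt_or_eq with hk | rfl
    · simp [h11 k hk.le, h01 (k + 1) (by omega), coeff_cst, hk.ne]
    · simp [h11 0 le_rfl, coeff_cst, h]
      ring

/-- The constant diagonal entries of G_0^L and its inverse have Λ-degree 0, and ζE₁₀ has degree 1,
so conjugation cannot create negative powers. -/
theorem isNonnegZero_gauge {P : Mat} (hP : IsNonnegZero P) {q : ℂ} (hq : q ≠ 0) :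
    IsNonnegZero (mZero (gaugeLP q) * P * mZero (gaugeLPInv q)) := by
  obtain ⟨h00, h01, h10, h11⟩ := hP.entries
  have hq' := cst_ne_zero hq
  have e : mZero (gaugeLP q) * P * mZero (gaugeLPInv q) =
      !![P 0 0 + cst (1 / q) * (zetaZero * P 0 1), cst (1 / q ^ 2) * P 0 1;
        cst q * (zetaZero * P 1 1) - cst q * (zetaZero * P 0 0) + cst (q ^ 2) * P 1 0 -
          zetaZero * (zetaZero * P 0 1), P 1 1 - cst (1 / q) * (zetaZero * P 0 1)] := by
    rw [mZero_gaugeLP, mZero_gaugeLPInv]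
    refine mat_ext ?_ ?_ ?_ ?_ <;>
      simp [-Matrix.cons_mul, Matrix.mul_apply, Fin.sum_univ_two, cst_div, cst_neg, cst_pow,
        cst_inv] <;>
      field_simp <;> ring
  rw [e]
  refine isNonnegZero_of ?_ ?_ ?_ ?_
  · intro k hk
    simp [h00 k hk, h01 (k - 1) (by omega)]
  · intro k hk
    simp [h01 k hk]
  · intro k hk
    simp [h11 (k - 1) (by omega), h00 (k - 1) (by omega), h10 k hk, h01 (k - 1 - 1) (by omega)]
  · intro k hk
    simp [h11 k hk, h01 (k - 1) (by omega)]

theorem isNonnegZero_gaugeDeriv {q q' : ℂ} (hq : q ≠ 0) :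
    IsNonnegZero (mZero (gaugeLPDeriv q q') * mZero (gaugeLPInv q)) := by
  have hq' := cst_ne_zero hq
  have e : mZero (gaugeLPDeriv q q') * mZero (gaugeLPInv q) =
      !![cst (-q' / q), 0; zetaZero * cst q', cst (q' / q)] := by
    rw [mZero_gaugeLPInv, mZero_gaugeLPDeriv]
    refine mat_ext ?_ ?_ ?_ ?_ <;>
      simp [-Matrix.cons_mul, Matrix.mul_apply, Fin.sum_univ_two, cst_div, cst_neg, cst_pow] <;>
      field_simp
  rw [e]
  refine isNonnegZero_of ?_ ?_ ?_ ?_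
  · intro k hk
    simp [coeff_cst, hk.ne]
  · intro k hk
    simp
  · intro k hk
    simp [coeff_cst, show k - 1 ≠ 0 by omega]
  · intro k hk
    simp [coeff_cst, hk.ne]

theorem hasDerivAt_neg_inv {q : ℂ → ℂ} {q' : ℂ} (h : HasDerivAt q q' 0) (h0 : q 0 ≠ 0) :
    HasDerivAt (fun s => -1 / q s) (q' / q 0 ^ 2) 0 := by
  have := (h.fun_inv h0).fun_neg
  simpa [neg_div] using this

theorem HasMatDeriv.gauge_inf {F : ℂ → Mat} {D : Mat} (hF : HasMatDeriv F D) {q : ℂ → ℂ} {q' : ℂ}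
    (h : HasDerivAt q q' 0) (h0 : q 0 ≠ 0) : HasMatDeriv (fun s => mInf (gaugeLP (q s)) * F s)
      (mInf (gaugeLPDeriv (q 0) q') * F 0 + mInf (gaugeLP (q 0)) * D) := by
  have e : ∀ s, mInf (gaugeLP (q s)) * F s =
      !![cst (-1 / q s) * F s 0 0, cst (-1 / q s) * F s 0 1;
        zetaInf * F s 0 0 + cst (-q s) * F s 1 0, zetaInf * F s 0 1 + cst (-q s) * F s 1 1] := by
    intro s
    rw [mInf_gaugeLP]
    refine mat_ext ?_ ?_ ?_ ?_ <;>
      simp [-Matrix.cons_mul, Matrix.mul_apply, Fin.sum_univ_two]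
  have e' : mInf (gaugeLPDeriv (q 0) q') * F 0 + mInf (gaugeLP (q 0)) * D =
      !![cst (q' / q 0 ^ 2) * F 0 0 0 + cst (-1 / q 0) * D 0 0,
        cst (q' / q 0 ^ 2) * F 0 0 1 + cst (-1 / q 0) * D 0 1;
        zetaInf * D 0 0 + (cst (-q') * F 0 1 0 + cst (-q 0) * D 1 0),
        zetaInf * D 0 1 + (cst (-q') * F 0 1 1 + cst (-q 0) * D 1 1)] := by
    rw [mInf_gaugeLP, mInf_gaugeLPDeriv]
    refine mat_ext ?_ ?_ ?_ ?_ <;>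
      simp [-Matrix.cons_mul, Matrix.mul_apply, Fin.sum_univ_two] <;> ring
  simp only [e]
  rw [e']
  have h1 := hasDerivAt_neg_inv h h0
  exact hasMatDeriv_of ((hF 0 0).cst_mul h1) ((hF 0 1).cst_mul h1)
    ((hF 0 0).zetaInf_mul.add ((hF 1 0).cst_mul h.fun_neg))
    ((hF 0 1).zetaInf_mul.add ((hF 1 1).cst_mul h.fun_neg))

theorem HasMatDeriv.gauge_zero {F : ℂ → Mat} {D : Mat} (hF : HasMatDeriv F D) {q : ℂ → ℂ}
    {q' : ℂ} (h : HasDerivAt q q' 0) (h0 : q 0 ≠ 0) :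
    HasMatDeriv (fun s => mZero (gaugeLP (q s)) * F s)
      (mZero (gaugeLPDeriv (q 0) q') * F 0 + mZero (gaugeLP (q 0)) * D) := by
  have e : ∀ s, mZero (gaugeLP (q s)) * F s =
      !![cst (-1 / q s) * F s 0 0, cst (-1 / q s) * F s 0 1;
        zetaZero * F s 0 0 + cst (-q s) * F s 1 0, zetaZero * F s 0 1 + cst (-q s) * F s 1 1] := by
    intro s
    rw [mZero_gaugeLP]
    refine mat_ext ?_ ?_ ?_ ?_ <;>
      simp [-Matrix.cons_mul, Matrix.mul_apply, Fin.sum_univ_two]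
  have e' : mZero (gaugeLPDeriv (q 0) q') * F 0 + mZero (gaugeLP (q 0)) * D =
      !![cst (q' / q 0 ^ 2) * F 0 0 0 + cst (-1 / q 0) * D 0 0,
        cst (q' / q 0 ^ 2) * F 0 0 1 + cst (-1 / q 0) * D 0 1;
        zetaZero * D 0 0 + (cst (-q') * F 0 1 0 + cst (-q 0) * D 1 0),
        zetaZero * D 0 1 + (cst (-q') * F 0 1 1 + cst (-q 0) * D 1 1)] := by
    rw [mZero_gaugeLP, mZero_gaugeLPDeriv]
    refine mat_ext ?_ ?_ ?_ ?_ <;>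
      simp [-Matrix.cons_mul, Matrix.mul_apply, Fin.sum_univ_two] <;> ring
  simp only [e]
  rw [e']
  have h1 := hasDerivAt_neg_inv h h0
  exact hasMatDeriv_of ((hF 0 0).cst_mul h1) ((hF 0 1).cst_mul h1)
    ((hF 0 0).zetaZero_mul.add ((hF 1 0).cst_mul h.fun_neg))
    ((hF 0 1).zetaZero_mul.add ((hF 1 1).cst_mul h.fun_neg))

theorem HasMatDeriv.mul_S_zero {F : ℂ → Mat} {D : Mat} (hF : HasMatDeriv F D) :
    HasMatDeriv (fun s => F s * S zetaInf 0) (D * S zetaInf 0) := by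
  have e : ∀ A : Mat, A * S zetaInf 0 = !![-(zetaInf * A 0 1), zetaZero * A 0 0;
      -(zetaInf * A 1 1), zetaZero * A 1 0] := by
    intro A
    refine mat_ext ?_ ?_ ?_ ?_ <;>
      simp [-Matrix.cons_mul, Matrix.mul_apply, Fin.sum_univ_two, S, zetaInf_eq_inv] <;> ring
  simp only [e]
  exact hasMatDeriv_of (hF 0 1).zetaInf_mul.neg (hF 0 0).zetaZero_mul (hF 1 1).zetaInf_mul.neg
    (hF 1 0).zetaZero_mul

theorem neg_act_sL_zero (m : Triple) :
    (act (.sL 0) m).neg = mInf (gaugeLP m.q) * m.neg * S zetaInf 0 := by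
  rw [mInf_gaugeLP]
  rfl

/-- The factor Ḡ_0^L cancels between g_0 and g_{>0}. Hence both sides of the factorization are
gauged by the same Laurent polynomial matrix, and one B' serves for both expansions. -/
theorem nonneg_act_sL_zero (m : Triple) :
    (act (.sL 0) m).nonneg = mZero (gaugeLP m.q) * m.nonneg := by
  rw [mZero_gaugeLP]
  have h : IsUnit (gaugeBarL zetaZero m 0).det := by simp [gaugeBarL, Matrix.det_fin_two]
  change gaugeL zetaZero m 0 * m.zero * (gaugeBarL zetaZero m 0)⁻¹ *
    (gaugeBarL zetaZero m 0 * m.pos) = gaugeL zetaZero m 0 * (m.zero * m.pos)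
  simp only [Matrix.mul_assoc, Matrix.nonsing_inv_mul_cancel_left _ _ h]

/-- This is the source of the sign change t ↦ -t under s_0^L. -/
theorem S_zero_mul_Hmat (n : ℤ) :
    S zetaInf 0 * Hmat zetaInf n * (S zetaInf 0)⁻¹ = -Hmat zetaInf n := by
  have h : IsUnit (S zetaInf 0).det := by simp [S, Matrix.det_fin_two, zetaInf_ne_zero]
  have e : S zetaInf 0 * Hmat zetaInf n = -Hmat zetaInf n * S zetaInf 0 := by
    refine mat_ext ?_ ?_ ?_ ?_ <;>
      simp [-Matrix.cons_mul, Matrix.mul_apply, Fin.sum_univ_two, S, Hmat] <;> ring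
  rw [e, Matrix.mul_nonsing_inv_cancel_right _ _ h]

theorem mInf_gaugeLP_inv {q : ℂ} (hq : q ≠ 0) : (mInf (gaugeLP q))⁻¹ = mInf (gaugeLPInv q) :=
  Matrix.inv_eq_left_inv (mInf_gaugeLPInv_mul hq)

theorem mZero_gaugeLP_inv {q : ℂ} (hq : q ≠ 0) :
    (mZero (gaugeLP q))⁻¹ = mZero (gaugeLPInv q) :=
  Matrix.inv_eq_left_inv (mZero_gaugeLPInv_mul hq)

/-- In the leading coefficient of the product only N₀₁ times the leading 1 of the diagonal survives:
the other summand is a product of two series without constant term. -/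
theorem HasMatDeriv.hasDerivAt_q {m : ℂ → Triple} {N : Mat} (h0 : (m 0).Normal) (hN : IsNegInf N)
    (h : HasMatDeriv (fun s => (m s).neg) (-N * (m 0).neg)) :
    HasDerivAt (fun s => (m s).q) (-(N 0 1).coeff 1) 0 := by
  obtain ⟨h00, h01, h10, h11⟩ := hN.entries
  obtain ⟨n00, n01, n10, n11⟩ := h0.neg_coeff
  have := h 0 1 1
  rw [mat_neg_mul, Matrix.neg_apply, HahnSeries.coeff_neg, Matrix.mul_apply, Fin.sum_univ_two,
    HahnSeries.coeff_add,
    coeff_mul_of_lt (a := 1) (b := 1) (fun i hi => h00 i (by omega)) (fun i hi => n01 i (by omega))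
      (by norm_num),
    coeff_mul_of_eq (a := 1) (b := 0) (fun i hi => h01 i (by omega))
      (fun i hi => by rw [n11 i (by omega), if_neg hi.ne]) (by norm_num), n11 0 le_rfl] at this
  change HasDerivAt (fun s => ((m s).neg 0 1).coeff 1) _ 0
  simpa using this

theorem FlowT.act_sL_zero {n : ℕ+} {m : ℂ → Triple} (h0 : (m 0).Normal) (hq : (m 0).q ≠ 0)
    (h : FlowT n m) : FlowT n (fun s => act (.sL 0) (m (-s))) := by
  obtain ⟨B, h1, h2, h3, h4⟩ := h
  have hd := h3.hasDerivAt_q h0 h2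
  set A := (m 0).neg * Hmat zetaInf n * (m 0).neg⁻¹ with hA
  set q := (m 0).q with hqdef
  set q' := -((A - mInf B) 0 1).coeff 1 with hq'
  have hG := mInf_gaugeLPInv_mul hq
  have hG0 := mZero_gaugeLPInv_mul hq
  have hA' : (act (.sL 0) (m (-0))).neg * Hmat zetaInf n * (act (.sL 0) (m (-0))).neg⁻¹ =
      -(mInf (gaugeLP q) * A * mInf (gaugeLPInv q)) := by
    rw [neg_zero, neg_act_sL_zero, ← hqdef, Matrix.mul_inv_rev, Matrix.mul_inv_rev,
      mInf_gaugeLP_inv hq]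
    calc _ = mInf (gaugeLP q) * (m 0).neg * (S zetaInf 0 * Hmat zetaInf n * (S zetaInf 0)⁻¹) *
          ((m 0).neg⁻¹ * mInf (gaugeLPInv q)) := by simp only [Matrix.mul_assoc]
      _ = _ := by
        rw [S_zero_mul_Hmat, hA]
        simp only [mat_neg_mul, mat_mul_neg, Matrix.mul_assoc]
  -- The gauge-transformed connection G'G⁻¹ + GBG⁻¹, with an overall minus sign because the curve is
  -- run backwards.
  set B' : LMat := -(gaugeLPDeriv q q' * gaugeLPInv q + gaugeLP q * B * gaugeLPInv q) with hB'
  have hN' : (act (.sL 0) (m (-0))).neg * Hmat zetaInf n * (act (.sL 0) (m (-0))).neg⁻¹ - mInf B' =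
      -(mInf (gaugeLP q) * (A - mInf B) * mInf (gaugeLPInv q) -
        mInf (gaugeLPDeriv q q') * mInf (gaugeLPInv q)) := by
    rw [hA', hB', mInf_neg, mInf_add, mInf_mul, mInf_mul, mInf_mul, mul_sub, sub_mul]
    abel
  have hP' : mZero B' = -(mZero (gaugeLPDeriv q q') * mZero (gaugeLPInv q) +
      mZero (gaugeLP q) * mZero B * mZero (gaugeLPInv q)) := by
    rw [hB', mZero_neg, mZero_add, mZero_mul, mZero_mul, mZero_mul]
  refine ⟨B', ?_, ?_, ?_, ?_⟩
  · rw [hP']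
    exact ((isNonnegZero_gaugeDeriv hq).add (isNonnegZero_gauge h1 hq)).neg
  · rw [hN']
    exact (isNegInf_gauge h2 hq hq').neg
  · rw [hN']
    have := (h3.gauge_inf hd hq).mul_S_zero.comp_neg
    simp only [neg_zero, neg_act_sL_zero]
    rw [← hqdef] at this ⊢
    convert this using 1
    rw [neg_neg, sub_mul, add_mul]
    simp only [Matrix.mul_assoc, mat_neg_mul, mat_mul_neg]
    rw [← Matrix.mul_assoc (mInf (gaugeLPInv q)) (mInf (gaugeLP q)), hG, Matrix.one_mul]
    abel
  · rw [hP']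
    have := (h4.gauge_zero hd hq).comp_neg
    simp only [neg_zero, nonneg_act_sL_zero]
    rw [← hqdef] at this ⊢
    convert this using 1
    rw [mat_neg_mul, add_mul]
    simp only [Matrix.mul_assoc]
    rw [← Matrix.mul_assoc (mZero (gaugeLPInv q)) (mZero (gaugeLP q)), hG0, Matrix.one_mul]

theorem FlowTbar.act_sL_zero {n : ℕ+} {m : ℂ → Triple} (h0 : (m 0).Normal) (hq : (m 0).q ≠ 0)
    (h : FlowTbar n m) : FlowTbar n (fun s => act (.sL 0) (m s)) := by
  obtain ⟨B, h1, h2, h3, h4⟩ := h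
  -- For the t̄-flow the role of the negative part N is played by -B, so the same lemmas give the
  -- derivative of q and the cancellation.
  have h3' : HasMatDeriv (fun s => (m s).neg) (-(-mInf B) * (m 0).neg) := by rwa [neg_neg]
  have hd := h3'.hasDerivAt_q h0 h1.neg
  set C := (m 0).nonneg * Hmat zetaZero (-n) * (m 0).nonneg⁻¹ with hC
  set q := (m 0).q with hqdef
  set q' := -((-mInf B) 0 1).coeff 1 with hq'
  have hG := mInf_gaugeLPInv_mul hq
  have hG0 := mZero_gaugeLPInv_mul hq
  set B' : LMat := gaugeLPDeriv q q' * gaugeLPInv q + gaugeLP q * B * gaugeLPInv q with hB'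
  have hP' : (act (.sL 0) (m 0)).nonneg * Hmat zetaZero (-n) * (act (.sL 0) (m 0)).nonneg⁻¹ -
      mZero B' = mZero (gaugeLP q) * (C - mZero B) * mZero (gaugeLPInv q) +
        -(mZero (gaugeLPDeriv q q') * mZero (gaugeLPInv q)) := by
    rw [nonneg_act_sL_zero, ← hqdef, Matrix.mul_inv_rev, mZero_gaugeLP_inv hq, hB', mZero_add,
      mZero_mul, mZero_mul, mZero_mul, mul_sub, sub_mul, hC]
    simp only [Matrix.mul_assoc]
    abel
  have hN' : mInf B' = -(mInf (gaugeLP q) * (-mInf B) * mInf (gaugeLPInv q) -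
      mInf (gaugeLPDeriv q q') * mInf (gaugeLPInv q)) := by
    rw [hB', mInf_add, mInf_mul, mInf_mul, mInf_mul, mat_mul_neg, mat_neg_mul]
    abel
  refine ⟨B', ?_, ?_, ?_, ?_⟩
  · rw [hN']
    exact (isNegInf_gauge h1.neg hq hq').neg
  · rw [hP']
    exact (isNonnegZero_gauge h2 hq).add (isNonnegZero_gaugeDeriv hq).neg
  · have := (h3.gauge_inf hd hq).mul_S_zero
    simp only [neg_act_sL_zero]
    rw [← hqdef] at this ⊢
    convert this using 1
    rw [hB', mInf_add, mInf_mul, mInf_mul, mInf_mul, add_mul, add_mul]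
    simp only [Matrix.mul_assoc]
    rw [← Matrix.mul_assoc (mInf (gaugeLPInv q)) (mInf (gaugeLP q)), hG, Matrix.one_mul]
  · rw [hP']
    have := h4.gauge_zero hd hq
    simp only [nonneg_act_sL_zero]
    rw [← hqdef] at this ⊢
    convert this using 1
    rw [mat_neg_mul, add_mul, neg_add]
    simp only [Matrix.mul_assoc, mat_neg_mul, mat_mul_neg]
    rw [← Matrix.mul_assoc (mZero (gaugeLPInv q)) (mZero (gaugeLP q)), hG0, Matrix.one_mul]
    abel

/-! ### The transformation `σ` of flows -/

/-- The substitution ζ ↦ ζ⁻¹ is invisible on series in X, whose meaning merely changes. What remains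
is a conjugation, which is why products and inverses are respected. -/
theorem flip_eq_conj {z : Ser} (hz : z ≠ 0) (A : Mat) :
    flip z A = (!![1, 0; 0, z] : Mat) * A * (!![1, 0; 0, z] : Mat)⁻¹ := by
  rw [inv_diag one_ne_zero hz]
  refine mat_ext ?_ ?_ ?_ ?_ <;>
    simp [flip, -Matrix.cons_mul, Matrix.mul_apply, Fin.sum_univ_two] <;> field_simp

theorem isUnit_det_diag {z : Ser} (hz : z ≠ 0) : IsUnit (!![1, 0; 0, z] : Mat).det := by
  simp [Matrix.det_fin_two, hz]

theorem flip_mul {z : Ser} (hz : z ≠ 0) (A B : Mat) : flip z (A * B) = flip z A * flip z B := by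
  simp only [flip_eq_conj hz, Matrix.mul_assoc]
  rw [Matrix.nonsing_inv_mul_cancel_left _ _ (isUnit_det_diag hz)]

theorem flip_inv {z : Ser} (hz : z ≠ 0) (A : Mat) : flip z A⁻¹ = (flip z A)⁻¹ := by
  simp only [flip_eq_conj hz, Matrix.mul_inv_rev, Matrix.mul_assoc,
    Matrix.nonsing_inv_nonsing_inv _ (isUnit_det_diag hz)]

theorem flip_sub (z : Ser) (A B : Mat) : flip z (A - B) = flip z A - flip z B := by
  refine mat_ext ?_ ?_ ?_ ?_ <;> simp [flip] <;> ring

theorem flip_neg (z : Ser) (A : Mat) : flip z (-A) = -flip z A := by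
  refine mat_ext ?_ ?_ ?_ ?_ <;> simp [flip] <;> ring

theorem flip_diag (z a b : Ser) : flip z !![a, 0; 0, b] = !![a, 0; 0, b] := by
  refine mat_ext ?_ ?_ ?_ ?_ <;> simp [flip]

/-- The map `flip` for matrices of Laurent polynomials. -/
def flipL (B : LMat) : LMat :=
  !![LaurentPolynomial.invert (B 0 0),
      LaurentPolynomial.T (-1) * LaurentPolynomial.invert (B 0 1);
    LaurentPolynomial.T 1 * LaurentPolynomial.invert (B 1 0), LaurentPolynomial.invert (B 1 1)]

theorem mInf_flipL (B : LMat) : mInf (flipL B) = flip zetaInf (mZero B) := by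
  refine mat_ext ?_ ?_ ?_ ?_ <;> simp [flipL, flip, lpInf_T, lpInf_invert] <;> ring

theorem mZero_flipL (B : LMat) : mZero (flipL B) = flip zetaZero (mInf B) := by
  refine mat_ext ?_ ?_ ?_ ?_ <;> simp [flipL, flip, lpZero_T, lpZero_invert] <;> ring

/-- The constant matrix `diag(a, b)` over Laurent polynomials. -/
def diagL (a b : ℂ) : LMat := !![LaurentPolynomial.C a, 0; 0, LaurentPolynomial.C b]

/-- The constant matrix `diag(a, b)`. -/
def diagM (a b : ℂ) : Mat := !![cst a, 0; 0, cst b]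

theorem mInf_diagL (a b : ℂ) : mInf (diagL a b) = diagM a b := by
  refine mat_ext ?_ ?_ ?_ ?_ <;> simp [diagL, diagM]

theorem mZero_diagL (a b : ℂ) : mZero (diagL a b) = diagM a b := by
  refine mat_ext ?_ ?_ ?_ ?_ <;> simp [diagL, diagM]

theorem diagM_mul (a b c d : ℂ) : diagM a b * diagM c d = diagM (a * c) (b * d) := by
  refine mat_ext ?_ ?_ ?_ ?_ <;>
    simp [diagM, -Matrix.cons_mul, Matrix.mul_apply, Fin.sum_univ_two, cst_mul]

theorem diagM_inv {a b : ℂ} (ha : a ≠ 0) (hb : b ≠ 0) : (diagM a b)⁻¹ = diagM (1 / a) (1 / b) := by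
  rw [diagM, inv_diag (cst_ne_zero ha) (cst_ne_zero hb)]
  simp [diagM, cst_inv]

theorem diagM_one : diagM 1 1 = 1 := by
  refine mat_ext ?_ ?_ ?_ ?_ <;> simp [diagM]

theorem HasMatDeriv.diag_mul {F : ℂ → Mat} {D : Mat} (hF : HasMatDeriv F D) {a b : ℂ → ℂ}
    {a' b' : ℂ} (ha : HasDerivAt a a' 0) (hb : HasDerivAt b b' 0) :
    HasMatDeriv (fun s => diagM (a s) (b s) * F s)
      (diagM a' b' * F 0 + diagM (a 0) (b 0) * D) := by
  have e : ∀ (c d : ℂ) (A : Mat), diagM c d * A =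
      !![cst c * A 0 0, cst c * A 0 1; cst d * A 1 0, cst d * A 1 1] := by
    intro c d A
    refine mat_ext ?_ ?_ ?_ ?_ <;>
      simp [diagM, -Matrix.cons_mul, Matrix.mul_apply, Fin.sum_univ_two]
  simp only [e]
  exact hasMatDeriv_of ((hF 0 0).cst_mul ha) ((hF 0 1).cst_mul ha) ((hF 1 0).cst_mul hb)
    ((hF 1 1).cst_mul hb)

theorem HasMatDeriv.flip_inf {F : ℂ → Mat} {D : Mat} (h : HasMatDeriv F D) :
    HasMatDeriv (fun s => flip zetaInf (F s)) (flip zetaInf D) := by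
  simp only [flip, zetaInf_eq_inv, inv_inv]
  rw [← zetaInf_eq_inv]
  exact hasMatDeriv_of (h 0 0) (h 0 1).zetaZero_mul (h 1 0).zetaInf_mul (h 1 1)

theorem HasMatDeriv.flip_zero {F : ℂ → Mat} {D : Mat} (h : HasMatDeriv F D) :
    HasMatDeriv (fun s => flip zetaZero (F s)) (flip zetaZero D) := by
  simp only [flip, ← zetaInf_eq_inv]
  exact hasMatDeriv_of (h 0 0) (h 0 1).zetaInf_mul (h 1 0).zetaZero_mul (h 1 1)

/-- Reversing Λ-degrees turns nonnegative powers into nonpositive ones; the degree-0 part diag(c,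
-c) is removed by the logarithmic derivative diag(-c, c) of g_0⁻¹. -/
theorem isNegInf_flip {P : Mat} (hP : IsNonnegZero P) {e c : ℂ} (he : e ≠ 0)
    (h0 : (P 0 0).coeff 0 = c) (h1 : (P 1 1).coeff 0 = -c) :
    IsNegInf (flip zetaInf (diagM (-c) c + diagM (1 / e) e * P * diagM e (1 / e))) := by
  obtain ⟨h00, h01, h10, h11⟩ := hP.entries
  have he' := cst_ne_zero he
  have e1 : flip zetaInf (diagM (-c) c + diagM (1 / e) e * P * diagM e (1 / e)) =
      !![P 0 0 - cst c, zetaZero * (cst (1 / e ^ 2) * P 0 1);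
        zetaInf * (cst (e ^ 2) * P 1 0), P 1 1 + cst c] := by
    refine mat_ext ?_ ?_ ?_ ?_ <;>
      simp [-mul_eq_mul_left_iff, -mul_eq_mul_right_iff, flip, diagM, -Matrix.cons_mul,
        Matrix.mul_apply, Fin.sum_univ_two, cst_inv, cst_neg, cst_pow,
        zetaInf_eq_inv] <;> field_simp <;> ring
  rw [e1]
  refine isNegInf_of ?_ ?_ ?_ ?_
  · intro k hk
    rcases hk.lt_or_eq with hk | rfl
    · simp [h00 k hk, coeff_cst, hk.ne]
    · simp [h0, coeff_cst]
  · intro k hk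
    simp [h01 (k - 1) (by omega)]
  · intro k hk
    simp [h10 (k + 1) (by omega)]
  · intro k hk
    rcases hk.lt_or_eq with hk | rfl
    · simp [h11 k hk, coeff_cst, hk.ne]
    · simp [h1, coeff_cst]

/-- Strictly negative powers become strictly positive, so here a degree-0 contribution is allowed
and c may be arbitrary. -/
theorem isNonnegZero_flip {N : Mat} (hN : IsNegInf N) {e : ℂ} (he : e ≠ 0) (c : ℂ) :
    IsNonnegZero (flip zetaZero (diagM (-c) c - diagM (1 / e) e * N * diagM e (1 / e))) := by
  obtain ⟨h00, h01, h10, h11⟩ := hN.entries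
  have he' := cst_ne_zero he
  have e1 : flip zetaZero (diagM (-c) c - diagM (1 / e) e * N * diagM e (1 / e)) =
      !![-N 0 0 - cst c, -(zetaInf * (cst (1 / e ^ 2) * N 0 1));
        -(zetaZero * (cst (e ^ 2) * N 1 0)), cst c - N 1 1] := by
    refine mat_ext ?_ ?_ ?_ ?_ <;>
      simp [-mul_eq_mul_left_iff, -mul_eq_mul_right_iff, flip, diagM, -Matrix.cons_mul,
        Matrix.mul_apply, Fin.sum_univ_two, cst_inv, cst_neg, cst_pow,
        zetaInf_eq_inv] <;> field_simp <;> ring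
  rw [e1]
  refine isNonnegZero_of ?_ ?_ ?_ ?_
  · intro k hk
    simp [h00 k hk.le, coeff_cst, hk.ne]
  · intro k hk
    simp [h01 (k + 1) (by omega)]
  · intro k hk
    simp [h10 (k - 1) (by omega)]
  · intro k hk
    simp [h11 k hk.le, coeff_cst, hk.ne]

theorem Triple.Normal.nonneg_eq {m : Triple} (h : m.Normal) :
    m.nonneg = diagM m.ephi (1 / m.ephi) * m.pos := by
  rw [Triple.nonneg, h.exists_zero.2]
  rfl

theorem Triple.Normal.nonneg_entry {m : Triple} (h : m.Normal) (j : Fin 2) :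
    m.nonneg 0 j = cst m.ephi * m.pos 0 j ∧ m.nonneg 1 j = cst (1 / m.ephi) * m.pos 1 j := by
  rw [h.nonneg_eq]
  constructor <;> simp [diagM, -Matrix.cons_mul, Matrix.mul_apply, Fin.sum_univ_two]

/-- The constant terms of the diagonal of g_{≥0} are e^φ and e^{-φ}, and they evolve by the degree-0
part of P alone. Normality is needed near 0, not only at 0, to read e^φ off along the curve. -/
theorem HasMatDeriv.hasDerivAt_ephi {m : ℂ → Triple} {P : Mat} (h0 : ∀ᶠ s in 𝓝 0, (m s).Normal)
    (hP : IsNonnegZero P) (h : HasMatDeriv (fun s => (m s).nonneg) (P * (m 0).nonneg)) :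
    HasDerivAt (fun s => (m s).ephi) ((P 0 0).coeff 0 * (m 0).ephi) 0 ∧
      (P 1 1).coeff 0 = -(P 0 0).coeff 0 := by
  obtain ⟨h00, h01, h10, h11⟩ := hP.entries
  have hm := h0.self_of_nhds
  obtain ⟨p00, p01, p10, p11⟩ := hm.pos_coeff
  obtain ⟨he, -⟩ := hm.exists_zero
  have e1 : HasDerivAt (fun s => (m s).ephi) ((P 0 0).coeff 0 * (m 0).ephi) 0 := by
    have := h 0 0 0
    rw [Matrix.mul_apply, Fin.sum_univ_two, HahnSeries.coeff_add,
      (hm.nonneg_entry 0).1, (hm.nonneg_entry 0).2,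
      coeff_mul_of_eq (k := 0) (a := 0) (b := 0) h00 (fun i hi => by simp [p00 i hi.le, hi.ne])
        (by norm_num),
      coeff_mul_of_lt (a := 0) (b := 1) h01 (fun i hi => by simp [p10 i (by omega)])
        (by norm_num)] at this
    have e : ((P 0 0).coeff 0 * (cst (m 0).ephi * (m 0).pos 0 0).coeff 0 + 0) =
        (P 0 0).coeff 0 * (m 0).ephi := by simp [p00 0 le_rfl]
    rw [e] at this
    refine this.congr_of_eventuallyEq (h0.mono fun s hs => ?_)
    simp [(hs.nonneg_entry 0).1, hs.pos_coeff.1 0 le_rfl]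
  have e2 : HasDerivAt (fun s => ((m s).ephi)⁻¹) ((P 1 1).coeff 0 * ((m 0).ephi)⁻¹) 0 := by
    have := h 1 1 0
    rw [Matrix.mul_apply, Fin.sum_univ_two, HahnSeries.coeff_add,
      (hm.nonneg_entry 1).1, (hm.nonneg_entry 1).2,
      coeff_mul_of_eq (k := 0) (a := 0) (b := 0) h11 (fun i hi => by simp [p11 i hi.le, hi.ne])
        (by norm_num),
      coeff_mul_of_lt (a := 1) (b := 0) (fun i hi => h10 i (by omega))
        (fun i hi => by simp [p01 i (by omega)]) (by norm_num)] at this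
    have e : (0 + (P 1 1).coeff 0 * (cst (1 / (m 0).ephi) * (m 0).pos 1 1).coeff 0) =
        (P 1 1).coeff 0 * ((m 0).ephi)⁻¹ := by simp [p11 0 le_rfl]
    rw [e] at this
    refine this.congr_of_eventuallyEq (h0.mono fun s hs => ?_)
    simp [(hs.nonneg_entry 1).2, hs.pos_coeff.2.2.2 0 le_rfl]
  -- The degree-0 part of P is traceless because the derivative of e^{-φ} is also that of the
  -- inverse of e^φ.
  refine ⟨e1, ?_⟩
  have := e2.unique (e1.fun_inv he)
  field_simp at this
  exact this

theorem neg_act_sigma {m : Triple} (h : m.Normal) :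
    (act .sigma m).neg = flip zetaInf (diagM (1 / m.ephi) m.ephi * m.nonneg) := by
  obtain ⟨he, -⟩ := h.exists_zero
  rw [h.nonneg_eq, ← Matrix.mul_assoc, diagM_mul, one_div_mul_cancel he, mul_one_div_cancel he,
    diagM_one, Matrix.one_mul]
  rfl

theorem nonneg_act_sigma {m : Triple} (h : m.Normal) :
    (act .sigma m).nonneg = flip zetaZero (diagM (1 / m.ephi) m.ephi * m.neg) := by
  obtain ⟨he, hz⟩ := h.exists_zero
  rw [flip_mul zetaZero_ne_zero, diagM, flip_diag]
  change m.zero⁻¹ * flip zetaZero m.neg = _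
  rw [hz]
  change (diagM _ _)⁻¹ * _ = _
  rw [diagM_inv he (by simpa using he), one_div_one_div]
  rfl

theorem Hmat_zetaInf (n : ℤ) : Hmat zetaInf n = Hmat zetaZero (-n) := by
  simp [Hmat, zetaInf_eq_inv]

theorem flip_Hmat (z w : Ser) (n : ℤ) : flip z (Hmat w n) = Hmat w n := by
  rw [Hmat, flip_diag]

theorem hasDerivAt_one_div {e : ℂ → ℂ} {c : ℂ} (h : HasDerivAt e (c * e 0) 0) (h0 : e 0 ≠ 0) :
    HasDerivAt (fun s => 1 / e s) (-c * (1 / e 0)) 0 := by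
  have e1 : -c * (1 / e 0) = -(c * e 0) / e 0 ^ 2 := by field_simp
  rw [e1]
  simpa using h.fun_inv h0

theorem diagM_conj_cancel {e : ℂ} (he : e ≠ 0) :
    diagM e (1 / e) * diagM (1 / e) e = 1 := by
  rw [diagM_mul, one_div_mul_cancel he, mul_one_div_cancel he, diagM_one]

/-- With D = diag(1/e, e) and D' = diag(-c, c)·D, this is (D'D⁻¹ + DPD⁻¹)·DF = D'F + D·PF, the
product rule for the gauge by g_0⁻¹. -/
theorem diagM_gauge_mul {e : ℂ} (he : e ≠ 0) (c : ℂ) (P F : Mat) :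
    (diagM (-c) c + diagM (1 / e) e * P * diagM e (1 / e)) * (diagM (1 / e) e * F) =
      diagM (-c * (1 / e)) (c * e) * F + diagM (1 / e) e * (P * F) := by
  rw [add_mul, ← Matrix.mul_assoc, diagM_mul]
  congr 1
  simp only [Matrix.mul_assoc]
  rw [← Matrix.mul_assoc (diagM e _), diagM_conj_cancel he, Matrix.one_mul]

/-- After the reversal of powers H_{-n} at ζ = 0 becomes H_n at ζ = ∞, so t̄_n-flows become
t_n-flows. Since g_{<0} must arise from g_{>0} and not from g_{≥0}, a gauge by g_0⁻¹ enters, and B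
changes accordingly. -/
theorem FlowTbar.act_sigma {n : ℕ+} {m : ℂ → Triple} (h0 : ∀ᶠ s in 𝓝 0, (m s).Normal)
    (h : FlowTbar n m) : FlowT n (fun s => act .sigma (m s)) := by
  obtain ⟨B, h1, h2, h3, h4⟩ := h
  have hm := h0.self_of_nhds
  obtain ⟨he, -⟩ := hm.exists_zero
  obtain ⟨hd, hc⟩ := h4.hasDerivAt_ephi h0 h2.neg
  set C := (m 0).nonneg * Hmat zetaZero (-n) * (m 0).nonneg⁻¹ with hC
  set P := -(C - mZero B) with hP
  set e := (m 0).ephi with hedef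
  set c := (P 0 0).coeff 0 with hcdef
  have hd' := hasDerivAt_one_div hd he
  set B' : LMat := flipL (diagL (-c) c + diagL (1 / e) e * B * diagL e (1 / e)) with hB'
  have hI : mInf B' =
      flip zetaInf (diagM (-c) c + diagM (1 / e) e * mZero B * diagM e (1 / e)) := by
    rw [hB', mInf_flipL, mZero_add, mZero_mul, mZero_mul, mZero_diagL, mZero_diagL, mZero_diagL]
  have hZ : mZero B' =
      flip zetaZero (diagM (-c) c + diagM (1 / e) e * mInf B * diagM e (1 / e)) := by
    rw [hB', mZero_flipL, mInf_add, mInf_mul, mInf_mul, mInf_diagL, mInf_diagL, mInf_diagL]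
  have hA : (act .sigma (m 0)).neg * Hmat zetaInf n * (act .sigma (m 0)).neg⁻¹ =
      flip zetaInf (diagM (1 / e) e * C * diagM e (1 / e)) := by
    rw [neg_act_sigma hm, ← flip_inv zetaInf_ne_zero, Matrix.mul_inv_rev,
      diagM_inv (by simpa using he) he, one_div_one_div, Hmat_zetaInf,
      ← flip_Hmat zetaInf zetaZero, ← flip_mul zetaInf_ne_zero, ← flip_mul zetaInf_ne_zero, hC]
    simp only [Matrix.mul_assoc]
    rfl
  have hN : (act .sigma (m 0)).neg * Hmat zetaInf n * (act .sigma (m 0)).neg⁻¹ - mInf B' =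
      -flip zetaInf (diagM (-c) c + diagM (1 / e) e * P * diagM e (1 / e)) := by
    rw [hA, hI, ← flip_sub, ← flip_neg, hP, mat_mul_neg, mat_neg_mul, mul_sub, sub_mul]
    congr 1
    abel
  refine ⟨B', ?_, ?_, ?_, ?_⟩
  · rw [hZ]
    have := isNonnegZero_flip h1.neg he c
    rwa [mat_mul_neg, mat_neg_mul, sub_neg_eq_add] at this
  · rw [hN]
    exact (isNegInf_flip h2.neg he rfl hc).neg
  · rw [hN, neg_neg, neg_act_sigma hm]
    refine HasMatDeriv.congr ?_ (h0.mono fun s hs => neg_act_sigma hs)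
    convert (h4.diag_mul hd' hd).flip_inf using 1
    rw [← flip_mul zetaInf_ne_zero, diagM_gauge_mul he]
  · rw [hZ, nonneg_act_sigma hm]
    refine HasMatDeriv.congr ?_ (h0.mono fun s hs => nonneg_act_sigma hs)
    convert (h3.diag_mul hd' hd).flip_zero using 1
    rw [← flip_mul zetaZero_ne_zero, diagM_gauge_mul he]

theorem FlowT.act_sigma {n : ℕ+} {m : ℂ → Triple} (h0 : ∀ᶠ s in 𝓝 0, (m s).Normal)
    (h : FlowT n m) : FlowTbar n (fun s => act .sigma (m s)) := by
  obtain ⟨B, h1, h2, h3, h4⟩ := h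
  have hm := h0.self_of_nhds
  obtain ⟨he, -⟩ := hm.exists_zero
  obtain ⟨hd, hc⟩ := h4.hasDerivAt_ephi h0 h1
  set A := (m 0).neg * Hmat zetaInf n * (m 0).neg⁻¹ with hA
  set e := (m 0).ephi with hedef
  set c := (mZero B 0 0).coeff 0 with hcdef
  have hd' := hasDerivAt_one_div hd he
  set B' : LMat := flipL (diagL (-c) c + diagL (1 / e) e * B * diagL e (1 / e)) with hB'
  have hI : mInf B' =
      flip zetaInf (diagM (-c) c + diagM (1 / e) e * mZero B * diagM e (1 / e)) := by
    rw [hB', mInf_flipL, mZero_add, mZero_mul, mZero_mul, mZero_diagL, mZero_diagL, mZero_diagL]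
  have hZ : mZero B' =
      flip zetaZero (diagM (-c) c + diagM (1 / e) e * mInf B * diagM e (1 / e)) := by
    rw [hB', mZero_flipL, mInf_add, mInf_mul, mInf_mul, mInf_diagL, mInf_diagL, mInf_diagL]
  have hC : (act .sigma (m 0)).nonneg * Hmat zetaZero (-n) * (act .sigma (m 0)).nonneg⁻¹ =
      flip zetaZero (diagM (1 / e) e * A * diagM e (1 / e)) := by
    rw [nonneg_act_sigma hm, ← flip_inv zetaZero_ne_zero, Matrix.mul_inv_rev,
      diagM_inv (by simpa using he) he, one_div_one_div, ← Hmat_zetaInf,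
      ← flip_Hmat zetaZero zetaInf, ← flip_mul zetaZero_ne_zero, ← flip_mul zetaZero_ne_zero, hA]
    simp only [Matrix.mul_assoc]
    rfl
  have hP : (act .sigma (m 0)).nonneg * Hmat zetaZero (-n) * (act .sigma (m 0)).nonneg⁻¹ -
      mZero B' =
        -flip zetaZero (diagM (-c) c - diagM (1 / e) e * (A - mInf B) * diagM e (1 / e)) := by
    rw [hC, hZ, ← flip_sub, ← flip_neg, mul_sub, sub_mul]
    congr 1
    abel
  refine ⟨B', ?_, ?_, ?_, ?_⟩
  · rw [hI]
    exact isNegInf_flip h1 he rfl hc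
  · rw [hP]
    exact (isNonnegZero_flip h2 he c).neg
  · rw [hI, neg_act_sigma hm]
    refine HasMatDeriv.congr ?_ (h0.mono fun s hs => neg_act_sigma hs)
    convert (h4.diag_mul hd' hd).flip_inf using 1
    rw [← flip_mul zetaInf_ne_zero, diagM_gauge_mul he]
  · rw [hP, neg_neg, nonneg_act_sigma hm]
    refine HasMatDeriv.congr ?_ (h0.mono fun s hs => nonneg_act_sigma hs)
    convert (h3.diag_mul hd' hd).flip_zero using 1
    rw [← flip_mul zetaZero_ne_zero, ← diagM_gauge_mul he, mat_mul_neg, mat_neg_mul,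
      sub_eq_add_neg]

/-! ### Solutions are mapped to solutions -/

theorem timeMap_shiftT (g : Gen) (n : ℕ+) (p : Times) (s : ℂ) :
    timeMap g (shiftT n p s) = match g with
      | .sigma => shiftTbar n (timeMap g p) s
      | .sL _ => shiftT n (timeMap g p) (-s)
      | .sR _ => shiftT n (timeMap g p) s
      | .pi => shiftT n (timeMap g p) (-s) := by
  cases g <;> simp [timeMap, shiftT, shiftTbar, add_comm]

theorem timeMap_shiftTbar (g : Gen) (n : ℕ+) (p : Times) (s : ℂ) :
    timeMap g (shiftTbar n p s) = match g with
      | .sigma => shiftT n (timeMap g p) s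
      | .sL _ => shiftTbar n (timeMap g p) s
      | .sR _ => shiftTbar n (timeMap g p) (-s)
      | .pi => shiftTbar n (timeMap g p) (-s) := by
  cases g <;> simp [timeMap, shiftT, shiftTbar, add_comm]

theorem eventually_comp_neg {q : ℂ → Prop} (h : ∀ᶠ s in 𝓝 0, q s) : ∀ᶠ s in 𝓝 0, q (-s) := by
  have : Tendsto (fun s : ℂ => -s) (𝓝 0) (𝓝 0) := by
    simpa using (continuous_neg (G := ℂ)).tendsto 0
  exact this.eventually h

section Solutions

variable {N : Set ℕ+} {U : Set Times} {x : Times → Triple}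

theorem SolutionOn.apply_sigma (h : SolutionOn N U x) :
    SolutionOn N (domain .sigma U x) (apply .sigma x) := by
  refine ⟨?_, ?_⟩
  · rintro p ⟨hp, -⟩ n hn
    simp only [domain, Set.mem_ofPred_eq, timeMap_shiftT, timeMap_shiftTbar, Regular, and_true]
    exact (h.1 _ hp n hn).symm
  · rintro p ⟨hp, -⟩
    refine ⟨normal_act_sigma (h.2 _ hp).1, fun n hn => satoWilsonAt_iff.2 ?_⟩
    obtain ⟨h1, h2⟩ := satoWilsonAt_iff.1 ((h.2 _ hp).2 n hn)
    simp only [apply, timeMap_shiftT, timeMap_shiftTbar]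
    exact ⟨h2.act_sigma ((h.1 _ hp n hn).2.mono fun s hs => (h.2 _ hs).1),
      h1.act_sigma ((h.1 _ hp n hn).1.mono fun s hs => (h.2 _ hs).1)⟩

theorem SolutionOn.apply_pi (h : SolutionOn N U x) :
    SolutionOn N (domain .pi U x) (apply .pi x) := by
  refine ⟨?_, ?_⟩
  · rintro p ⟨hp, -⟩ n hn
    simp only [domain, Set.mem_ofPred_eq, timeMap_shiftT, timeMap_shiftTbar, Regular, and_true]
    exact ⟨eventually_comp_neg (h.1 _ hp n hn).1, eventually_comp_neg (h.1 _ hp n hn).2⟩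
  · rintro p ⟨hp, -⟩
    refine ⟨normal_act_pi (h.2 _ hp).1, fun n hn => satoWilsonAt_iff.2 ?_⟩
    obtain ⟨h1, h2⟩ := satoWilsonAt_iff.1 ((h.2 _ hp).2 n hn)
    simp only [apply, timeMap_shiftT, timeMap_shiftTbar]
    exact ⟨h1.act_pi, h2.act_pi⟩

theorem SolutionOn.apply_sL_zero (h : SolutionOn N U x) :
    SolutionOn N (domain (.sL 0) U x) (apply (.sL 0) x) := by
  refine ⟨?_, ?_⟩
  · rintro p ⟨hp, hq⟩ n hn
    obtain ⟨h1, h2⟩ := satoWilsonAt_iff.1 ((h.2 _ hp).2 n hn)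
    simp only [domain, Set.mem_ofPred_eq, timeMap_shiftT, timeMap_shiftTbar, Regular]
    -- The flow equations make q differentiable along each coordinate line, so the condition q ≠ 0
    -- keeps the domain open along those lines.
    have c1 : ContinuousAt (fun s => (x (shiftT n (timeMap (.sL 0) p) s)).q) 0 := by
      obtain ⟨B, -, -, h3, -⟩ := h1
      exact (h3 0 1 1).continuousAt
    have c2 : ContinuousAt (fun s => (x (shiftTbar n (timeMap (.sL 0) p) s)).q) 0 := by
      obtain ⟨B, -, -, h3, -⟩ := h2
      exact (h3 0 1 1).continuousAt
    have e1 := c1.eventually_ne (by simp only [shiftT_zero]; exact hq)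
    have e2 := c2.eventually_ne (by simp only [shiftTbar_zero]; exact hq)
    exact ⟨eventually_comp_neg ((h.1 _ hp n hn).1.and e1), (h.1 _ hp n hn).2.and e2⟩
  · rintro p ⟨hp, hq⟩
    refine ⟨normal_act_sL_zero (h.2 _ hp).1 hq, fun n hn => satoWilsonAt_iff.2 ?_⟩
    obtain ⟨h1, h2⟩ := satoWilsonAt_iff.1 ((h.2 _ hp).2 n hn)
    simp only [apply, timeMap_shiftT, timeMap_shiftTbar]
    refine ⟨h1.act_sL_zero ?_ ?_, h2.act_sL_zero ?_ ?_⟩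
    all_goals simp only [shiftT_zero, shiftTbar_zero]
    exacts [(h.2 _ hp).1, hq, (h.2 _ hp).1, hq]

theorem SolutionOn.congr_negZero (h : SolutionOn N U x) {U' : Set Times} {y : Times → Triple}
    (hU : U' = U) (hy : ∀ p ∈ U, y p = (x p).negZero) : SolutionOn N U' y := by
  subst hU
  refine ⟨h.1, fun p hp => ⟨by rw [hy p hp]; exact (h.2 p hp).1.negZero, fun n hn => ?_⟩⟩
  obtain ⟨h1, h2⟩ := satoWilsonAt_iff.1 ((h.2 _ hp).2 n hn)
  exact satoWilsonAt_iff.2 ⟨h1.negZero.congr ((h.1 p hp n hn).1.mono fun s hs => hy _ hs),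
    h2.negZero.congr ((h.1 p hp n hn).2.mono fun s hs => hy _ hs)⟩

/-- Covers a = -g b g, used for s_1^L with g = π and for s_i^R with g = σ; the domains agree as
well, not only the values. -/
theorem SolutionOn.apply_of_conj {a b g : Gen}
    (hg : ∀ {U : Set Times} {x : Times → Triple}, SolutionOn N U x →
      SolutionOn N (domain g U x) (apply g x))
    (hb : ∀ {U : Set Times} {x : Times → Triple}, SolutionOn N U x →
      SolutionOn N (domain b U x) (apply b x))
    (htime : ∀ p, timeMap g (timeMap b (timeMap g p)) = timeMap a p)
    (hreg : ∀ m : Triple, Regular g m)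
    (hab : ∀ m : Triple, m.Normal → (Regular b (act g m) ↔ Regular a m))
    (hact : ∀ m : Triple, m.Normal → Regular a m → act a m = (act g (act b (act g m))).negZero)
    (h : SolutionOn N U x) : SolutionOn N (domain a U x) (apply a x) := by
  have hU : domain a U x = domain g (domain b (domain g U x) (apply g x))
      (apply b (apply g x)) := by
    ext p
    simp only [domain, Set.mem_ofPred_eq, apply, htime, hreg, and_true]
    exact and_congr_right fun hp => (hab _ (h.2 _ hp).1).symm
  refine (hg (hb (hg h))).congr_negZero hU fun p hp => ?_
  rw [← hU] at hp
  simp only [apply, htime]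
  exact hact _ (h.2 _ hp.1).1 hp.2

theorem SolutionOn.apply_sL (i : Fin 2) (h : SolutionOn N U x) :
    SolutionOn N (domain (.sL i) U x) (apply (.sL i) x) := by
  match i with
  | 0 => exact h.apply_sL_zero
  | 1 =>
    exact SolutionOn.apply_of_conj (g := .pi) (b := .sL 0) SolutionOn.apply_pi
      SolutionOn.apply_sL_zero (fun p => by simp [timeMap]) (fun _ => trivial)
      (fun m hm => regular_sL_act_pi hm 0) (fun m hm hr => act_sL_one_eq hm hr) h

theorem SolutionOn.apply (g : Gen) (h : SolutionOn N U x) :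
    SolutionOn N (domain g U x) (apply g x) := by
  match g with
  | .sigma => exact h.apply_sigma
  | .pi => exact h.apply_pi
  | .sL i => exact h.apply_sL i
  | .sR i =>
    exact SolutionOn.apply_of_conj (g := .sigma) (b := .sL (1 - i)) SolutionOn.apply_sigma
      (SolutionOn.apply_sL _) (fun p => by simp [timeMap]) (fun _ => trivial)
      (fun m hm => by rw [regular_sL_act_sigma hm, sub_sub_cancel])
      (fun m hm hr => act_sR_eq hm hr) h

end Solutions

/-! ### Curves of power series -/

/-- Power series as Laurent series. -/
def psSer : PowerSeries ℂ →+* Ser := HahnSeries.ofPowerSeries ℤ ℂ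

theorem psSer_two : psSer 2 = 2 := map_ofNat psSer 2

theorem lpInf_two : lpInf 2 = 2 := map_ofNat lpInf 2

theorem lpZero_two : lpZero 2 = 2 := map_ofNat lpZero 2

theorem coeff_psSer (f : PowerSeries ℂ) (k : ℤ) :
    (psSer f).coeff k = if k < 0 then 0 else PowerSeries.coeff k.natAbs f :=
  PowerSeries.coeff_coe f k

theorem coeff_psSer_natCast (f : PowerSeries ℂ) (k : ℕ) :
    (psSer f).coeff k = PowerSeries.coeff k f := by
  simp [coeff_psSer]

theorem coeff_psSer_of_neg (f : PowerSeries ℂ) {k : ℤ} (hk : k < 0) : (psSer f).coeff k = 0 := by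
  simp [coeff_psSer, hk]

theorem psSer_X_pow (n : ℕ) : psSer (PowerSeries.X ^ n) = zetaZero ^ (n : ℤ) := by
  rw [zetaZero_zpow]
  exact HahnSeries.ofPowerSeries_X_pow n

theorem coeff_zetaZero_zpow_mul (n : ℤ) (f : Ser) (k : ℤ) :
    (zetaZero ^ n * f).coeff k = f.coeff (k - n) := by
  rw [zetaZero_zpow, HahnSeries.coeff_single_mul, one_mul]

theorem coeff_zetaInf_zpow_mul (n : ℤ) (f : Ser) (k : ℤ) :
    (zetaInf ^ n * f).coeff k = f.coeff (k + n) := by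
  rw [zetaInf_zpow, HahnSeries.coeff_single_mul, one_mul, sub_neg_eq_add]

/-- Coefficientwise derivative at `0` of a curve of power series. -/
def HasPSDeriv (f : ℂ → PowerSeries ℂ) (f' : PowerSeries ℂ) : Prop :=
  ∀ k, HasDerivAt (fun s => PowerSeries.coeff k (f s)) (PowerSeries.coeff k f') 0

namespace HasPSDeriv

variable {f g : ℂ → PowerSeries ℂ} {f' g' : PowerSeries ℂ}

theorem mul (hf : HasPSDeriv f f') (hg : HasPSDeriv g g') :
    HasPSDeriv (fun s => f s * g s) (f' * g 0 + f 0 * g') := fun k => by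
  simp only [PowerSeries.coeff_mul, map_add, ← Finset.sum_add_distrib]
  exact HasDerivAt.fun_sum fun ij _ => (hf ij.1).fun_mul (hg ij.2)

theorem const (f : PowerSeries ℂ) : HasPSDeriv (fun _ => f) 0 := fun k => by
  simpa using hasDerivAt_const (0 : ℂ) (PowerSeries.coeff k f)

theorem comp_neg (hf : HasPSDeriv f f') : HasPSDeriv (fun s => f (-s)) (-f') := fun k => by
  have h := hf k
  rw [← neg_zero] at h
  simpa [Function.comp_def] using h.scomp (0 : ℂ) (hasDerivAt_neg (0 : ℂ))

theorem psSer (hf : HasPSDeriv f f') : HasSerDeriv (fun s => psSer (f s)) (psSer f') := fun k => by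
  simp only [coeff_psSer]
  split_ifs
  · exact hasDerivAt_const _ _
  · exact hf _

end HasPSDeriv

/-! ### Exponentials of the times. -/

/-- The power series `exp(a X^n)`. -/
def expX (n : ℕ+) (a : ℂ) : PowerSeries ℂ :=
  PowerSeries.expand (n : ℕ) n.ne_zero (PowerSeries.rescale a (PowerSeries.exp ℂ))

theorem expX_add (n : ℕ+) (a b : ℂ) : expX n (a + b) = expX n a * expX n b := by
  rw [expX, ← PowerSeries.exp_mul_exp_eq_exp_add, map_mul]
  rfl

theorem expX_zero (n : ℕ+) : expX n 0 = 1 := by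
  rw [expX, PowerSeries.rescale_zero]
  simp

theorem constantCoeff_expX (n : ℕ+) (a : ℂ) : PowerSeries.constantCoeff (expX n a) = 1 := by
  rw [expX, PowerSeries.constantCoeff_expand, ← PowerSeries.coeff_zero_eq_constantCoeff_apply,
    PowerSeries.coeff_rescale]
  simp

theorem hasPSDeriv_expX (n : ℕ+) : HasPSDeriv (expX n) (PowerSeries.X ^ (n : ℕ)) := by
  intro k
  by_cases h : (n : ℕ) ∣ k
  · obtain ⟨d, rfl⟩ := h
    simp only [expX, PowerSeries.coeff_expand_mul, PowerSeries.coeff_rescale,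
      PowerSeries.coeff_exp]
    have h1 := (hasDerivAt_pow d (0 : ℂ)).mul_const ((algebraMap ℚ ℂ) (1 / d.factorial))
    refine h1.congr_deriv ?_
    rw [PowerSeries.coeff_X_pow]
    -- Of the powers a^d with d ∣-quotient of the index by n, only a¹ has nonzero derivative at a =
    -- 0, giving the single coefficient of X^n.
    match d with
    | 0 => simp [n.ne_zero.symm]
    | 1 => simp
    | d + 2 =>
      rw [if_neg]
      · simp
      · intro e
        have := n.pos
        nlinarith
  · simp only [expX, PowerSeries.coeff_expand_of_not_dvd _ _ _ h]
    rw [PowerSeries.coeff_X_pow, if_neg]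
    · exact hasDerivAt_const _ _
    · rintro rfl
      exact h dvd_rfl

/-- The power series `exp(∑ t_n X^n)`. -/
def expSum (t : ℕ+ →₀ ℂ) : PowerSeries ℂ := t.prod expX

theorem expSum_add (t u : ℕ+ →₀ ℂ) : expSum (t + u) = expSum t * expSum u :=
  Finsupp.prod_add_index' expX_zero expX_add

theorem expSum_zero : expSum 0 = 1 := Finsupp.prod_zero_index

theorem expSum_single (n : ℕ+) (a : ℂ) : expSum (Finsupp.single n a) = expX n a :=
  Finsupp.prod_single_index (expX_zero n)

theorem expSum_mul_expSum_neg (t : ℕ+ →₀ ℂ) : expSum t * expSum (-t) = 1 := by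
  rw [← expSum_add, add_neg_cancel, expSum_zero]

theorem constantCoeff_expSum (t : ℕ+ →₀ ℂ) : PowerSeries.constantCoeff (expSum t) = 1 := by
  rw [expSum, Finsupp.prod, map_prod]
  exact Finset.prod_eq_one fun n _ => constantCoeff_expX n _

theorem hasPSDeriv_expSum (t : ℕ+ →₀ ℂ) (n : ℕ+) :
    HasPSDeriv (fun s => expSum (t + Finsupp.single n s)) (PowerSeries.X ^ (n : ℕ) * expSum t) := by
  have := (HasPSDeriv.const (expSum t)).mul (hasPSDeriv_expX n)
  simp only [expSum_add, expSum_single]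
  convert this using 1
  rw [zero_mul, zero_add, mul_comm]

theorem hasPSDeriv_expSum_neg (t : ℕ+ →₀ ℂ) (n : ℕ+) :
    HasPSDeriv (fun s => expSum (-(t + Finsupp.single n s)))
      (-(PowerSeries.X ^ (n : ℕ) * expSum (-t))) := by
  have := (hasPSDeriv_expSum (-t) n).comp_neg
  simpa [neg_add, add_comm] using this

/-! ### Triangular solutions -/

/-- Sequences of functions of the times with `∂F_k/∂t_n = 2 F_{k-n}`, `∂F_k/∂t̄_n = 2 F_{k+n}`. -/
structure LinearSolution (F : ℤ → Times → ℂ) : Prop where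
  t : ∀ k n p, HasDerivAt (fun s => F k (shiftT n p s)) (2 * F (k - n) p) 0
  tbar : ∀ k n p, HasDerivAt (fun s => F k (shiftTbar n p s)) (2 * F (k + n) p) 0

/-- The series `∑_{k ≥ 1} F_{m-k} X^k`. -/
def serNeg (F : ℤ → Times → ℂ) (m : ℤ) (p : Times) : PowerSeries ℂ :=
  PowerSeries.mk fun k => if k = 0 then 0 else F (m - k) p

/-- The series `∑_{k ≥ 0} F_{m+k} X^k`. -/
def serNonneg (F : ℤ → Times → ℂ) (m : ℤ) (p : Times) : PowerSeries ℂ :=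
  PowerSeries.mk fun k => F (m + k) p

/-- The solution with upper triangular `g_{<0}` and `g_{>0}` given by a solution of the linear
equations. -/
def triangular (F : ℤ → Times → ℂ) (p : Times) : Triple where
  neg := !![psSer (expSum p.2), -psSer (expSum (-p.2) * serNeg F 0 p);
    0, psSer (expSum (-p.2))]
  zero := 1
  pos := !![psSer (expSum p.1), psSer (expSum (-p.1) * serNonneg F 0 p);
    0, psSer (expSum (-p.1))]

theorem coeff_psSer_expSum (t : ℕ+ →₀ ℂ) {k : ℤ} (hk : k ≤ 0) :
    (psSer (expSum t)).coeff k = if k = 0 then 1 else 0 := by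
  rcases hk.lt_or_eq with hk | rfl
  · rw [coeff_psSer_of_neg _ hk, if_neg hk.ne]
  · simpa [constantCoeff_expSum] using coeff_psSer_natCast (expSum t) 0

theorem psSer_expSum_mul_neg (t : ℕ+ →₀ ℂ) : psSer (expSum t) * psSer (expSum (-t)) = 1 := by
  rw [← map_mul, expSum_mul_expSum_neg, map_one]

section Triangular

variable {F : ℤ → Times → ℂ}

theorem triangular_normal (F : ℤ → Times → ℂ) (p : Times) : (triangular F p).Normal := by
  refine Triple.normal_of_coeff one_ne_zero (by simp [triangular, Matrix.one_fin_two])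
    (fun k hk => coeff_psSer_expSum _ hk) ?_ (fun k hk => rfl) (fun k hk => coeff_psSer_expSum _ hk)
    (fun k hk => coeff_psSer_expSum _ hk) ?_ (fun k hk => rfl)
    (fun k hk => coeff_psSer_expSum _ hk) ?_ ?_
  · intro k hk
    change (-psSer (expSum (-p.2) * serNeg F 0 p)).coeff k = 0
    rw [HahnSeries.coeff_neg, neg_eq_zero]
    rcases hk.lt_or_eq with hk | rfl
    · exact coeff_psSer_of_neg _ hk
    · simpa [serNeg] using coeff_psSer_natCast (expSum (-p.2) * serNeg F 0 p) 0
  · intro k hk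
    exact coeff_psSer_of_neg _ hk
  · simp [triangular, psSer_expSum_mul_neg]
  · simp [triangular, psSer_expSum_mul_neg]

/-- The polynomial `∑_{0 ≤ k < n} F_{k-n} ζ^k`. -/
def polyNonneg (F : ℤ → Times → ℂ) (n : ℕ) (p : Times) : LaurentPolynomial ℂ :=
  ∑ k ∈ Finset.range n, LaurentPolynomial.C (F (k - n) p) * LaurentPolynomial.T k

/-- The polynomial `∑_{1 ≤ k ≤ n} F_{n-k} ζ^{-k}`. -/
def polyNeg (F : ℤ → Times → ℂ) (n : ℕ) (p : Times) : LaurentPolynomial ℂ :=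
  ∑ k ∈ Finset.range n,
    LaurentPolynomial.C (F (n - (k + 1)) p) * LaurentPolynomial.T (-(k + 1))

theorem coeff_lpZero_polyNonneg (F : ℤ → Times → ℂ) (n : ℕ) (p : Times) (k : ℤ) :
    (lpZero (polyNonneg F n p)).coeff k = if 0 ≤ k ∧ k < n then F (k - n) p else 0 := by
  rw [polyNonneg, map_sum, HahnSeries.coeff_sum]
  simp only [map_mul, lpZero_C, lpZero_T, coeff_cst_mul_zetaZero_zpow]
  split_ifs with h
  · lift k to ℕ using h.1
    rw [Finset.sum_eq_single_of_mem k (by simp; omega)]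
    · simp
    · intro b _ hb
      rw [if_neg]
      exact_mod_cast hb.symm
  · refine Finset.sum_eq_zero fun b hb => if_neg ?_
    rw [Finset.mem_range] at hb
    omega

theorem coeff_lpZero_polyNeg (F : ℤ → Times → ℂ) (n : ℕ) (p : Times) (k : ℤ) :
    (lpZero (polyNeg F n p)).coeff k = if k < 0 ∧ -n ≤ k then F (k + n) p else 0 := by
  rw [polyNeg, map_sum, HahnSeries.coeff_sum]
  simp only [map_mul, lpZero_C, lpZero_T, coeff_cst_mul_zetaZero_zpow]
  split_ifs with h
  · obtain ⟨l, rfl⟩ : ∃ l : ℕ, k = -(l + 1) := ⟨(-k - 1).toNat, by omega⟩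
    rw [Finset.sum_eq_single_of_mem l (by simp; omega)]
    · rw [if_pos rfl]
      congr 2
    · intro b _ hb
      rw [if_neg]
      omega
  · refine Finset.sum_eq_zero fun b hb => if_neg ?_
    rw [Finset.mem_range] at hb
    omega

theorem coeff_lpInf (B : LaurentPolynomial ℂ) (k : ℤ) :
    (lpInf B).coeff k = (lpZero B).coeff (-k) := by
  rw [coeff_lpZero, neg_neg]

theorem coeff_psSer_serNeg (F : ℤ → Times → ℂ) (m : ℤ) (p : Times) (k : ℤ) :
    (psSer (serNeg F m p)).coeff k = if 0 < k then F (m - k) p else 0 := by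
  rw [coeff_psSer]
  split_ifs with h1 h2 h2
  · omega
  · rfl
  · rw [serNeg, PowerSeries.coeff_mk, if_neg (by omega)]
    congr 1
    omega
  · rw [serNeg, PowerSeries.coeff_mk, if_pos (by omega)]

theorem coeff_psSer_serNonneg (F : ℤ → Times → ℂ) (m : ℤ) (p : Times) (k : ℤ) :
    (psSer (serNonneg F m p)).coeff k = if 0 ≤ k then F (m + k) p else 0 := by
  rw [coeff_psSer]
  split_ifs with h1 h2 h2
  · omega
  · rfl
  · rw [serNonneg, PowerSeries.coeff_mk]
    congr 1
    omega
  · omega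

/-- Multiplying the negative half of F by ζ^n pushes its first n terms into nonnegative powers;
these form the polynomial. The next lemma says that the nonnegative half gains the same polynomial,
and the two after it treat ζ^{-n} likewise. -/
theorem zetaInf_zpow_mul_serNeg (F : ℤ → Times → ℂ) (n : ℕ) (p : Times) :
    zetaInf ^ (n : ℤ) * psSer (serNeg F 0 p) =
      psSer (serNeg F (-n) p) + lpInf (polyNonneg F n p) := by
  ext k
  rw [coeff_zetaInf_zpow_mul, HahnSeries.coeff_add, coeff_psSer_serNeg, coeff_psSer_serNeg,
    coeff_lpInf, coeff_lpZero_polyNonneg]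
  rcases lt_or_ge 0 k with h | h
  · rw [if_pos h, if_pos (by omega), if_neg (by omega), add_zero]
    congr 1
    ring
  · rw [if_neg h.not_gt, zero_add]
    by_cases h1 : 0 < k + n
    · rw [if_pos h1, if_pos (by omega)]
      congr 1
      ring
    · rw [if_neg h1, if_neg (by omega)]

theorem serNonneg_shift (F : ℤ → Times → ℂ) (n : ℕ) (p : Times) :
    psSer (serNonneg F (-n) p) =
      zetaZero ^ (n : ℤ) * psSer (serNonneg F 0 p) + lpZero (polyNonneg F n p) := by
  ext k
  rw [HahnSeries.coeff_add, coeff_zetaZero_zpow_mul, coeff_psSer_serNonneg, coeff_psSer_serNonneg,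
    coeff_lpZero_polyNonneg]
  rcases lt_or_ge k 0 with h | h
  · rw [if_neg h.not_ge, if_neg (by omega), if_neg (by omega), add_zero]
  · rw [if_pos h]
    by_cases h1 : k < n
    · rw [if_neg (by omega), if_pos (by omega), zero_add]
      congr 1
      ring
    · rw [if_pos (by omega), if_neg (by omega), add_zero]
      congr 1
      ring

theorem zetaZero_zpow_mul_serNonneg (F : ℤ → Times → ℂ) (n : ℕ) (p : Times) :
    zetaZero ^ (-(n : ℤ)) * psSer (serNonneg F 0 p) =
      psSer (serNonneg F n p) + lpZero (polyNeg F n p) := by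
  ext k
  rw [HahnSeries.coeff_add, coeff_zetaZero_zpow_mul, coeff_psSer_serNonneg, coeff_psSer_serNonneg,
    coeff_lpZero_polyNeg]
  rcases lt_or_ge k 0 with h | h
  · rw [if_neg h.not_ge, zero_add]
    by_cases h1 : -n ≤ k
    · rw [if_pos (by omega), if_pos (by omega)]
      rw [zero_add, sub_neg_eq_add]
    · rw [if_neg (by omega), if_neg (by omega), add_zero]
  · rw [if_pos h, if_pos (by omega), if_neg (by omega), add_zero]
    congr 1
    ring

theorem serNeg_shift (F : ℤ → Times → ℂ) (n : ℕ) (p : Times) :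
    psSer (serNeg F n p) =
      zetaInf ^ (-(n : ℤ)) * psSer (serNeg F 0 p) + lpInf (polyNeg F n p) := by
  ext k
  rw [HahnSeries.coeff_add, coeff_zetaInf_zpow_mul, coeff_psSer_serNeg, coeff_psSer_serNeg,
    coeff_lpInf, coeff_lpZero_polyNeg]
  rcases lt_or_ge 0 k with h | h
  · rw [if_pos h]
    by_cases h1 : k ≤ n
    · rw [if_neg (by omega), if_pos (by omega), zero_add]
      congr 1
      ring
    · rw [if_pos (by omega), if_neg (by omega), add_zero]
      congr 1
      ring
  · rw [if_neg h.not_gt, if_neg (by omega), if_neg (by omega), add_zero]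

theorem LinearSolution.serNeg_t (hF : LinearSolution F) (n : ℕ+) (p : Times) :
    HasPSDeriv (fun s => serNeg F 0 (shiftT n p s)) (2 * serNeg F (-n) p) := by
  intro k
  rw [two_mul, map_add, ← two_mul]
  simp only [serNeg, PowerSeries.coeff_mk]
  split_ifs
  · simpa using hasDerivAt_const (0 : ℂ) (0 : ℂ)
  · have e : (-n - k : ℤ) = 0 - k - n := by ring
    rw [e]
    exact hF.t _ n p

theorem LinearSolution.serNeg_tbar (hF : LinearSolution F) (n : ℕ+) (p : Times) :
    HasPSDeriv (fun s => serNeg F 0 (shiftTbar n p s)) (2 * serNeg F n p) := by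
  intro k
  rw [two_mul, map_add, ← two_mul]
  simp only [serNeg, PowerSeries.coeff_mk]
  split_ifs
  · simpa using hasDerivAt_const (0 : ℂ) (0 : ℂ)
  · have e : (n - k : ℤ) = 0 - k + n := by ring
    rw [e]
    exact hF.tbar _ n p

theorem LinearSolution.serNonneg_t (hF : LinearSolution F) (n : ℕ+) (p : Times) :
    HasPSDeriv (fun s => serNonneg F 0 (shiftT n p s)) (2 * serNonneg F (-n) p) := by
  intro k
  rw [two_mul, map_add, ← two_mul]
  simp only [serNonneg, PowerSeries.coeff_mk]
  have e : (-n + k : ℤ) = 0 + k - n := by ring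
  rw [e]
  exact hF.t _ n p

theorem LinearSolution.serNonneg_tbar (hF : LinearSolution F) (n : ℕ+) (p : Times) :
    HasPSDeriv (fun s => serNonneg F 0 (shiftTbar n p s)) (2 * serNonneg F n p) := by
  intro k
  rw [two_mul, map_add, ← two_mul]
  simp only [serNonneg, PowerSeries.coeff_mk]
  have e : (n + k : ℤ) = 0 + k + n := by ring
  rw [e]
  exact hF.tbar _ n p

theorem inv_upper_unimodular {a b c : Ser} (h : a * b = 1) :
    (!![a, c; 0, b] : Mat)⁻¹ = !![b, -c; 0, a] := by
  apply Matrix.inv_eq_left_inv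
  refine mat_ext ?_ ?_ ?_ ?_ <;> simp
  · linear_combination h
  · ring
  · exact h

theorem HasSerDeriv.const (f : Ser) : HasSerDeriv (fun _ => f) 0 := fun k => by
  simpa using hasDerivAt_const (0 : ℂ) (f.coeff k)

theorem nonneg_triangular (F : ℤ → Times → ℂ) (p : Times) :
    (triangular F p).nonneg = (triangular F p).pos := by
  simp [Triple.nonneg, triangular]

/-- Formally g_{<0}⁻¹ g_{≥0} is upper triangular with off-diagonal entry exp(-∑ t_n ζ^n - ∑ t̄_n
ζ^{-n}) F, and `triangular` is its Gauss decomposition. Multiplying F by ζ^n moves finitely many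
terms across the splitting, which accounts for the off-diagonal part of B. -/
theorem LinearSolution.flowT (hF : LinearSolution F) (n : ℕ+) (p : Times) :
    FlowT n (fun s => triangular F (shiftT n p s)) := by
  have hE := psSer_expSum_mul_neg p.2
  let B : LMat := !![LaurentPolynomial.T n, 2 * polyNonneg F n p; 0, -LaurentPolynomial.T n]
  have hI : mInf B =
      !![zetaInf ^ (n : ℤ), 2 * lpInf (polyNonneg F n p); 0, -zetaInf ^ (n : ℤ)] := by
    refine mat_ext ?_ ?_ ?_ ?_ <;> simp [B, lpInf_T, lpInf_two]
  have hZ : mZero B =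
      !![zetaZero ^ (n : ℤ), 2 * lpZero (polyNonneg F n p); 0, -zetaZero ^ (n : ℤ)] := by
    refine mat_ext ?_ ?_ ?_ ?_ <;> simp [B, lpZero_T, lpZero_two]
  have hN : (triangular F p).neg * Hmat zetaInf n * (triangular F p).neg⁻¹ - mInf B =
      !![0, 2 * psSer (serNeg F (-n) p); 0, 0] := by
    have h1 := zetaInf_zpow_mul_serNeg F n p
    rw [hI, triangular, inv_upper_unimodular hE]
    refine mat_ext ?_ ?_ ?_ ?_ <;>
      simp [-Matrix.cons_mul, Matrix.mul_apply, Fin.sum_univ_two, Hmat] at h1 ⊢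
    · linear_combination zetaInf ^ (n : ℕ) * hE
    · linear_combination (2 * zetaInf ^ (n : ℕ) * psSer (serNeg F 0 p)) * hE + 2 * h1
    · linear_combination -zetaInf ^ (n : ℕ) * hE
  refine ⟨B, ?_, ?_, ?_, ?_⟩
  · rw [hZ]
    refine isNonnegZero_of ?_ ?_ ?_ ?_
    · intro k hk
      change (zetaZero ^ (n : ℤ)).coeff k = 0
      rw [← psSer_X_pow, coeff_psSer_of_neg _ hk]
    · intro k hk
      simp [two_mul, coeff_lpZero_polyNonneg, hk.not_ge]
    · intro k hk
      rfl
    · intro k hk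
      change (-zetaZero ^ (n : ℤ)).coeff k = 0
      rw [HahnSeries.coeff_neg, ← psSer_X_pow, coeff_psSer_of_neg _ hk, neg_zero]
  all_goals simp only [shiftT_zero, nonneg_triangular]
  · rw [hN]
    refine isNegInf_of (fun k hk => rfl) ?_ (fun k hk => rfl) (fun k hk => rfl)
    intro k hk
    simp [two_mul, coeff_psSer_serNeg, hk.not_gt]
  · rw [hN]
    have e : -(!![0, 2 * psSer (serNeg F (-n) p); 0, 0] : Mat) * (triangular F p).neg =
        !![0, -psSer (0 * serNeg F 0 p + expSum (-p.2) * (2 * serNeg F (-n) p)); 0, 0] := by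
      rw [triangular]
      refine mat_ext ?_ ?_ ?_ ?_ <;>
        simp [-Matrix.cons_mul, Matrix.mul_apply, Fin.sum_univ_two, psSer_two]
      ring
    rw [e]
    have h1 := (HasPSDeriv.const (expSum (-p.2))).mul (hF.serNeg_t n p)
    simp only [shiftT_zero] at h1
    exact hasMatDeriv_of (HasSerDeriv.const (psSer (expSum p.2))) h1.psSer.neg
      (HasSerDeriv.const 0) (HasSerDeriv.const (psSer (expSum (-p.2))))
  · rw [hZ]
    have h1 := serNonneg_shift F n p
    have e : !![zetaZero ^ (n : ℤ), 2 * lpZero (polyNonneg F n p); 0, -zetaZero ^ (n : ℤ)] *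
        (triangular F p).pos = !![psSer (PowerSeries.X ^ (n : ℕ) * expSum p.1),
          psSer (-(PowerSeries.X ^ (n : ℕ) * expSum (-p.1)) * serNonneg F 0 p +
            expSum (-p.1) * (2 * serNonneg F (-n) p));
          0, psSer (-(PowerSeries.X ^ (n : ℕ) * expSum (-p.1)))] := by
      rw [triangular]
      simp only [map_add, map_mul, map_neg, psSer_X_pow]
      refine mat_ext ?_ ?_ ?_ ?_ <;>
        simp [-Matrix.cons_mul, Matrix.mul_apply, Fin.sum_univ_two, psSer_two] at h1 ⊢
      · linear_combination (-2 * psSer (expSum (-p.1))) * h1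
      · ring
    rw [e]
    have h2 := (hasPSDeriv_expSum_neg p.1 n).mul (hF.serNonneg_t n p)
    simp only [shiftT_zero, Finsupp.single_zero, add_zero] at h2
    exact hasMatDeriv_of (hasPSDeriv_expSum p.1 n).psSer h2.psSer (HasSerDeriv.const 0)
      (hasPSDeriv_expSum_neg p.1 n).psSer

theorem LinearSolution.flowTbar (hF : LinearSolution F) (n : ℕ+) (p : Times) :
    FlowTbar n (fun s => triangular F (shiftTbar n p s)) := by
  have hE := psSer_expSum_mul_neg p.1
  let B : LMat :=
    !![LaurentPolynomial.T (-n), -(2 * polyNeg F n p); 0, -LaurentPolynomial.T (-n)]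
  have hI : mInf B =
      !![zetaZero ^ (n : ℤ), -(2 * lpInf (polyNeg F n p)); 0, -zetaZero ^ (n : ℤ)] := by
    refine mat_ext ?_ ?_ ?_ ?_ <;> simp [B, lpInf_T, lpInf_two, zetaInf_eq_inv]
  have hZ : mZero B =
      !![zetaZero ^ (-(n : ℤ)), -(2 * lpZero (polyNeg F n p)); 0, -zetaZero ^ (-(n : ℤ))] := by
    refine mat_ext ?_ ?_ ?_ ?_ <;> simp [B, lpZero_T, lpZero_two]
  have hP : (triangular F p).pos * Hmat zetaZero (-n) * (triangular F p).pos⁻¹ - mZero B =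
      !![0, -(2 * psSer (serNonneg F n p)); 0, 0] := by
    have h1 := zetaZero_zpow_mul_serNonneg F n p
    rw [hZ, triangular, inv_upper_unimodular hE]
    refine mat_ext ?_ ?_ ?_ ?_ <;>
      simp only [Matrix.mul_apply, Fin.sum_univ_two, Hmat, Matrix.sub_apply,
        map_mul, Matrix.of_apply, Matrix.cons_val', Matrix.cons_val_zero, Matrix.cons_val_one,
        Matrix.cons_val_fin_one, mul_zero, zero_mul, add_zero, zero_add, sub_zero] at h1 ⊢
    · linear_combination zetaZero ^ (-(n : ℤ)) * hE
    · linear_combination (-2 * zetaZero ^ (-(n : ℤ)) * psSer (serNonneg F 0 p)) * hE - 2 * h1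
    · linear_combination -zetaZero ^ (-(n : ℤ)) * hE
  refine ⟨B, ?_, ?_, ?_, ?_⟩
  · rw [hI]
    -- Here n ≥ 1 matters: ζ^{-n} on the diagonal must have strictly negative Λ-degree.
    have hn := n.pos
    have h2 : ∀ k : ℤ, k ≤ 0 → (psSer (PowerSeries.X ^ (n : ℕ))).coeff k = 0 := by
      intro k hk
      rw [coeff_psSer]
      split_ifs
      · rfl
      · rw [PowerSeries.coeff_X_pow, if_neg (by omega)]
    refine isNegInf_of ?_ ?_ (fun k hk => rfl) ?_
    · intro k hk
      simpa [psSer_X_pow] using h2 k hk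
    · intro k hk
      simp [two_mul, coeff_lpInf, coeff_lpZero_polyNeg, hk.not_gt]
    · intro k hk
      simpa [psSer_X_pow] using h2 k hk
  all_goals simp only [shiftTbar_zero, nonneg_triangular]
  · rw [hP]
    refine isNonnegZero_of (fun k hk => rfl) ?_ (fun k hk => rfl) (fun k hk => rfl)
    intro k hk
    simp [two_mul, coeff_psSer_serNonneg, hk.not_ge]
  · rw [hI]
    have h1 := serNeg_shift F n p
    have e : !![zetaZero ^ (n : ℤ), -(2 * lpInf (polyNeg F n p)); 0, -zetaZero ^ (n : ℤ)] *
        (triangular F p).neg = !![psSer (PowerSeries.X ^ (n : ℕ) * expSum p.2),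
          -psSer (-(PowerSeries.X ^ (n : ℕ) * expSum (-p.2)) * serNeg F 0 p +
            expSum (-p.2) * (2 * serNeg F n p));
          0, psSer (-(PowerSeries.X ^ (n : ℕ) * expSum (-p.2)))] := by
      rw [triangular]
      simp only [map_add, map_mul, map_neg, psSer_X_pow]
      refine mat_ext ?_ ?_ ?_ ?_ <;>
        simp [-Matrix.cons_mul, Matrix.mul_apply, Fin.sum_univ_two, zetaInf_eq_inv,
          psSer_two] at h1 ⊢
      · linear_combination (2 * psSer (expSum (-p.2))) * h1
      · ring
    rw [e]
    have h2 := (hasPSDeriv_expSum_neg p.2 n).mul (hF.serNeg_tbar n p)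
    simp only [shiftTbar_zero, Finsupp.single_zero, add_zero] at h2
    exact hasMatDeriv_of (hasPSDeriv_expSum p.2 n).psSer h2.psSer.neg (HasSerDeriv.const 0)
      (hasPSDeriv_expSum_neg p.2 n).psSer
  · rw [hP]
    have e : -(!![0, -(2 * psSer (serNonneg F n p)); 0, 0] : Mat) * (triangular F p).pos =
        !![0, psSer (0 * serNonneg F 0 p + expSum (-p.1) * (2 * serNonneg F n p)); 0, 0] := by
      rw [triangular]
      refine mat_ext ?_ ?_ ?_ ?_ <;>
        simp [-Matrix.cons_mul, Matrix.mul_apply, Fin.sum_univ_two, psSer_two]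
      ring
    rw [e]
    have h1 := (HasPSDeriv.const (expSum (-p.1))).mul (hF.serNonneg_tbar n p)
    simp only [shiftTbar_zero] at h1
    exact hasMatDeriv_of (HasSerDeriv.const (psSer (expSum p.1))) h1.psSer
      (HasSerDeriv.const 0) (HasSerDeriv.const (psSer (expSum (-p.1))))

theorem LinearSolution.solutionOn (hF : LinearSolution F) :
    SolutionOn Set.univ Set.univ (triangular F) :=
  ⟨fun p _ n _ => by simp, fun p _ => ⟨triangular_normal F p, fun n _ =>
    satoWilsonAt_iff.2 ⟨hF.flowT n p, hF.flowTbar n p⟩⟩⟩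

end Triangular

/-! ### Superpositions of exponentials -/

/-- The linear function `∑ (t_n a^n + t̄_n a^{-n})` of the times. -/
def phase (a : ℂ) (p : Times) : ℂ :=
  p.1.sum (fun n s => s * a ^ (n : ℕ)) + p.2.sum (fun n s => s * (a ^ (n : ℕ))⁻¹)

theorem phase_shiftT (a : ℂ) (n : ℕ+) (p : Times) (s : ℂ) :
    phase a (shiftT n p s) = phase a p + s * a ^ (n : ℕ) := by
  simp only [phase, shiftT]
  rw [Finsupp.sum_add_index' (by simp) (by intros; ring), Finsupp.sum_single_index (by simp)]
  ring

theorem phase_shiftTbar (a : ℂ) (n : ℕ+) (p : Times) (s : ℂ) :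
    phase a (shiftTbar n p s) = phase a p + s * (a ^ (n : ℕ))⁻¹ := by
  simp only [phase, shiftTbar]
  rw [Finsupp.sum_add_index' (by simp) (by intros; ring), Finsupp.sum_single_index (by simp)]
  ring

/-- The sequence `F_k = ∑_j c_j a_j^{-k-1} exp(2 ∑ (t_n a_j^n + t̄_n a_j^{-n}))`. -/
def expSequence {ι : Type*} [Fintype ι] (a c : ι → ℂ) (k : ℤ) (p : Times) : ℂ :=
  ∑ j, c j * a j ^ (-k - 1) * Complex.exp (2 * phase (a j) p)

theorem hasDerivAt_exp_line (b u d : ℂ) :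
    HasDerivAt (fun s : ℂ => b * Complex.exp (2 * (u + s * d))) (2 * (d * b * Complex.exp (2 * u)))
      0 := by
  have h1 : HasDerivAt (fun s : ℂ => 2 * (u + s * d)) (2 * d) 0 := by
    simpa using (((hasDerivAt_id (0 : ℂ)).mul_const d).const_add u).const_mul 2
  have h2 := h1.cexp.const_mul b
  refine h2.congr_deriv ?_
  rw [zero_mul, add_zero]
  ring

/-- Each exponential is an eigenfunction: differentiation in t_n multiplies it by 2a^n, which is the
shift k ↦ k - n in a^{-k-1}; likewise for t̄_n with a^{-n}. -/
theorem linearSolution_expSequence {ι : Type*} [Fintype ι] {a : ι → ℂ} (ha : ∀ j, a j ≠ 0)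
    (c : ι → ℂ) : LinearSolution (expSequence a c) := by
  refine ⟨fun k n p => ?_, fun k n p => ?_⟩
  · simp only [expSequence, phase_shiftT, Finset.mul_sum]
    refine HasDerivAt.fun_sum fun j _ => ?_
    refine (hasDerivAt_exp_line (c j * a j ^ (-k - 1)) (phase (a j) p)
      (a j ^ (n : ℕ))).congr_deriv ?_
    rw [show (-(k - n) - 1 : ℤ) = (-k - 1) + (n : ℕ) by ring, zpow_add₀ (ha j),
      zpow_natCast]
    ring
  · simp only [expSequence, phase_shiftTbar, Finset.mul_sum]
    refine HasDerivAt.fun_sum fun j _ => ?_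
    refine (hasDerivAt_exp_line (c j * a j ^ (-k - 1)) (phase (a j) p)
      ((a j ^ (n : ℕ))⁻¹)).congr_deriv ?_
    rw [show (-(k + n) - 1 : ℤ) = (-k - 1) + -(n : ℕ) by ring, zpow_add₀ (ha j),
      zpow_neg, zpow_natCast]
    ring

open Polynomial in
/-- Real polynomials in `ζ`, as elements of `ℂ((ζ⁻¹))`. -/
def polyInf : ℝ[X] →+* Ser :=
  Polynomial.eval₂RingHom ((HahnSeries.C (Γ := ℤ) (R := ℂ)).comp Complex.ofRealHom) zetaInf

/-! ### Moment series and orthogonal polynomials. -/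

section Moments

open Polynomial

theorem polyInf_X : polyInf X = zetaInf := by
  simp [polyInf]

theorem polyInf_C (a : ℝ) : polyInf (C a) = cst a := by
  simp [polyInf, cst]

theorem polyInf_monomial (n : ℕ) (a : ℝ) :
    polyInf (monomial n a) = cst a * zetaInf ^ (n : ℤ) := by
  rw [← C_mul_X_pow_eq_monomial, map_mul, map_pow, polyInf_C, polyInf_X, zpow_natCast]

theorem coeff_polyInf (P : ℝ[X]) (n : ℕ) : (polyInf P).coeff (-n) = P.coeff n := by
  induction P using Polynomial.induction_on' with
  | add P Q hP hQ => simp [hP, hQ]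
  | monomial m a =>
    rw [polyInf_monomial, coeff_cst_mul, zetaInf_zpow, HahnSeries.coeff_single, coeff_monomial]
    split_ifs with h1 h2 h2
    · simp
    · omega
    · omega
    · simp

theorem coeff_polyInf_of_pos (P : ℝ[X]) {k : ℤ} (hk : 0 < k) : (polyInf P).coeff k = 0 := by
  induction P using Polynomial.induction_on' with
  | add P Q hP hQ => simp [hP, hQ]
  | monomial m a =>
    rw [polyInf_monomial, coeff_cst_mul, zetaInf_zpow, HahnSeries.coeff_single, if_neg (by omega),
      mul_zero]

/-- `u = ∑ L(X^n) ζ^{-n-1}`. -/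
def IsMomentSeries (L : ℝ[X] →ₗ[ℝ] ℝ) (u : Ser) : Prop := ∀ n : ℕ, u.coeff (n + 1) = L (X ^ n)

variable {L : ℝ[X] →ₗ[ℝ] ℝ} {u : Ser}

/-- Multiplication by a power of ζ shifts the moments. Thus vanishing of coefficients of Pu is
orthogonality of P to powers of X, the mechanism of Padé approximation. -/
theorem IsMomentSeries.coeff_mul (hu : IsMomentSeries L u) (P : ℝ[X]) (n : ℕ) :
    (polyInf P * u).coeff (n + 1) = L (X ^ n * P) := by
  induction P using Polynomial.induction_on' with
  | add P Q hP hQ => simp [mul_add, add_mul, hP, hQ]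
  | monomial m a =>
    have h := hu (n + m)
    push_cast at h
    rw [polyInf_monomial, mul_assoc, coeff_cst_mul, coeff_zetaInf_zpow_mul, add_right_comm, h,
      ← mul_one a, ← smul_eq_mul a 1, ← smul_monomial, mul_smul_comm, map_smul,
      monomial_one_right_eq_X_pow, ← pow_add]
    simp

theorem IsMomentSeries.coeff_sub (hu : IsMomentSeries L u) (P Q : ℝ[X]) (n : ℕ) :
    (polyInf Q - polyInf P * u).coeff (n + 1) = -(L (X ^ n * P) : ℂ) := by
  rw [HahnSeries.coeff_sub, hu.coeff_mul, coeff_polyInf_of_pos _ (by omega), zero_sub]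

/-- The normalization of a diagonal entry of g_{<0}, after extracting the power ζ^{-d}, fixes the
degree and the leading coefficient. -/
theorem monic_of_polyInf {P : ℝ[X]} {d : ℕ}
    (h : ∀ j : ℤ, j ≤ 0 → (zetaInf ^ (-(d : ℤ)) * polyInf P).coeff j = if j = 0 then 1 else 0) :
    P.Monic ∧ P.natDegree = d := by
  have h1 : ∀ i : ℕ, P.coeff (d + i) = if i = 0 then 1 else 0 := by
    intro i
    have h2 := h (-i) (by omega)
    rw [coeff_zetaInf_zpow_mul, ← neg_add, add_comm, ← Nat.cast_add, coeff_polyInf] at h2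
    have h3 : (P.coeff (d + i) : ℂ) = ((if i = 0 then 1 else 0 : ℝ) : ℂ) := by
      rw [h2]
      by_cases hi : i = 0 <;> simp [hi]
    exact_mod_cast h3
  have h4 : P.natDegree ≤ d := by
    rw [natDegree_le_iff_coeff_eq_zero]
    intro N hN
    obtain ⟨i, rfl⟩ := Nat.exists_eq_add_of_lt hN
    rw [add_assoc, h1, if_neg (by omega)]
  have h5 : P.coeff d = 1 := by simpa using h1 0
  exact ⟨monic_of_natDegree_le_of_coeff_eq_one d h4 h5,
    natDegree_eq_of_le_of_coeff_ne_zero h4 (by simp [h5])⟩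

/-- The lower-order terms of the monic A contribute nothing, by orthogonality of B to them. -/
theorem apply_mul_of_orthogonal {A B : ℝ[X]} (hA : A.Monic)
    (h : ∀ n < A.natDegree, L (X ^ n * B) = 0) : L (X ^ A.natDegree * B) = L (A * B) := by
  conv_rhs => rw [hA.as_sum, add_mul, Finset.sum_mul, map_add, map_sum]
  rw [Finset.sum_eq_zero, add_zero]
  intro n hn
  rw [mul_assoc, C_mul', map_smul, h n (Finset.mem_range.1 hn), smul_zero]

/-- The mean value of a polynomial over the points `-2, …, -(M+1)`. -/
def meanValue (M : ℕ) : ℝ[X] →ₗ[ℝ] ℝ :=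
  (M : ℝ)⁻¹ • ∑ j : Fin M, leval (-((j : ℝ) + 2))

theorem meanValue_apply (M : ℕ) (P : ℝ[X]) :
    meanValue M P = (M : ℝ)⁻¹ * ∑ j : Fin M, P.eval (-((j : ℝ) + 2)) := by
  simp [meanValue, leval]

theorem exists_eval_ne_zero {M : ℕ} {P : ℝ[X]} (hP : P ≠ 0) (hd : P.natDegree < M) :
    ∃ j : Fin M, P.eval (-((j : ℝ) + 2)) ≠ 0 := by
  by_contra! h
  refine hP (eq_zero_of_natDegree_lt_card_of_eval_eq_zero P (f := fun j : Fin M => -((j : ℝ) + 2))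
    ?_ h (by simpa))
  intro i j hij
  simpa [Fin.ext_iff] using hij

theorem meanValue_mul_self_pos {M : ℕ} {P : ℝ[X]} (hP : P ≠ 0) (hd : P.natDegree < M) :
    0 < meanValue M (P * P) := by
  obtain ⟨j, hj⟩ := exists_eval_ne_zero hP hd
  have hM : 0 < (M : ℝ) := by exact_mod_cast (Nat.zero_le _).trans_lt hd
  rw [meanValue_apply]
  refine mul_pos (inv_pos.2 hM) (Finset.sum_pos' (fun i _ => ?_) ⟨j, Finset.mem_univ _, ?_⟩)
  · rw [eval_mul]
    exact mul_self_nonneg _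
  · rw [eval_mul]
    exact mul_self_pos.2 hj

/-- All points of the measure are negative, and a nonzero polynomial of degree less than M cannot
vanish at all M of them. -/
theorem meanValue_X_mul_self_neg {M : ℕ} {P : ℝ[X]} (hP : P ≠ 0) (hd : P.natDegree < M) :
    meanValue M (P * (X * P)) < 0 := by
  obtain ⟨j, hj⟩ := exists_eval_ne_zero hP hd
  have hM : 0 < (M : ℝ) := by exact_mod_cast (Nat.zero_le _).trans_lt hd
  have key : ∀ i : Fin M, (P * (X * P)).eval (-((i : ℝ) + 2)) =
      -(((i : ℝ) + 2) * (P.eval (-((i : ℝ) + 2)) * P.eval (-((i : ℝ) + 2)))) := by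
    intro i
    simp only [eval_mul, eval_X]
    ring
  rw [meanValue_apply]
  simp only [key, Finset.sum_neg_distrib, mul_neg, neg_lt_zero]
  refine mul_pos (inv_pos.2 hM) (Finset.sum_pos' (fun i _ => ?_) ⟨j, Finset.mem_univ _, ?_⟩)
  · exact mul_nonneg (by positivity) (mul_self_nonneg _)
  · exact mul_pos (by positivity) (mul_self_pos.2 hj)

end Moments

/-! ### The chain generated from a triangular solution -/

open Polynomial in
/-- The values with `g_{<0} = N(ζ) g_0 diag(ζ^{-k}, ζ^k)`, where `g_0 = !![1, -u; 0, 1]`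
and `N` is a
real polynomial matrix. -/
structure EvenStage (u : Ser) (k : ℕ) (m : Triple) : Prop where
  normal : m.Normal
  ephi : ∃ e : ℝ, m.ephi = e
  neg : ∃ A B C D : ℝ[X], B.coeff 0 = 0 ∧ m.neg =
    !![zetaInf ^ (-(k : ℤ)) * polyInf A, zetaInf ^ (k : ℤ) * (polyInf C - polyInf A * u);
      zetaInf ^ (-(k : ℤ)) * polyInf B, zetaInf ^ (k : ℤ) * (polyInf D - polyInf B * u)]

open Polynomial in
/-- The values with `g_{<0} = N(ζ) g_0 !![0, ζ^{-k-1}; -ζ^{k+1}, 0]`, where `g_0 = !![1, -u; 0, 1]`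
and `N` is a real polynomial matrix. -/
structure OddStage (u : Ser) (k : ℕ) (m : Triple) : Prop where
  normal : m.Normal
  ephi : ∃ e : ℝ, m.ephi = e
  neg : ∃ A B C D : ℝ[X], B.coeff 0 = 0 ∧ m.neg =
    !![-(zetaInf ^ ((k + 1 : ℕ) : ℤ) * (polyInf C - polyInf A * u)),
        zetaInf ^ (-((k + 1 : ℕ) : ℤ)) * polyInf A;
      -(zetaInf ^ ((k + 1 : ℕ) : ℤ) * (polyInf D - polyInf B * u)),
        zetaInf ^ (-((k + 1 : ℕ) : ℤ)) * polyInf B]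

section Stages

open Polynomial

variable {L : ℝ[X] →ₗ[ℝ] ℝ} {u : Ser} {M k : ℕ} {m : Triple}

/-- The first row of g_{<0} is a Padé approximation: A is monic of degree k and orthogonal to lower
degrees, and q is minus its squared norm. This is nonzero as long as k is below the number M of
points. -/
theorem EvenStage.exists_q_neg (hu : IsMomentSeries (meanValue M) u) (hm : EvenStage u k m)
    (hk : k < M) : ∃ x : ℝ, m.q = x ∧ x < 0 := by
  obtain ⟨A, B, C, D, -, hN⟩ := hm.neg
  have h00 : m.neg 0 0 = zetaInf ^ (-(k : ℤ)) * polyInf A := by rw [hN]; rfl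
  have h01 : m.neg 0 1 = zetaInf ^ (k : ℤ) * (polyInf C - polyInf A * u) := by rw [hN]; rfl
  obtain ⟨hA, hd⟩ := monic_of_polyInf (h00 ▸ hm.normal.neg_coeff.1)
  -- For n < k the coefficient index n + 1 - k is at most 0, where normality forces vanishing; n = k
  -- gives q itself.
  have key : ∀ n : ℕ, (m.neg 0 1).coeff (n + 1 - k) = -(meanValue M (X ^ n * A) : ℂ) := by
    intro n
    rw [h01, coeff_zetaInf_zpow_mul, sub_add_cancel, hu.coeff_sub]
  have h0 : ∀ n < A.natDegree, meanValue M (X ^ n * A) = 0 := by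
    intro n hn
    have h1 := key n
    rw [hm.normal.neg_coeff.2.1 _ (by omega)] at h1
    exact_mod_cast neg_eq_zero.1 h1.symm
  refine ⟨-meanValue M (A * A), ?_, neg_lt_zero.2 (meanValue_mul_self_pos hA.ne_zero (by omega))⟩
  have h1 := key k
  rw [add_sub_cancel_left] at h1
  rw [Triple.q, h1, ← apply_mul_of_orthogonal hA h0, hd]
  push_cast
  rfl

/-- The same argument for the second row, with B = XQ: Q is the monic orthogonal polynomial for the
measure weighted by X, and r is its norm, negative because the weight is. -/
theorem OddStage.exists_r_neg (hu : IsMomentSeries (meanValue M) u) (hm : OddStage u k m)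
    (hk : k < M) : ∃ x : ℝ, m.r = x ∧ x < 0 := by
  obtain ⟨A, B, C, D, hB0, hN⟩ := hm.neg
  have h11 : m.neg 1 1 = zetaInf ^ (-((k + 1 : ℕ) : ℤ)) * polyInf B := by rw [hN]; rfl
  have h10 : m.neg 1 0 = -(zetaInf ^ ((k + 1 : ℕ) : ℤ) * (polyInf D - polyInf B * u)) := by
    rw [hN]; rfl
  obtain ⟨hB, hd⟩ := monic_of_polyInf (h11 ▸ hm.normal.neg_coeff.2.2.2)
  -- The condition B(0) = 0 is carried along the stages for this factorization.
  obtain ⟨Q, rfl⟩ := X_dvd_iff.2 hB0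
  have hQ : Q.Monic := (monic_X.of_mul_monic_left hB)
  have hd' : Q.natDegree = k := by
    rw [natDegree_X_mul hQ.ne_zero] at hd
    omega
  have key : ∀ n : ℕ, (m.neg 1 0).coeff (n - k) = meanValue M (X ^ n * (X * Q)) := by
    intro n
    rw [h10, HahnSeries.coeff_neg, coeff_zetaInf_zpow_mul,
      show ((n : ℤ) - k + (k + 1 : ℕ)) = n + 1 by push_cast; ring, hu.coeff_sub, neg_neg]
  have h0 : ∀ n < Q.natDegree, meanValue M (X ^ n * (X * Q)) = 0 := by
    intro n hn
    have h1 := key n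
    rw [hm.normal.neg_coeff.2.2.1 _ (by omega)] at h1
    exact_mod_cast h1.symm
  refine ⟨meanValue M (Q * (X * Q)), ?_, meanValue_X_mul_self_neg hQ.ne_zero (by omega)⟩
  have h1 := key k
  rw [sub_self] at h1
  rw [Triple.r, h1, ← apply_mul_of_orthogonal hQ h0, hd']

/-- The polynomial matrix N is multiplied on the left by G_0^L, whose entries are real polynomials
once q is real, and S_0 is absorbed into the monomial factor on the right. The new B is XA - qB,
which still vanishes at 0. -/
theorem EvenStage.next (hm : EvenStage u k m) {x : ℝ} (hq : m.q = x) (hx : x ≠ 0) :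
    OddStage u k (act (.sL 0) m) := by
  obtain ⟨A, B, C', D, hB, hN⟩ := hm.neg
  obtain ⟨e, he⟩ := hm.ephi
  have hq0 : m.q ≠ 0 := by rw [hq]; exact_mod_cast hx
  refine ⟨normal_act_sL_zero hm.normal hq0, ⟨-e / x, ?_⟩,
    C (-1 / x) * A, X * A - C x * B, C (-1 / x) * C', X * C' - C x * D, ?_, ?_⟩
  · rw [ephi_act_sL_zero hm.normal hq0, hq, he]
    push_cast
    rfl
  · simp [hB]
  · have hz := zetaInf_ne_zero
    have hz' : zetaZero = zetaInf⁻¹ := by rw [zetaInf_eq_inv, inv_inv]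
    have hxc : cst (x : ℂ) ≠ 0 := cst_ne_zero (by exact_mod_cast hx)
    rw [act_sL_zero hm.normal hq0, hN, hq, hz']
    simp only [map_mul, map_sub, polyInf_C, polyInf_X, Complex.ofReal_div, Complex.ofReal_neg,
      Complex.ofReal_one, cst_div, cst_neg, Nat.cast_add, Nat.cast_one, neg_add, zpow_add₀ hz,
      zpow_neg, zpow_one, zpow_natCast]
    refine mat_ext ?_ ?_ ?_ ?_ <;> simp <;> field_simp <;> ring

theorem OddStage.next (hm : OddStage u k m) {x : ℝ} (hr : m.r = x) (hx : x ≠ 0) :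
    EvenStage u (k + 1) (act (.sL 1) m) := by
  obtain ⟨A, B, C', D, hB, hN⟩ := hm.neg
  obtain ⟨e, he⟩ := hm.ephi
  have hr0 : m.r ≠ 0 := by rw [hr]; exact_mod_cast hx
  refine ⟨normal_act_sL_one hm.normal hr0, ⟨-x * e, ?_⟩,
    B - C x * A, C (-1 / x) * B, D - C x * C', C (-1 / x) * D, ?_, ?_⟩
  · rw [act_sL_one hm.normal hr0, Triple.ephi]
    simp [coeff_cst, hr, he]
  · simp [hB]
  · have hz := zetaInf_ne_zero
    have hxc : cst (x : ℂ) ≠ 0 := cst_ne_zero (by exact_mod_cast hx)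
    rw [act_sL_one hm.normal hr0, hN, hr]
    simp only [map_mul, map_sub, polyInf_C, Complex.ofReal_div, Complex.ofReal_neg,
      Complex.ofReal_one, cst_div, cst_neg]
    refine mat_ext ?_ ?_ ?_ ?_ <;> simp <;> field_simp <;> ring

theorem qb_act_sL_zero (h : m.Normal) (hq : m.q ≠ 0) : (act (.sL 0) m).qb = m.qb := by
  rw [act_sL_zero h hq]
  rfl

theorem rb_act_sL_zero (h : m.Normal) (hq : m.q ≠ 0) :
    (act (.sL 0) m).rb = m.rb - m.ephi ^ 2 / m.q := by
  rw [act_sL_zero h hq]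
  simp [Triple.rb, h.pos_coeff.1 0 le_rfl]

theorem rb_act_sL_one (h : m.Normal) (hr : m.r ≠ 0) : (act (.sL 1) m).rb = m.rb := by
  rw [act_sL_one h hr]
  rfl

theorem qb_act_sL_one (h : m.Normal) (hr : m.r ≠ 0) :
    (act (.sL 1) m).qb = m.qb - 1 / (m.r * m.ephi ^ 2) := by
  rw [act_sL_one h hr]
  simp [Triple.qb, h.pos_coeff.2.2.2 0 le_rfl]

end Stages

/-- The values coincide up to the sign of `e^φ`. -/
def SignEq (m m' : Triple) : Prop := m = m' ∨ m = m'.negZero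

namespace SignEq

variable {m m' m'' : Triple}

theorem refl (m : Triple) : SignEq m m := Or.inl rfl

theorem symm (h : SignEq m m') : SignEq m' m := by
  rcases h with rfl | rfl
  · exact Or.inl rfl
  · exact Or.inr (Triple.negZero_negZero _).symm

theorem trans (h : SignEq m m') (h' : SignEq m' m'') : SignEq m m'' := by
  rcases h with rfl | rfl
  · exact h'
  · rcases h' with rfl | rfl
    · exact Or.inr rfl
    · exact Or.inl (Triple.negZero_negZero _)

theorem regular_iff (h : SignEq m m') (g : Gen) : Regular g m ↔ Regular g m' := by
  rcases h with rfl | rfl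
  · rfl
  · exact regular_negZero g m'

theorem act (h : SignEq m m') (g : Gen) : SignEq (act g m) (MPLR.act g m') := by
  rcases h with rfl | rfl
  · exact refl _
  · exact Or.inr (act_negZero g m')

theorem sameVars (h : SignEq m m') : SameVars m m' := by
  rcases h with rfl | rfl <;> exact ⟨rfl, rfl, rfl, rfl⟩

end SignEq

theorem SameVars.trans {m m' m'' : Triple} (h : SameVars m m') (h' : SameVars m' m'') :
    SameVars m m'' :=
  ⟨h.1.trans h'.1, h.2.1.trans h'.2.1, h.2.2.1.trans h'.2.2.1, h.2.2.2.trans h'.2.2.2⟩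

theorem SameVars.of_act_sigma {m m' : Triple} (hm : m.Normal) (hm' : m'.Normal)
    (h : SameVars (act .sigma m) (act .sigma m')) : SameVars m m' := by
  simp only [SameVars, q_act_sigma, r_act_sigma, qb_act_sigma, rb_act_sigma, hm, hm'] at h
  exact ⟨h.2.2.1, h.2.2.2, h.1, h.2.1⟩

/-- The parity of an integer. -/
def parity (n : ℤ) : Fin 2 := if Even n then 0 else 1

theorem parity_add_one (n : ℤ) : parity (n + 1) = 1 - parity n := by
  by_cases h : Even n <;> simp [parity, h]

theorem parity_sub_one (n : ℤ) : parity (n - 1) = 1 - parity n := by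
  have h := parity_add_one (n - 1)
  rw [sub_add_cancel] at h
  rw [h, sub_sub_cancel]

theorem parity_even_add {j : ℤ} (hj : Even j) (n : ℤ) : parity (j + n) = parity n := by
  simp [parity, Int.even_add, hj]

/-- Values of solutions at the origin, obtained from each other by applying the two generators
`γ (s 0)` and `γ (s 1)` alternately, which are distinct from each other and from their images under
`π`. -/
structure IsChain (γ : ExtGen → Gen) (K : ℕ) (m : ℕ → Triple) : Prop where
  solution : ∀ i ≤ K, ∃ U x, SolutionOn Set.univ U x ∧ 0 ∈ U ∧ x 0 = m i
  regular : ∀ i < K, Regular (γ (.s (parity i))) (m i)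
  step : ∀ i < K, SignEq (act (γ (.s (parity i))) (m i)) (m (i + 1))
  injective : ∀ i ≤ K, ∀ j ≤ K, SameVars (m i) (m j) → i = j
  pi : ∀ i ≤ K, ∀ j ≤ K, 1 ≤ j → ¬SameVars (act .pi (m i)) (m j)

theorem IsChain.normal {γ : ExtGen → Gen} {K : ℕ} {m : ℕ → Triple} (h : IsChain γ K m) {i : ℕ}
    (hi : i ≤ K) : (m i).Normal := by
  obtain ⟨U, x, hx, h0, e⟩ := h.solution i hi
  exact e ▸ (hx.2 0 h0).1

/-- σ carries s_i^L to s_{1-i}^R up to sign. Dropping the first value shifts the parity by one and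
so restores the prescribed order of the generators. -/
theorem isChain_sigma {K : ℕ} {m : ℕ → Triple} (h : IsChain leftGen (K + 1) m) :
    IsChain rightGen K (fun i => act .sigma (m (i + 1))) where
  solution i hi := by
    obtain ⟨U, x, hx, h0, e⟩ := h.solution (i + 1) (by omega)
    exact ⟨_, _, hx.apply .sigma, ⟨h0, trivial⟩, congrArg _ e⟩
  regular i hi := by
    have h1 := h.regular (i + 1) (by omega)
    rw [Nat.cast_add_one, parity_add_one] at h1
    exact (regular_sR_act_sigma (h.normal (by omega)) _).2 h1
  step i hi := by
    have h1 := h.regular (i + 1) (by omega)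
    have h2 := h.step (i + 1) (by omega)
    have h3 := act_sigma_sL (h.normal (by omega)) h1
    rw [Nat.cast_add_one, parity_add_one, sub_sub_cancel] at h3
    rw [Nat.cast_add_one, parity_add_one] at h2
    exact (SignEq.symm (Or.inr h3)).trans (h2.act .sigma)
  injective i hi j hj hij := by
    have := h.injective _ (by omega) _ (by omega)
      (hij.of_act_sigma (h.normal (by omega)) (h.normal (by omega)))
    omega
  pi i hi j hj hj1 hij := by
    have hi' : (m (i + 1)).Normal := h.normal (by omega)
    rw [act_pi_sigma hi'] at hij
    exact h.pi _ (by omega) _ (by omega) (by omega)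
      (hij.of_act_sigma (normal_act_pi hi') (h.normal (by omega)))

/-! ### The chain of the uniform superposition of exponentials -/

/-- The sequence `F_k` given by exponentials with `a = -2, …, -(M+1)` of equal weight. -/
def uniformSequence (M : ℕ) : ℤ → Times → ℂ :=
  expSequence (fun j : Fin M => -((j : ℂ) + 2)) fun _ => (M : ℂ)⁻¹

theorem add_two_ne_zero (j : ℕ) : (j : ℂ) + 2 ≠ 0 := by
  exact_mod_cast Nat.succ_ne_zero (j + 1)

theorem linearSolution_uniformSequence (M : ℕ) : LinearSolution (uniformSequence M) :=
  linearSolution_expSequence (fun j : Fin M => neg_ne_zero.2 (add_two_ne_zero j)) _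

theorem phase_zero (a : ℂ) : phase a 0 = 0 := by simp [phase]

/-- At the origin all phases vanish and the exponent -k-1 at k = -n-1 is n, so that F_{-n-1} is the
mean of the n-th powers of the points. -/
theorem isMomentSeries_uniform (M : ℕ) :
    IsMomentSeries (meanValue M) (psSer (serNeg (uniformSequence M) 0 0)) := by
  intro n
  rw [coeff_psSer_serNeg, if_pos (by omega), meanValue_apply, uniformSequence, expSequence]
  simp only [phase_zero, mul_zero, Complex.exp_zero, mul_one, Polynomial.eval_pow,
    Polynomial.eval_X]
  push_cast
  rw [Finset.mul_sum]
  refine Finset.sum_congr rfl fun j _ => ?_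
  rw [show (-(0 - ((n : ℤ) + 1)) - 1) = n by ring, zpow_natCast]

theorem evenStage_uniform (M : ℕ) : EvenStage (psSer (serNeg (uniformSequence M) 0 0)) 0
    (triangular (uniformSequence M) 0) := by
  refine ⟨triangular_normal _ _, ⟨1, by simp [Triple.ephi, triangular]⟩, 1, 0, 0, 1, by simp, ?_⟩
  simp [triangular, expSum_zero]

theorem rb_triangular (F : ℤ → Times → ℂ) (p : Times) : (triangular F p).rb = 0 := rfl

/-- Here q̄ is minus the mean of 1/(j+2), at least -1/2. Starting the points at -2 instead of -1
makes the bound strict, as needed for the separation from the π-images. -/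
theorem re_qb_uniform (M : ℕ) : -1 < (triangular (uniformSequence M) 0).qb.re := by
  have h1 : (triangular (uniformSequence M) 0).qb =
      ((-((M : ℝ)⁻¹ * ∑ j : Fin M, ((j : ℝ) + 2)⁻¹) : ℝ) : ℂ) := by
    have h2 : (triangular (uniformSequence M) 0).qb =
        (psSer (serNonneg (uniformSequence M) 0 0)).coeff 0 := by
      simp [Triple.qb, triangular, expSum_zero]
    rw [h2, coeff_psSer_serNonneg, if_pos le_rfl, uniformSequence, expSequence]
    simp only [phase_zero, mul_zero, Complex.exp_zero, mul_one]
    push_cast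
    rw [Finset.mul_sum, ← Finset.sum_neg_distrib]
    refine Finset.sum_congr rfl fun j _ => ?_
    rw [zpow_neg_one, inv_neg, mul_neg]
  rw [h1, Complex.ofReal_re, neg_lt_neg_iff]
  rcases Nat.eq_zero_or_pos M with rfl | hM
  · simp
  have hM' : (0 : ℝ) < M := by exact_mod_cast hM
  calc (M : ℝ)⁻¹ * ∑ j : Fin M, ((j : ℝ) + 2)⁻¹ ≤ (M : ℝ)⁻¹ * ∑ j : Fin M, (2 : ℝ)⁻¹ := by
        gcongr with j
        linarith [show (0 : ℝ) ≤ (j : ℕ) by positivity]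
    _ < 1 := by
        simp
        field_simp
        norm_num

/-- The solutions generated from the triangular one by applying `s_0^L` and `s_1^L` alternately. -/
def chain (M : ℕ) : ℕ → Times → Triple
  | 0 => triangular (uniformSequence M)
  | i + 1 => apply (.sL (parity i)) (chain M i)

/-- The domains of definition of `chain`. -/
def chainDomain (M : ℕ) : ℕ → Set Times
  | 0 => Set.univ
  | i + 1 => domain (.sL (parity i)) (chainDomain M i) (chain M i)

theorem solutionOn_chain (M i : ℕ) : SolutionOn Set.univ (chainDomain M i) (chain M i) := by
  induction i with
  | zero => exact (linearSolution_uniformSequence M).solutionOn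
  | succ i ih => exact ih.apply _

/-- The origin is fixed by every change of times, so the values at the origin alone can be followed
through any word. -/
theorem timeMap_zero (g : Gen) : timeMap g 0 = 0 := by
  cases g <;> simp [timeMap]

theorem chain_succ_zero (M i : ℕ) : chain M (i + 1) 0 = act (.sL (parity i)) (chain M i 0) := by
  rw [chain, apply, timeMap_zero]

theorem parity_two_mul (k : ℕ) : parity ((2 * k : ℕ) : ℤ) = 0 := by
  simp [parity]

theorem parity_two_mul_add_one (k : ℕ) : parity ((2 * k + 1 : ℕ) : ℤ) = 1 := by
  rw [Nat.cast_add_one, parity_add_one, parity_two_mul]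
  rfl

/-- The step from a value to the next one in a chain increases `q̄ + r̄`. -/
structure IsIncreasingStep (m m' : Triple) : Prop where
  qb_le : m.qb.re ≤ m'.qb.re
  rb_le : m.rb.re ≤ m'.rb.re
  add_lt : m.qb.re + m.rb.re < m'.qb.re + m'.rb.re

/-- s_0^L leaves q̄ fixed and subtracts e^{2φ}/q from r̄, a negative number because e^φ is real and
q < 0. The odd step exchanges the roles of q̄ and r̄. -/
theorem EvenStage.isIncreasingStep {u : Ser} {k : ℕ} {m : Triple} (hm : EvenStage u k m) {x : ℝ}
    (hq : m.q = x) (hx : x < 0) : IsIncreasingStep m (act (.sL 0) m) := by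
  obtain ⟨e, he⟩ := hm.ephi
  have he0 : e ≠ 0 := by
    have := hm.normal.exists_zero.1
    rw [he] at this
    exact_mod_cast this
  have hq0 : m.q ≠ 0 := by rw [hq]; exact_mod_cast hx.ne
  have h1 := qb_act_sL_zero hm.normal hq0
  have h2 : (act (.sL 0) m).rb.re = m.rb.re - e ^ 2 / x := by
    rw [rb_act_sL_zero hm.normal hq0, hq, he, Complex.sub_re]
    norm_cast
  have h3 : e ^ 2 / x < 0 := div_neg_of_pos_of_neg (by positivity) hx
  refine ⟨?_, ?_, ?_⟩ <;> rw [h1] at * <;> linarith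

theorem OddStage.isIncreasingStep {u : Ser} {k : ℕ} {m : Triple} (hm : OddStage u k m) {x : ℝ}
    (hr : m.r = x) (hx : x < 0) : IsIncreasingStep m (act (.sL 1) m) := by
  obtain ⟨e, he⟩ := hm.ephi
  have he0 : e ≠ 0 := by
    have := hm.normal.exists_zero.1
    rw [he] at this
    exact_mod_cast this
  have hr0 : m.r ≠ 0 := by rw [hr]; exact_mod_cast hx.ne
  have h1 := rb_act_sL_one hm.normal hr0
  have h2 : (act (.sL 1) m).qb.re = m.qb.re - 1 / (x * e ^ 2) := by
    rw [qb_act_sL_one hm.normal hr0, hr, he, Complex.sub_re]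
    norm_cast
  have h3 : 1 / (x * e ^ 2) < 0 := one_div_neg.2 (mul_neg_of_neg_of_pos hx (by positivity))
  refine ⟨?_, ?_, ?_⟩ <;> rw [h1] at * <;> linarith

theorem evenStage_chain {M k : ℕ} (hk : k ≤ M) :
    EvenStage (psSer (serNeg (uniformSequence M) 0 0)) k (chain M (2 * k) 0) := by
  have hu := isMomentSeries_uniform M
  induction k with
  | zero => exact evenStage_uniform M
  | succ k ih =>
    have h1 := ih (by omega)
    obtain ⟨x, hq, hx⟩ := h1.exists_q_neg hu (by omega)
    have h2 := h1.next hq hx.ne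
    obtain ⟨y, hr, hy⟩ := h2.exists_r_neg hu (by omega)
    have h3 := h2.next hr hy.ne
    rwa [Nat.mul_succ, chain_succ_zero, parity_two_mul_add_one, chain_succ_zero, parity_two_mul]

theorem chain_step {M i : ℕ} (hi : i < 2 * M) :
    Regular (.sL (parity i)) (chain M i 0) ∧
      IsIncreasingStep (chain M i 0) (chain M (i + 1) 0) := by
  have hu := isMomentSeries_uniform M
  rcases Nat.even_or_odd' i with ⟨k, rfl | rfl⟩
  · have h1 := evenStage_chain (M := M) (k := k) (by omega)
    obtain ⟨x, hq, hx⟩ := h1.exists_q_neg hu (by omega)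
    rw [chain_succ_zero, parity_two_mul]
    refine ⟨?_, h1.isIncreasingStep hq hx⟩
    change (chain M (2 * k) 0).q ≠ 0
    rw [hq]
    exact_mod_cast hx.ne
  · have h1 := evenStage_chain (M := M) (k := k) (by omega)
    obtain ⟨x, hq, hx⟩ := h1.exists_q_neg hu (by omega)
    have h2 := h1.next hq hx.ne
    obtain ⟨y, hr, hy⟩ := h2.exists_r_neg hu (by omega)
    have e := chain_succ_zero M (2 * k)
    rw [parity_two_mul] at e
    rw [chain_succ_zero M (2 * k + 1), parity_two_mul_add_one, e]
    refine ⟨?_, h2.isIncreasingStep hr hy⟩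
    change (act (.sL 0) (chain M (2 * k) 0)).r ≠ 0
    rw [hr]
    exact_mod_cast hy.ne

theorem zero_mem_chainDomain {M i : ℕ} (hi : i ≤ 2 * M) : 0 ∈ chainDomain M i := by
  induction i with
  | zero => trivial
  | succ i ih =>
    simp only [chainDomain, domain, Set.mem_ofPred_eq, timeMap_zero]
    exact ⟨ih (by omega), (chain_step (by omega)).1⟩

/-- The measure has total mass 1, so q = -1 at the start, where also r̄ = 0 and e^φ = 1; the first
step raises r̄ to 1. -/
theorem rb_chain_one (M : ℕ) (hM : 0 < M) : 1 ≤ (chain M 1 0).rb.re := by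
  have hu := isMomentSeries_uniform M
  have h1 := evenStage_uniform M
  have hM' : (M : ℝ) ≠ 0 := by exact_mod_cast hM.ne'
  have hq : (triangular (uniformSequence M) 0).q = -1 := by
    have h2 := hu 0
    rw [Nat.cast_zero, zero_add] at h2
    simp [Triple.q, triangular, expSum_zero, h2, meanValue_apply, hM']
  have he : (triangular (uniformSequence M) 0).ephi = 1 := by simp [Triple.ephi, triangular]
  rw [chain_succ_zero, Nat.cast_zero, show parity 0 = 0 by simp [parity]]
  change 1 ≤ (act (.sL 0) (triangular (uniformSequence M) 0)).rb.re
  rw [rb_act_sL_zero h1.normal (by simp [hq]), rb_triangular, hq, he]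
  norm_num

theorem isChain_chain (M : ℕ) : IsChain leftGen (2 * M) (fun i => chain M i 0) := by
  have hqb : MonotoneOn (fun i => (chain M i 0).qb.re) (Set.Iic (2 * M)) :=
    monotoneOn_of_le_add_one Set.ordConnected_Iic fun i _ _ hi => (chain_step hi).2.qb_le
  have hrb : MonotoneOn (fun i => (chain M i 0).rb.re) (Set.Iic (2 * M)) :=
    monotoneOn_of_le_add_one Set.ordConnected_Iic fun i _ _ hi => (chain_step hi).2.rb_le
  have hadd : StrictMonoOn (fun i => (chain M i 0).qb.re + (chain M i 0).rb.re)
      (Set.Iic (2 * M)) :=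
    strictMonoOn_of_lt_add_one Set.ordConnected_Iic fun i _ _ hi => (chain_step hi).2.add_lt
  have hn : ∀ i ≤ 2 * M, (chain M i 0).Normal := fun i hi =>
    ((solutionOn_chain M i).2 0 (zero_mem_chainDomain hi)).1
  refine ⟨fun i hi => ⟨_, _, solutionOn_chain M i, zero_mem_chainDomain hi, rfl⟩,
    fun i hi => (chain_step hi).1, fun i hi => Or.inl (chain_succ_zero M i).symm,
    fun i hi j hj h => hadd.injOn hi hj ?_, fun i hi j hj hj1 h => ?_⟩
  · simp only [h.2.2.1, h.2.2.2]
  -- π would give r̄_j = -q̄_i. But -q̄_i ≤ -q̄_0 < 1 ≤ r̄_1 ≤ r̄_j by monotonicity; the value at j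
  -- = 0 has r̄ = 0 and is excluded.
  · have h1 := h.2.2.2
    rw [rb_act_pi (hn i hi)] at h1
    have h2 := congrArg Complex.re h1
    rw [Complex.neg_re] at h2
    have h3 := hqb (Set.mem_Iic.2 (Nat.zero_le _)) hi (Nat.zero_le i)
    have h4 := hrb (Set.mem_Iic.2 (hj1.trans hj)) hj hj1
    have h5 := re_qb_uniform M
    have h6 := rb_chain_one M (by omega)
    simp only [chain] at h3
    linarith

theorem exists_isChain {γ : ExtGen → Gen} (hγ : γ = leftGen ∨ γ = rightGen) (K : ℕ) :
    ∃ m, IsChain γ (2 * K + 1) m := by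
  rcases hγ with rfl | rfl
  · have h := isChain_chain (K + 1)
    exact ⟨_, ⟨fun i hi => h.solution i (by omega), fun i hi => h.regular i (by omega),
      fun i hi => h.step i (by omega), fun i hi j hj => h.injective i (by omega) j (by omega),
      fun i hi j hj => h.pi i (by omega) j (by omega)⟩⟩
  · exact ⟨_, isChain_sigma (isChain_chain (K + 1))⟩

/-! ### The regular representation of the extended affine Weyl group -/

theorem fin_two_sub_eq {i j : Fin 2} (h : i ≠ j) : 1 - i = j := by
  revert i j
  decide

theorem fin_two_sub_ne (i : Fin 2) : 1 - i ≠ i := by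
  revert i
  decide

theorem perm_fin_two (e : Equiv.Perm (Fin 2)) : e = 1 ∨ e = Equiv.swap 0 1 := by
  revert e
  decide

theorem swap_fin_two (i : Fin 2) : (Equiv.swap 0 1 : Equiv.Perm (Fin 2))⁻¹ i = 1 - i := by
  revert i
  decide

/-- The elements of the extended affine Weyl group are `e w_n`, where `e` is a diagram automorphism,
`w_0 = 1` and `w_{n+1} = s_i w_n` with `i` the parity of `n`.  This is the left multiplication by a
generator in terms of `(n, e)`. -/
def walk : ExtGen → ℤ × Equiv.Perm (Fin 2) → ℤ × Equiv.Perm (Fin 2)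
  | .s i, (n, e) => (if parity n = e⁻¹ i then n + 1 else n - 1, e)
  | .pi, (n, e) => (n, Equiv.swap 0 1 * e)

theorem involutive_walk_s (i : Fin 2) : Function.Involutive (walk (.s i)) := by
  rintro ⟨n, e⟩
  by_cases h : parity n = e⁻¹ i
  · simp [walk, h, parity_add_one, fin_two_sub_ne]
  · simp only [walk, if_neg h, parity_sub_one, if_pos (fin_two_sub_eq h), sub_add_cancel]

/-- Left multiplication by a simple reflection. -/
def reflectionPerm (i : Fin 2) : Equiv.Perm (ℤ × Equiv.Perm (Fin 2)) :=
  (involutive_walk_s i).toPerm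

theorem reflectionPerm_mul_self (i : Fin 2) : reflectionPerm i * reflectionPerm i = 1 :=
  Equiv.ext fun st => involutive_walk_s i st

theorem isLiftable_reflectionPerm : affineA1.IsLiftable reflectionPerm := by
  intro i j
  by_cases h : i = j
  · subst h
    rw [reflectionPerm_mul_self, one_pow]
  · have h0 : affineA1 i j = 0 := by
      change (if i = j then 1 else 0) = 0
      simp [h]
    rw [h0, pow_zero]

/-- The representation of the affine Weyl group by left multiplication. -/
def affineRep : AffineWeyl →* Equiv.Perm (ℤ × Equiv.Perm (Fin 2)) :=
  affineA1.toCoxeterSystem.lift ⟨reflectionPerm, isLiftable_reflectionPerm⟩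

theorem affineRep_simple (i : Fin 2) : affineRep (affineA1.simple i) = reflectionPerm i := by
  have h := affineA1.toCoxeterSystem.lift_apply_simple isLiftable_reflectionPerm i
  rwa [CoxeterMatrix.toCoxeterSystem_simple] at h

/-- Left multiplication by diagram automorphisms. -/
def diagramRep : Equiv.Perm (Fin 2) →* Equiv.Perm (ℤ × Equiv.Perm (Fin 2)) where
  toFun g := Equiv.prodCongr (Equiv.refl ℤ) (Equiv.mulLeft g)
  map_one' := by
    ext <;> simp
  map_mul' g h := by
    ext <;> simp

theorem diagramRep_apply (g : Equiv.Perm (Fin 2)) (n : ℤ) (e : Equiv.Perm (Fin 2)) :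
    diagramRep g (n, e) = (n, g * e) := rfl

theorem reflectionPerm_apply (i : Fin 2) (st : ℤ × Equiv.Perm (Fin 2)) :
    reflectionPerm i st = walk (.s i) st := rfl

/-- The regular representation of the extended affine Weyl group. -/
def extRep : ExtAffineWeyl →* Equiv.Perm (ℤ × Equiv.Perm (Fin 2)) :=
  SemidirectProduct.lift affineRep diagramRep (by
    intro g
    apply affineA1.toCoxeterSystem.ext_simple
    intro i
    rw [CoxeterMatrix.toCoxeterSystem_simple]
    change affineRep (diagramHom g (affineA1.simple i)) =
      diagramRep g * affineRep (affineA1.simple i) * (diagramRep g)⁻¹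
    rw [diagramHom_simple, affineRep_simple, affineRep_simple, eq_mul_inv_iff_mul_eq]
    ext1 ⟨n, e⟩
    simp [reflectionPerm_apply, diagramRep_apply, walk])

theorem extRep_weylGen (a : ExtGen) (st : ℤ × Equiv.Perm (Fin 2)) :
    extRep (weylGen a) st = walk a st := by
  cases a with
  | s i =>
    rw [extRep, weylGen, SemidirectProduct.lift_inl, affineRep_simple]
    rfl
  | pi =>
    rw [extRep, weylGen, SemidirectProduct.lift_inr]
    rfl

/-- The pair `(n, e)` of the element represented by a word. -/
def wordState (l : List ExtGen) : ℤ × Equiv.Perm (Fin 2) := l.foldr walk (0, 1)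

theorem wordState_cons (a : ExtGen) (l : List ExtGen) :
    wordState (a :: l) = walk a (wordState l) := rfl

theorem extRep_prod (l : List ExtGen) : extRep (l.map weylGen).prod (0, 1) = wordState l := by
  induction l with
  | nil => simp [wordState]
  | cons a l ih =>
    rw [List.map_cons, List.prod_cons, map_mul, Equiv.Perm.mul_apply, ih, extRep_weylGen,
      wordState_cons]

/-- The elements `w_n`. -/
def affineElement (n : ℤ) : AffineWeyl :=
  (if Even n then 1 else affineA1.simple 0) * (affineA1.simple 1 * affineA1.simple 0) ^ (n / 2)

theorem simple_mul_simple (i : Fin 2) : affineA1.simple i * affineA1.simple i = 1 := by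
  have h := affineA1.toCoxeterSystem.simple_mul_simple_self i
  rwa [CoxeterMatrix.toCoxeterSystem_simple] at h

theorem affineElement_add_one (n : ℤ) :
    affineElement (n + 1) = affineA1.simple (parity n) * affineElement n := by
  rcases Int.even_or_odd' n with ⟨k, rfl | rfl⟩
  · have h1 : (2 * k + 1) / 2 = k := by omega
    have h2 : 2 * k / 2 = k := by omega
    simp [affineElement, parity, h1, h2]
  · have h1 : (2 * k + 1) / 2 = k := by omega
    have h2 : (2 * k + 1 + 1) / 2 = 1 + k := by omega
    have h3 : ¬Even (2 * k + 1) := by simp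
    have h4 : Even (2 * k + 1 + 1) := by rw [Int.even_add_one]; exact h3
    rw [affineElement, affineElement, parity, if_neg h3, if_neg h3, if_pos h4, h1, h2,
      zpow_one_add, one_mul, mul_assoc]

theorem affineElement_sub_one (n : ℤ) :
    affineElement (n - 1) = affineA1.simple (parity (n - 1)) * affineElement n := by
  have h := affineElement_add_one (n - 1)
  rw [sub_add_cancel] at h
  rw [h, ← mul_assoc, simple_mul_simple, one_mul]

/-- The element `e w_n` of the extended affine Weyl group. -/
def stateElement (st : ℤ × Equiv.Perm (Fin 2)) : ExtAffineWeyl :=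
  SemidirectProduct.inr st.2 * SemidirectProduct.inl (affineElement st.1)

/-- Moving s_i past e turns it into the simple reflection with index e⁻¹(i), and multiplying w_n by
a simple reflection gives w_{n+1} or w_{n-1} according to the parity of n. -/
theorem stateElement_walk (a : ExtGen) (st : ℤ × Equiv.Perm (Fin 2)) :
    stateElement (walk a st) = weylGen a * stateElement st := by
  obtain ⟨n, e⟩ := st
  cases a with
  | s i =>
    have h1 : weylGen (.s i) = SemidirectProduct.inr e *
        SemidirectProduct.inl (affineA1.simple (e⁻¹ i)) * SemidirectProduct.inr e⁻¹ := by
      rw [← SemidirectProduct.inl_aut]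
      change _ = SemidirectProduct.inl (diagramHom e (affineA1.simple (e⁻¹ i)))
      rw [diagramHom_simple, show e (e⁻¹ i) = i from e.apply_symm_apply i]
      rfl
    have h2 : affineElement (walk (.s i) (n, e)).1 =
        affineA1.simple (e⁻¹ i) * affineElement n := by
      by_cases h : parity n = e⁻¹ i
      · rw [walk, if_pos h, affineElement_add_one, h]
      · rw [walk, if_neg h, affineElement_sub_one, parity_sub_one, fin_two_sub_eq h]
    rw [stateElement, h2, stateElement, h1, map_mul, map_inv]
    change SemidirectProduct.inr e * _ = _
    group
  | pi =>
    rw [stateElement, stateElement, walk, weylGen, map_mul, mul_assoc]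

theorem stateElement_wordState (l : List ExtGen) :
    stateElement (wordState l) = (l.map weylGen).prod := by
  induction l with
  | nil => simp [wordState, stateElement, affineElement]
  | cons a l ih => rw [wordState_cons, stateElement_walk, ih, List.map_cons, List.prod_cons]

/-- The regular representation shows that the pair depends only on the group element, and
`stateElement` recovers the element from the pair. -/
theorem prod_weylGen_eq_one_iff (l : List ExtGen) :
    (l.map weylGen).prod = 1 ↔ wordState l = (0, 1) := by
  refine ⟨fun h => ?_, fun h => ?_⟩
  · rw [← extRep_prod, h, map_one, Equiv.Perm.one_apply]
  · rw [← stateElement_wordState, h]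
    simp [stateElement, affineElement]

/-! ### Reduction of words -/

/-- The relations between the transformations `γ (s 0)`, `γ (s 1)` and `π`. -/
structure IsExtTriple (γ : ExtGen → Gen) : Prop where
  pi : γ .pi = .pi
  sq : ∀ (i : Fin 2) (m : Triple), m.Normal → Regular (γ (.s i)) m →
    act (γ (.s i)) (act (γ (.s i)) m) = m.negZero
  regular_pi : ∀ (i : Fin 2) (m : Triple), m.Normal →
    (Regular (γ (.s i)) (act .pi m) ↔ Regular (γ (.s (1 - i))) m)
  act_pi : ∀ (i : Fin 2) (m : Triple), m.Normal → Regular (γ (.s i)) m →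
    act .pi (act (γ (.s i)) m) = (act (γ (.s (1 - i))) (act .pi m)).negZero
  time : ∀ (i j : Fin 2) (p : Times),
    timeMap .pi (timeMap (γ (.s i)) p) = timeMap (γ (.s j)) (timeMap .pi p)

theorem isExtTriple_leftGen : IsExtTriple leftGen where
  pi := rfl
  sq _ _ h hi := act_sL_sq h hi
  regular_pi i _ h := regular_sL_act_pi h i
  act_pi _ _ h hi := act_pi_sL h hi
  time _ _ _ := rfl

theorem isExtTriple_rightGen : IsExtTriple rightGen where
  pi := rfl
  sq _ _ h hi := act_sR_sq h hi
  regular_pi i _ h := regular_sR_act_pi h i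
  act_pi _ _ h hi := act_pi_sR h hi
  time _ _ _ := rfl

/-- Wherever `w` is defined, so is `w'`, and the values agree up to the sign of `e^φ`. -/
def Reduces (w w' : List Gen) : Prop := ∀ (x : Times → Triple) (p : Times), DefinedAt w x p →
  DefinedAt w' x p ∧ SignEq (applyWord w x p) (applyWord w' x p)

namespace Reduces

variable {w w' w'' : List Gen}

theorem refl (w : List Gen) : Reduces w w := fun _ _ h => ⟨h, SignEq.refl _⟩

theorem trans (h : Reduces w w') (h' : Reduces w' w'') : Reduces w w'' := fun x p hw =>
  have h1 := h x p hw
  have h2 := h' x p h1.1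
  ⟨h2.1, h1.2.trans h2.2⟩

theorem cons (g : Gen) (h : Reduces w w') : Reduces (g :: w) (g :: w') := fun x _ hw =>
  have h1 := h x _ hw.1
  ⟨⟨h1.1, (h1.2.regular_iff g).1 hw.2⟩, h1.2.act g⟩

end Reduces

variable {γ : ExtGen → Gen}

theorem reduces_pi_pi (w : List Gen) : Reduces (.pi :: .pi :: w) w := by
  rintro x p ⟨⟨h, -⟩, -⟩
  simp only [applyWord, apply, timeMap_timeMap] at *
  refine ⟨h, Or.inl ?_⟩
  rw [act_pi_pi (normal_applyWord h)]

theorem IsExtTriple.reduces_sq (hγ : IsExtTriple γ) (i : Fin 2) (w : List Gen) :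
    Reduces (γ (.s i) :: γ (.s i) :: w) w := by
  rintro x p ⟨⟨h, h1⟩, -⟩
  simp only [applyWord, apply, timeMap_timeMap] at *
  exact ⟨h, Or.inr (hγ.sq _ _ (normal_applyWord h) h1)⟩

/-- Moves π to the left of a reflection, so that words can be brought to the form e w_n. -/
theorem IsExtTriple.reduces_comm (hγ : IsExtTriple γ) (i : Fin 2) (w : List Gen) :
    Reduces (γ (.s i) :: .pi :: w) (.pi :: γ (.s (1 - i)) :: w) := by
  rintro x p ⟨⟨h, -⟩, h2⟩
  simp only [applyWord, apply, DefinedAt, hγ.time i (1 - i),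
    ← hγ.time (1 - i) (1 - i)] at *
  have hn := normal_applyWord h
  have h3 := (hγ.regular_pi _ _ hn).1 h2
  refine ⟨⟨⟨h, h3⟩, trivial⟩, Or.inr ?_⟩
  rw [hγ.act_pi _ _ hn h3, sub_sub_cancel, Triple.negZero_negZero]

/-- The alternating words `… s_1 s_0`. -/
def upWord : ℕ → List ExtGen
  | 0 => []
  | n + 1 => .s (parity n) :: upWord n

/-- The alternating words `… s_0 s_1`. -/
def downWord : ℕ → List ExtGen
  | 0 => []
  | n + 1 => .s (parity (-(n + 1))) :: downWord n

/-- The reduced word of `w_n`. -/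
def altWord (n : ℤ) : List ExtGen := if 0 ≤ n then upWord n.toNat else downWord (-n).toNat

theorem altWord_of_nonneg {n : ℤ} (hn : 0 ≤ n) :
    altWord (n + 1) = .s (parity n) :: altWord n := by
  lift n to ℕ using hn
  rw [altWord, if_pos (by omega), altWord, if_pos (by omega)]
  rfl

theorem altWord_of_neg {n : ℤ} (hn : n < 0) :
    altWord n = .s (parity n) :: altWord (n + 1) := by
  obtain ⟨k, rfl⟩ : ∃ k : ℕ, n = -(k + 1) := ⟨(-n - 1).toNat, by omega⟩
  have h1 : (-(-((k : ℤ) + 1))).toNat = k + 1 := by omega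
  rw [altWord, if_neg (by omega), h1, downWord, altWord]
  rcases Nat.eq_zero_or_pos k with rfl | hk
  · rfl
  · rw [if_neg (by omega)]
    congr 2
    omega

/-- A reflection put in front of an alternating word either prolongs it or cancels its first letter,
depending on the sign of n and the parity. -/
theorem IsExtTriple.reduces_altWord (hγ : IsExtTriple γ) (n : ℤ) (i : Fin 2) :
    Reduces (γ (.s i) :: (altWord n).map γ)
      ((altWord (if parity n = i then n + 1 else n - 1)).map γ) := by
  by_cases h : parity n = i
  · rw [if_pos h]
    subst h
    rcases lt_or_ge n 0 with hn | hn
    · rw [altWord_of_neg hn]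
      exact hγ.reduces_sq _ _
    · rw [altWord_of_nonneg hn]
      exact Reduces.refl _
  · rw [if_neg h]
    obtain rfl := fin_two_sub_eq h
    rw [← parity_sub_one]
    rcases le_or_gt n 0 with hn | hn
    · rw [altWord_of_neg (n := n - 1) (by omega), sub_add_cancel]
      exact Reduces.refl _
    · have h1 := altWord_of_nonneg (n := n - 1) (by omega)
      rw [sub_add_cancel] at h1
      rw [h1]
      exact hγ.reduces_sq _ _

/-- The reduced word of `e w_n`. -/
def stateWord (st : ℤ × Equiv.Perm (Fin 2)) : List ExtGen :=
  if st.2 = 1 then altWord st.1 else .pi :: altWord st.1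

theorem IsExtTriple.reduces_stateWord (hγ : IsExtTriple γ) (a : ExtGen)
    (st : ℤ × Equiv.Perm (Fin 2)) :
    Reduces (γ a :: (stateWord st).map γ) ((stateWord (walk a st)).map γ) := by
  obtain ⟨n, e⟩ := st
  have hs : (Equiv.swap 0 1 : Equiv.Perm (Fin 2)) ≠ 1 := by decide
  rcases perm_fin_two e with rfl | rfl <;> cases a with
  | s i =>
    simp only [stateWord, walk, if_true, inv_one, Equiv.Perm.one_apply, hs, if_false,
      swap_fin_two, List.map_cons, hγ.pi]
    first
    | exact hγ.reduces_altWord n i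
    | exact (hγ.reduces_comm i _).trans ((hγ.reduces_altWord n (1 - i)).cons _)
  | pi =>
    simp only [stateWord, walk, if_true, mul_one, hs, if_false, Equiv.swap_mul_self,
      List.map_cons, hγ.pi]
    first
    | exact Reduces.refl _
    | exact reduces_pi_pi _

/-- Each rewriting keeps the composition defined. This gives the easy direction: a word that is
trivial in the group reduces to the empty word, up to the sign of e^φ. -/
theorem IsExtTriple.reduces_wordState (hγ : IsExtTriple γ) (l : List ExtGen) :
    Reduces (l.map γ) ((stateWord (wordState l)).map γ) := by
  induction l with
  | nil => exact Reduces.refl _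
  | cons a l ih => exact (ih.cons _).trans (hγ.reduces_stateWord a _)

theorem IsExtTriple.actsTrivially (hγ : IsExtTriple γ) {l : List ExtGen}
    (hl : wordState l = (0, 1)) : ActsTrivially γ l := by
  intro U x _ p _ hp
  have h := (hγ.reduces_wordState l x p hp).2
  rw [hl] at h
  exact h.sameVars

/-! ### Words acting on a chain -/

/-- The value `m`, or its image under `π`. -/
def twist (e : Equiv.Perm (Fin 2)) (m : Triple) : Triple := if e = 1 then m else act .pi m

/-- One of the two reflections moves forward by construction; the other moves backward, since it is
the one that produced the present value and its square is the identity up to sign. -/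
theorem IsChain.act_s {K : ℕ} {m : ℕ → Triple} (hγ : IsExtTriple γ) (h : IsChain γ K m) {k : ℕ}
    (h0 : 0 < k) (hk : k < K) (i : Fin 2) : Regular (γ (.s i)) (m k) ∧
      SignEq (act (γ (.s i)) (m k)) (m (if parity k = i then k + 1 else k - 1)) := by
  by_cases hi : parity k = i
  · rw [if_pos hi]
    subst hi
    exact ⟨h.regular k hk, h.step k hk⟩
  · rw [if_neg hi]
    obtain ⟨j, rfl⟩ := Nat.exists_eq_add_one.2 h0
    have h1 := h.regular j (by omega)
    have h2 := h.step j (by omega)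
    have hn := h.normal (i := j) (by omega)
    have e : parity j = i := by
      rw [← fin_two_sub_eq hi, Nat.cast_add_one, parity_add_one, sub_sub_cancel]
    rw [e] at h1 h2
    rw [Nat.add_sub_cancel]
    exact ⟨(h2.regular_iff _).1 (regular_act hn h1),
      (h2.symm.act _).trans (Or.inr (hγ.sq _ _ hn h1))⟩

/-- With an even base point j the parity of the position j + n is that of n, so moving along the
chain is literally `walk`. -/
theorem IsChain.act_twist {K : ℕ} {m : ℕ → Triple} (hγ : IsExtTriple γ) (h : IsChain γ K m)
    {j : ℕ} (hj : Even (j : ℤ)) (a : ExtGen) {n : ℤ} (e : Equiv.Perm (Fin 2)) (h0 : 0 < j + n)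
    (hK : j + n < K) : Regular (γ a) (twist e (m (j + n).toNat)) ∧
      SignEq (act (γ a) (twist e (m (j + n).toNat)))
        (twist (walk a (n, e)).2 (m (j + (walk a (n, e)).1).toNat)) := by
  have hs : (Equiv.swap 0 1 : Equiv.Perm (Fin 2)) ≠ 1 := by decide
  obtain ⟨k, hk⟩ : ∃ k : ℕ, j + n = k := ⟨(j + n).toNat, by omega⟩
  have hp : parity k = parity n := by rw [← hk, parity_even_add hj]
  have hn := h.normal (i := k) (by omega)
  have key : ∀ i, Regular (γ (.s i)) (m k) ∧ SignEq (act (γ (.s i)) (m k))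
      (m (j + if parity n = i then n + 1 else n - 1).toNat) := by
    intro i
    have := h.act_s hγ (k := k) (by omega) (by omega) i
    rw [hp] at this
    convert this using 3
    split_ifs <;> omega
  rw [hk, Int.toNat_natCast]
  rcases perm_fin_two e with rfl | rfl <;> cases a with
  | s i =>
    simp only [twist, walk, if_true, inv_one, Equiv.Perm.one_apply, hs, if_false, swap_fin_two]
    first
    | exact key i
    | exact ⟨(hγ.regular_pi _ _ hn).2 (key (1 - i)).1, by
        have h1 := hγ.act_pi _ _ hn (key (1 - i)).1
        rw [sub_sub_cancel] at h1
        exact (SignEq.symm (Or.inr h1)).trans ((key (1 - i)).2.act _)⟩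
  | pi =>
    simp only [twist, walk, if_true, mul_one, hs, if_false, Equiv.swap_mul_self, hγ.pi, hk,
      Int.toNat_natCast]
    first
    | exact ⟨trivial, SignEq.refl _⟩
    | exact ⟨trivial, Or.inl (act_pi_pi hn)⟩

theorem abs_walk_le (a : ExtGen) (st : ℤ × Equiv.Perm (Fin 2)) :
    |(walk a st).1| ≤ |st.1| + 1 := by
  obtain ⟨n, e⟩ := st
  cases a with
  | s i =>
    simp only [walk]
    split_ifs
    · exact (abs_add_le _ _).trans (by simp)
    · exact (abs_sub _ _).trans (by simp)
  | pi =>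
    simp only [walk]
    omega

theorem abs_wordState_le (l : List ExtGen) : |(wordState l).1| ≤ l.length := by
  induction l with
  | nil => simp [wordState]
  | cons a l ih =>
    rw [wordState_cons, List.length_cons, Nat.cast_add_one]
    exact (abs_walk_le _ _).trans (by omega)

/-- A word changes n by at most its length, so a start farther than that from both ends keeps every
intermediate value inside the chain and every denominator nonzero. -/
theorem IsChain.applyWord {K : ℕ} {m : ℕ → Triple} (hγ : IsExtTriple γ) (h : IsChain γ K m)
    {j : ℕ} (hj : Even (j : ℤ)) {x : Times → Triple} (hx : x 0 = m j) (l : List ExtGen)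
    (h0 : l.length < j) (hK : j + l.length < K) : DefinedAt (l.map γ) x 0 ∧
      SignEq (applyWord (l.map γ) x 0)
        (twist (wordState l).2 (m (j + (wordState l).1).toNat)) := by
  induction l with
  | nil =>
    refine ⟨?_, ?_⟩
    · change (x 0).Normal
      rw [hx]
      exact h.normal (by omega)
    · simp only [wordState, List.foldr_nil, twist, if_true, add_zero, Int.toNat_natCast,
        List.map_nil, MPLR.applyWord, hx]
      exact SignEq.refl _
  | cons a l ih =>
    rw [List.length_cons] at h0 hK
    obtain ⟨h1, h2⟩ := ih (by omega) (by omega)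
    have h3 := abs_le.1 (abs_wordState_le l)
    obtain ⟨h4, h5⟩ := h.act_twist hγ hj a (n := (wordState l).1) (wordState l).2 (by omega)
      (by omega)
    simp only [List.map_cons, DefinedAt, applyWord_cons, timeMap_zero, wordState_cons]
    exact ⟨⟨h1, (h2.regular_iff _).2 h4⟩, (h2.act _).trans h5⟩

theorem wordState_eq_of_actsTrivially (hγ : γ = leftGen ∨ γ = rightGen) (hγ' : IsExtTriple γ)
    {l : List ExtGen} (hl : ActsTrivially γ l) : wordState l = (0, 1) := by
  obtain ⟨m, hm⟩ := exists_isChain hγ (2 * l.length + 2)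
  -- An even starting position with more than the length of the word on either side.
  set j := 2 * (l.length + 1) with hj
  have hje : Even (j : ℤ) := by simp [hj]
  obtain ⟨U, x, hx, h0, e⟩ := hm.solution j (by omega)
  obtain ⟨h1, h2⟩ := hm.applyWord hγ' hje e l (by omega) (by omega)
  have h3 := h2.symm.sameVars.trans (hl U x hx 0 h0 h1)
  have h4 := abs_le.1 (abs_wordState_le l)
  rw [e] at h3
  rcases perm_fin_two (wordState l).2 with he | he <;> rw [he] at h3
  · have h5 := hm.injective _ (by omega) _ (by omega) h3
    exact Prod.ext (by omega) he
  · exact (hm.pi _ (by omega) _ (by omega) (by omega) h3).elim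

theorem actsTrivially_iff (hγ : γ = leftGen ∨ γ = rightGen) (l : List ExtGen) :
    ActsTrivially γ l ↔ (l.map weylGen).prod = 1 := by
  have hγ' : IsExtTriple γ := by
    rcases hγ with rfl | rfl
    · exact isExtTriple_leftGen
    · exact isExtTriple_rightGen
  rw [prod_weylGen_eq_one_iff]
  exact ⟨wordState_eq_of_actsTrivially hγ hγ', hγ'.actsTrivially⟩

/-! ### The group of transformations -/

theorem weylGen_mul_self (a : ExtGen) : weylGen a * weylGen a = 1 := by
  cases a with
  | s i => rw [weylGen, ← map_mul, simple_mul_simple, map_one]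
  | pi => rw [weylGen, ← map_mul, Equiv.swap_mul_self, map_one]

theorem closure_range_weylGen : Subgroup.closure (Set.range weylGen) = ⊤ := by
  rw [eq_top_iff]
  rintro w -
  rw [← SemidirectProduct.inl_left_mul_inr_right w]
  refine mul_mem ?_ ?_
  · have h : ∀ v : AffineWeyl, (SemidirectProduct.inl v : ExtAffineWeyl) ∈
        Subgroup.closure (Set.range weylGen) := by
      intro v
      induction v using affineA1.toCoxeterSystem.simple_induction with
      | simple i =>
        rw [CoxeterMatrix.toCoxeterSystem_simple]
        exact Subgroup.subset_closure ⟨.s i, rfl⟩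
      | one => simp
      | mul v v' hv hv' =>
        rw [map_mul]
        exact mul_mem hv hv'
    exact h _
  · rcases perm_fin_two w.right with h | h <;> rw [h]
    · simp
    · exact Subgroup.subset_closure ⟨.pi, rfl⟩

/-- The transformation group, as a quotient of the free group, is the extended affine Weyl group. -/
theorem exists_mulEquiv (hγ : ∀ l, ActsTrivially γ l ↔ (l.map weylGen).prod = 1) :
    ∃ e : TransformationGroup γ ≃* ExtAffineWeyl, ∀ a, e (PresentedGroup.of a) = weylGen a := by
  have hlift : ∀ l : List ExtGen,
      FreeGroup.lift weylGen (l.map FreeGroup.of).prod = (l.map weylGen).prod := by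
    intro l
    rw [map_list_prod, List.map_map]
    congr 2
    ext1 a
    simp
  have hrel : ∀ w ∈ trivialWords γ, FreeGroup.lift weylGen w = 1 := by
    rintro w ⟨l, rfl, hl⟩
    rw [hlift, (hγ l).1 hl]
  have hmk : ∀ l : List ExtGen, PresentedGroup.mk (trivialWords γ) (l.map FreeGroup.of).prod =
      (l.map PresentedGroup.of).prod := by
    intro l
    rw [map_list_prod, List.map_map]
    rfl
  have hone : ∀ l : List ExtGen, (l.map weylGen).prod = 1 →
      (l.map (PresentedGroup.of (rels := trivialWords γ))).prod = 1 := by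
    intro l hl
    exact (hmk l).symm.trans
      (PresentedGroup.one_of_mem (rels := trivialWords γ) ⟨l, rfl, (hγ l).2 hl⟩)
  -- The relators are words without inverse letters. Since each generator squares to the identity,
  -- every element of the presented group is nevertheless represented by such a word.
  have hinv : ∀ a, (PresentedGroup.of (rels := trivialWords γ) a)⁻¹ = PresentedGroup.of a := by
    intro a
    have h := hone [a, a] (by simp [weylGen_mul_self])
    rw [inv_eq_iff_mul_eq_one]
    simpa using h
  have hword : ∀ g : TransformationGroup γ, ∃ l : List ExtGen,
      g = (l.map PresentedGroup.of).prod := by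
    intro g
    induction g using PresentedGroup.induction_on with
    | _ w =>
      induction w using FreeGroup.induction_on with
      | C1 => exact ⟨[], by simp⟩
      | of a => exact ⟨[a], by simp [PresentedGroup.of]⟩
      | inv_of a _ => exact ⟨[a], by rw [map_inv]; simpa [PresentedGroup.of] using hinv a⟩
      | mul v v' hv hv' =>
        obtain ⟨l, hl⟩ := hv
        obtain ⟨l', hl'⟩ := hv'
        exact ⟨l ++ l', by rw [map_mul, hl, hl', List.map_append, List.prod_append]⟩
  let f : TransformationGroup γ →* ExtAffineWeyl := PresentedGroup.toGroup hrel
  have hf : ∀ a, f (PresentedGroup.of a) = weylGen a := fun a => PresentedGroup.toGroup.of hrel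
  refine ⟨MulEquiv.ofBijective f ⟨?_, ?_⟩, hf⟩
  · rw [injective_iff_map_eq_one]
    intro g hg
    obtain ⟨l, rfl⟩ := hword g
    refine hone l ?_
    rw [map_list_prod, List.map_map] at hg
    rw [← hg]
    congr 2
    ext1 a
    exact (hf a).symm
  · rw [← MonoidHom.range_eq_top, eq_top_iff, ← closure_range_weylGen, Subgroup.closure_le]
    rintro _ ⟨a, rfl⟩
    exact ⟨_, hf a⟩

end MPLR

theorem theorem1 :
    -- each transformation maps normal triples to normal triples, where it is defined
    (∀ (g : MPLR.Gen) (m : MPLR.Triple), m.Normal → MPLR.Regular g m →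
      (MPLR.act g m).Normal ∧ MPLR.Regular g (MPLR.act g m)) ∧
    -- the transformations map solutions of the Sato–Wilson equations to solutions
    (∀ (g : MPLR.Gen) (N : Set ℕ+) (U : Set MPLR.Times) (x : MPLR.Times → MPLR.Triple),
      MPLR.SolutionOn N U x → MPLR.SolutionOn N (MPLR.domain g U x) (MPLR.apply g x)) ∧
    -- relations on `q, r, q̄, r̄`, and on `φ` with the sign in the last argument
    (MPLR.Rel [.sigma, .sigma] [] 1 ∧
      MPLR.Rel [.pi, .pi] [] 1 ∧
      (∀ i, MPLR.Rel [.sL i, .sL i] [] (-1)) ∧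
      (∀ i, MPLR.Rel [.sR i, .sR i] [] (-1)) ∧
      (∀ i, MPLR.Rel [.sL i, .sL i, .sL i, .sL i] [] 1) ∧
      (∀ i, MPLR.Rel [.sR i, .sR i, .sR i, .sR i] [] 1) ∧
      MPLR.Rel [.pi, .sL 0] [.sL 1, .pi] (-1) ∧
      MPLR.Rel [.pi, .sR 0] [.sR 1, .pi] (-1) ∧
      MPLR.Rel [.sigma, .sL 0] [.sR 1, .sigma] (-1) ∧
      MPLR.Rel [.sigma, .sL 1] [.sR 0, .sigma] (-1)) ∧
    -- on `q, r, q̄, r̄` the left (right) transformations and `π` generate the extended affine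
    -- Weyl group of type `A_1^{(1)}`, with `s_0, s_1, π` as its standard generators
    (∀ γ ∈ ({MPLR.leftGen, MPLR.rightGen} : Set (MPLR.ExtGen → MPLR.Gen)),
      (∀ l : List MPLR.ExtGen, MPLR.ActsTrivially γ l ↔ (l.map MPLR.weylGen).prod = 1) ∧
      ∃ e : MPLR.TransformationGroup γ ≃* MPLR.ExtAffineWeyl,
        ∀ a, e (PresentedGroup.of a) = MPLR.weylGen a) := by
  obtain ⟨h1, h2, h3, h4, h5, h6, h7, h8, h9⟩ := MPLR.rel_all
  exact ⟨fun g m h hg => ⟨MPLR.normal_act h hg, MPLR.regular_act h hg⟩,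
    fun g N U x h => h.apply g,
    ⟨h1, h2, h3, h4, h5, h6, h7 0, h8 0, h9 0, h9 1⟩,
    fun γ hγ => ⟨MPLR.actsTrivially_iff hγ, MPLR.exists_mulEquiv (MPLR.actsTrivially_iff hγ)⟩⟩

end
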